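/- **Setting.** Let $G=(V,E)$ be a connected, locally finite graph with positive symmetric edge weights $\omega_{xy}=\omega_{yx}>0$ and a vertex measure $\mu:V\to(0,\infty)$ with $\mu(x)\ge\mu_0>0$ for all $x$, and suppose that $\sum_{y\sim x}\omega_{xy}<C$ for all $x\in V$ with a constant $C$. Write $\int_V\psi\,d\mu=\sum_{x\in V}\mu(x)\psi(x)$, $\|\psi\|_\theta=(\int_V|\psi|^\theta d\mu)^{1/\theta}$, $\|\psi\|_\infty=\sup_V|\psi|$, $$\Gamma(\psi_1,\psi_2)(x)=\frac1{2\mu(x)}\sum_{y\sim x}\omega_{xy}(\psi_1(y)-\psi_1(x))(\psi_2(y)-\psi_2(x)),\qquad |\nabla\psi|=\sqrt{\Gamma(\psi,\psi)} .$$ Let $0<\gamma<1<q\le p<\alpha+1$, let $a,b:V\to\mathbb R$ satisfy $a\ge a_0>0$ and $b\ge b_0>0$, let $f>0$ on $V$, $f\in L^1(V)\cap L^{p/(p-1+\gamma)}(V)\cap L^{q/(q-1+\gamma)}(V)$, and let $g\ge0$, $g\not\equiv0$, $g\in L^1(V)\cap L^\infty(V)$. For $s>1$ and a potential $h$, let $W^{1,s}_h(V)$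 be the set of $u:V\to\mathbb R$ with $\int_V(|\nabla u|^s+|u|^s)d\mu<\infty$ and $\int_V h|u|^sd\mu<\infty$, with norm $\|u\|_{W_h^{1,s}}=(\int_V(|\nabla u|^s+h|u|^s)d\mu)^{1/s}$. Put $W=W_a^{1,p}(V)\cap W_b^{1,q}(V)$, $\|u\|_W=\|u\|_{W_a^{1,p}}+\|u\|_{W_b^{1,q}}$, $W_+=\{u\in W:u\ge0\}$. A *positive (weak) solution* of $$-\Delta_pu-\Delta_qu+a u^{p-1}+b u^{q-1}=f u^{-\gamma}+\lambda g u^\alpha \quad\text{in } V \tag{1}$$ is a $u\in W$ with $u(x)>0$ for all $x\in V$ such that for every $\phi\in W$ the following integrals converge and $$\int_V(|\nabla u|^{p-2}\Gamma(u,\phi)+a u^{p-1}\phi)d\mu+\int_V(|\nabla u|^{q-2}\Gamma(u,\phi)+b u^{q-1}\phi)d\mu=\int_V f u^{-\gamma}\phi\,d\mu+\lambda\int_V g u^\alpha\phi\,d\mu ,$$ where $|\nabla u|^{s-2}\Gamma(u,\phi)$ is read as $0$ where $|\nabla u|=0$. For $u\in W_+$ and $t>0$ let $$\varphi_u(t)=t^{p-1+\gamma}\|u\|_{W_a^{1,p}}^p+t^{q-1+\gamma}\|u\|_{W_b^{1,q}}^q-\int_V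 f u^{1-\gamma}d\mu-\lambda t^{\alpha+\gamma}\int_V g u^{\alpha+1}d\mu ,$$ let $\mathcal D_\lambda=\{tu: u\in W_+,\ t>0,\ \varphi_u(t)=0\}$, and let $\mathcal D^+_\lambda$ (respectively $\mathcal D^-_\lambda$) be the set of all $v\in\mathcal D_\lambda$ for which $$(p-1+\gamma)\|v\|_{W_a^{1,p}}^p+(q-1+\gamma)\|v\|_{W_b^{1,q}}^q-(\alpha+\gamma)\lambda\int_V g v^{\alpha+1}d\mu$$ is positive (respectively negative). With $N=\|f\|_{p/(p-1+\gamma)}$ define $$X(\lambda)=\left(\frac{p-1+\gamma}{\lambda(\alpha+\gamma)\|g\|_\infty\mu_0^{\frac{p-1-\alpha}p}a_0^{-\frac{\alpha+1}p}}\right)^{\frac1{\alpha+1-p}},\qquad X_0=\left(\frac{\alpha+\gamma}{\alpha+1-p}\right)^{\frac1{p-1+\gamma}}a_0^{-\frac{1-\gamma}{p(p-1+\gamma)}}N^{\frac1{p-1+\gamma}},$$ $$S(\lambda)=\left(\frac{p-1+\gamma}{\lambda(\alpha+\gamma)}\right)^{\frac1{\alpha+1-p}}\left(\frac1{\mu_0}\right)^{-\frac1{\alpha+1}}a_0^{\frac1{\alpha+1-p}}\left(\frac1{\|g\|_\infty}\right)^{\frac1{\alpha+1-p}},$$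 $$S_0=\left(\frac{\alpha+\gamma}{\alpha+1-p}\right)^{\frac1{p-1+\gamma}}\left(\frac1{\mu_0}\right)^{\frac{\alpha+1-p}{p(\alpha+1)}}a_0^{-\frac1{p-1+\gamma}}N^{\frac1{p-1+\gamma}},$$ $$\Lambda_*=\left(\frac{p+\gamma-1}{\alpha+\gamma}\right)^{\frac{\alpha+\gamma}{p+\gamma-1}}\left(\frac{\alpha+1-p}{p-1+\gamma}\right)^{\frac{\alpha+1-p}{p+\gamma-1}}\frac1{\|g\|_\infty}\,\mu_0^{\frac{\alpha+1-p}p}a_0^{\frac{\alpha+\gamma}{p-1+\gamma}}\left(\frac1N\right)^{\frac{\alpha+1-p}{p+\gamma-1}} .$$ **Theorem 1.1.** Let $0<\lambda<\Lambda_*$. Then (1) has at least two positive weak solutions, $u_\lambda\in\mathcal D^+_\lambda$ and $v_\lambda\in\mathcal D^-_\lambda$, with $u_\lambda\neq v_\lambda$, $$\|v_\lambda\|_{W_a^{1,p}}>X(\lambda)>X_0>\|u_\lambda\|_{W_a^{1,p}},\qquad \|v_\lambda\|_{\alpha+1}>S(\lambda)>S_0>\|u_\lambda\|_{\alpha+1},$$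 and $\|v_\lambda\|_W>\|v_\lambda\|_{W_a^{1,p}}$. Moreover, $\|v_\lambda\|_W>\|v_\lambda\|_{W_a^{1,p}}>X(\lambda)\to+\infty$ as $p\to\alpha+1$ with all other data fixed: for every $M$ there is $\delta>0$ such that for all admissible $p\in(\alpha+1-\delta,\alpha+1)$ and all $\lambda\in(0,\Lambda_*)$, where $\Lambda_*$ and $X(\lambda)$ are those belonging to $p$, one has $X(\lambda)>M$, and every $v\in\mathcal D^-_\lambda$, in particular $v_\lambda$, satisfies $\|v\|_W>\|v\|_{W_a^{1,p}}>X(\lambda)$. -/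

import Mathlib

/-- A symmetric, locally finite weighted graph on the vertex set `V`: positive symmetric weights
on the edges and a positive (finite) measure on the vertices. -/
structure WeightedGraph (V : Type*) where
  graph : SimpleGraph V
  finite_neighbors : ∀ x, (graph.neighborSet x).Finite
  weight : V → V → ℝ
  weight_pos : ∀ x y, graph.Adj x y → 0 < weight x y
  weight_symm : ∀ x y, graph.Adj x y → weight x y = weight y x
  meas : V → ℝ
  meas_pos : ∀ x, 0 < meas x

namespace WeightedGraph

noncomputable section

/-- The finite set of vertices `y ∼ x`. -/
def nbhd {V : Type*} (G : WeightedGraph V) (x : V) : Finset V :=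
  (G.finite_neighbors x).toFinset

/-- `∑_{y ∼ x} ω_{xy}`. -/
def weightSum {V : Type*} (G : WeightedGraph V) (x : V) : ℝ :=
  ∑ y ∈ G.nbhd x, G.weight x y

/-- `ψ` is integrable on `V`. -/
def Integrable {V : Type*} (G : WeightedGraph V) (ψ : V → ℝ) : Prop :=
  Summable fun x => G.meas x * ψ x

/-- `∫_V ψ dμ = ∑_{x ∈ V} μ(x) ψ(x)`. -/
def integral {V : Type*} (G : WeightedGraph V) (ψ : V → ℝ) : ℝ :=
  ∑' x, G.meas x * ψ x

/-- `Γ(ψ₁, ψ₂)(x)`. -/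
def Gam {V : Type*} (G : WeightedGraph V) (ψ₁ ψ₂ : V → ℝ) (x : V) : ℝ :=
  1 / (2 * G.meas x) * ∑ y ∈ G.nbhd x, G.weight x y * (ψ₁ y - ψ₁ x) * (ψ₂ y - ψ₂ x)

/-- The length `|∇ψ|(x)` of the gradient. -/
def gradLen {V : Type*} (G : WeightedGraph V) (ψ : V → ℝ) (x : V) : ℝ :=
  Real.sqrt (G.Gam ψ ψ x)

/-- `ψ ∈ L^θ(V)` for finite `θ`. -/
def MemL {V : Type*} (G : WeightedGraph V) (θ : ℝ) (ψ : V → ℝ) : Prop :=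
  G.Integrable fun x => |ψ x| ^ θ

/-- The norm of `L^θ(V)` for finite `θ`. -/
def normL {V : Type*} (G : WeightedGraph V) (θ : ℝ) (ψ : V → ℝ) : ℝ :=
  (G.integral fun x => |ψ x| ^ θ) ^ (1 / θ)

/-- `u ∈ W^{1,s}_h(V)`, where `h` is the potential. -/
def MemW {V : Type*} (G : WeightedGraph V) (s : ℝ) (h u : V → ℝ) : Prop :=
  (G.Integrable fun x => G.gradLen u x ^ s + |u x| ^ s) ∧
    G.Integrable fun x => h x * |u x| ^ s

/-- The norm of `W^{1,s}_h(V)`. -/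
def normW {V : Type*} (G : WeightedGraph V) (s : ℝ) (h u : V → ℝ) : ℝ :=
  (G.integral fun x => G.gradLen u x ^ s + h x * |u x| ^ s) ^ (1 / s)

/-- The space `W = W^{1,p}_a(V) ∩ W^{1,q}_b(V)`. -/
def spaceW {V : Type*} (G : WeightedGraph V) (p q : ℝ) (a b : V → ℝ) : Set (V → ℝ) :=
  {u | G.MemW p a u ∧ G.MemW q b u}

/-- The norm of `W`. -/
def normWW {V : Type*} (G : WeightedGraph V) (p q : ℝ) (a b u : V → ℝ) : ℝ :=
  G.normW p a u + G.normW q b u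

/-- The cone `W₊` of non-negative functions in `W`. -/
def coneW {V : Type*} (G : WeightedGraph V) (p q : ℝ) (a b : V → ℝ) : Set (V → ℝ) :=
  {u | u ∈ G.spaceW p q a b ∧ ∀ x, 0 ≤ u x}

/-- `u` is a (strictly positive) weak solution in `W` of
`-Δ_p u - Δ_q u + a u^{p-1} + b u^{q-1} = f u^{-γ} + lam g u^α`;
every integral in the weak formulation is required to converge. At a vertex where `|∇u| = 0` also
`Γ(u, φ) = 0`, so the product `|∇u|^{s-2} Γ(u, φ)` is zero there, as usual when `s < 2`. -/
def IsWeakSolution {V : Type*} (G : WeightedGraph V) (p q γ α lam : ℝ) (a b f g : V → ℝ)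
    (u : V → ℝ) : Prop :=
  u ∈ G.spaceW p q a b ∧ (∀ x, 0 < u x) ∧
    ∀ φ ∈ G.spaceW p q a b,
      (G.Integrable fun x => G.gradLen u x ^ (p - 2) * G.Gam u φ x + a x * u x ^ (p - 1) * φ x) ∧
      (G.Integrable fun x => G.gradLen u x ^ (q - 2) * G.Gam u φ x + b x * u x ^ (q - 1) * φ x) ∧
      (G.Integrable fun x => f x * u x ^ (-γ) * φ x) ∧
      (G.Integrable fun x => g x * u x ^ α * φ x) ∧
      (G.integral fun x => G.gradLen u x ^ (p - 2) * G.Gam u φ x + a x * u x ^ (p - 1) * φ x)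
        + (G.integral fun x =>
            G.gradLen u x ^ (q - 2) * G.Gam u φ x + b x * u x ^ (q - 1) * φ x)
      = (G.integral fun x => f x * u x ^ (-γ) * φ x)
        + lam * G.integral fun x => g x * u x ^ α * φ x

/-- The fibering function `φ_u(t) = t^γ (d/dt) J_lam(t u)` for `u ∈ W₊` and `t > 0`. -/
def fiber {V : Type*} (G : WeightedGraph V) (p q γ α lam : ℝ) (a b f g : V → ℝ)
    (u : V → ℝ) (t : ℝ) : ℝ :=
  t ^ (p - 1 + γ) * G.normW p a u ^ p + t ^ (q - 1 + γ) * G.normW q b u ^ q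
    - (G.integral fun x => f x * u x ^ (1 - γ))
    - lam * t ^ (α + γ) * G.integral fun x => g x * u x ^ (α + 1)

/-- The Nehari manifold: all `t u` with `u ∈ W₊` and `t > 0` a zero of `φ_u`. -/
def nehari {V : Type*} (G : WeightedGraph V) (p q γ α lam : ℝ) (a b f g : V → ℝ) :
    Set (V → ℝ) :=
  {v | ∃ u ∈ G.coneW p q a b, ∃ t : ℝ, 0 < t ∧ G.fiber p q γ α lam a b f g u t = 0 ∧ v = t • u}

/-- The quantity whose sign splits the Nehari manifold. -/
def nehariSign {V : Type*} (G : WeightedGraph V) (p q γ α lam : ℝ) (a b g : V → ℝ)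
    (v : V → ℝ) : ℝ :=
  (p - 1 + γ) * G.normW p a v ^ p + (q - 1 + γ) * G.normW q b v ^ q
    - (α + γ) * lam * G.integral fun x => g x * v x ^ (α + 1)

/-- The submanifold `D⁺`. -/
def nehariPlus {V : Type*} (G : WeightedGraph V) (p q γ α lam : ℝ) (a b f g : V → ℝ) :
    Set (V → ℝ) :=
  {v | v ∈ G.nehari p q γ α lam a b f g ∧ 0 < G.nehariSign p q γ α lam a b g v}

/-- The submanifold `D⁻`. -/
def nehariMinus {V : Type*} (G : WeightedGraph V) (p q γ α lam : ℝ) (a b f g : V → ℝ) :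
    Set (V → ℝ) :=
  {v | v ∈ G.nehari p q γ α lam a b f g ∧ G.nehariSign p q γ α lam a b g v < 0}

end

end WeightedGraph

noncomputable section

/-- The norm of `L^∞(V)`. -/
def supNorm {V : Type*} (ψ : V → ℝ) : ℝ := ⨆ x, |ψ x|

/-- `ψ ∈ L^∞(V)`. -/
def MemLinfty {V : Type*} (ψ : V → ℝ) : Prop := BddAbove (Set.range fun x => |ψ x|)

/-- `X(lam)`; `Ng` stands for `‖g‖_∞`. -/
def boundX (p γ α μ₀ a₀ Ng lam : ℝ) : ℝ :=
  ((p - 1 + γ) /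
      (lam * (α + γ) * Ng * μ₀ ^ ((p - 1 - α) / p) * a₀ ^ (-((α + 1) / p))))
    ^ (1 / (α + 1 - p))

/-- `X₀`; `Nf` stands for the norm of `f` in `L^{p/(p-1+γ)}(V)`. -/
def boundX₀ (p γ α a₀ Nf : ℝ) : ℝ :=
  ((α + γ) / (α + 1 - p)) ^ (1 / (p - 1 + γ)) * a₀ ^ (-((1 - γ) / (p * (p - 1 + γ))))
    * Nf ^ (1 / (p - 1 + γ))

/-- `S(lam)`. -/
def boundS (p γ α μ₀ a₀ Ng lam : ℝ) : ℝ :=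
  ((p - 1 + γ) / (lam * (α + γ))) ^ (1 / (α + 1 - p)) * (1 / μ₀) ^ (-(1 / (α + 1)))
    * a₀ ^ (1 / (α + 1 - p)) * (1 / Ng) ^ (1 / (α + 1 - p))

/-- `S₀`. -/
def boundS₀ (p γ α μ₀ a₀ Nf : ℝ) : ℝ :=
  ((α + γ) / (α + 1 - p)) ^ (1 / (p - 1 + γ)) * (1 / μ₀) ^ ((α + 1 - p) / (p * (α + 1)))
    * a₀ ^ (-(1 / (p - 1 + γ))) * Nf ^ (1 / (p - 1 + γ))

/-- The threshold `Λ_*`. -/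
def lamStar (p γ α μ₀ a₀ Nf Ng : ℝ) : ℝ :=
  ((p + γ - 1) / (α + γ)) ^ ((α + γ) / (p + γ - 1))
    * ((α + 1 - p) / (p - 1 + γ)) ^ ((α + 1 - p) / (p + γ - 1)) * (1 / Ng)
    * μ₀ ^ ((α + 1 - p) / p) * a₀ ^ ((α + γ) / (p - 1 + γ))
    * (1 / Nf) ^ ((α + 1 - p) / (p + γ - 1))

end

section Scalar

lemma mul_rpow_sub_one_mul_le {s x y : ℝ} (hs : 1 < s) (hx : 0 ≤ x) (hy : 0 ≤ y) :
    s * (x ^ (s - 1) * y) ≤ (s - 1) * x ^ s + y ^ s := by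
  have hs0 : 0 < s := by linarith
  have hs1 : 0 < s - 1 := by linarith
  have h := Real.young_inequality_of_nonneg hy (Real.rpow_nonneg hx (s - 1))
    (Real.HolderConjugate.conjExponent hs)
  have e : (x ^ (s - 1)) ^ (s.conjExponent) = x ^ s := by
    rw [← Real.rpow_mul hx, Real.conjExponent]
    congr 1
    field_simp
  rw [e, Real.conjExponent] at h
  have h2 : s * (y * x ^ (s - 1)) ≤ s * (y ^ s / s + x ^ s / (s / (s - 1))) :=
    mul_le_mul_of_nonneg_left h hs0.le
  have e2 : s * (y ^ s / s + x ^ s / (s / (s - 1))) = (s - 1) * x ^ s + y ^ s := by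
    field_simp
    ring
  rw [e2] at h2
  linarith [mul_comm y (x ^ (s - 1))]

lemma rpow_sub_one_mul_le_add {s x y : ℝ} (hs : 1 < s) (hx : 0 ≤ x) (hy : 0 ≤ y) :
    x ^ (s - 1) * y ≤ x ^ s + y ^ s := by
  have h := mul_rpow_sub_one_mul_le hs hx hy
  have h1 := Real.rpow_nonneg hx s
  have h2 := Real.rpow_nonneg hy s
  have h3 : s * (x ^ (s - 1) * y) ≤ s * (x ^ s + y ^ s) := by nlinarith
  exact le_of_mul_le_mul_left h3 (by linarith)

lemma rpow_add_mul_le_rpow {s x y : ℝ} (hs : 1 < s) (hx : 0 ≤ x) (hy : 0 ≤ y) :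
    x ^ s + s * (x ^ (s - 1) * y) ≤ (x + y) ^ s := by
  have h := mul_rpow_sub_one_mul_le hs hx (add_nonneg hx hy)
  have e : x ^ (s - 1) * x = x ^ s := by
    rcases hx.eq_or_lt with rfl | hx
    · rw [mul_zero, Real.zero_rpow (by linarith)]
    · rw [← Real.rpow_add_one hx.ne']
      ring_nf
  nlinarith

lemma rpow_add_mul_le_rpow_of_lt_one {γ x y : ℝ} (hγ0 : 0 < γ) (hγ1 : γ < 1) (hx : 0 ≤ x)
    (hy : 0 ≤ y) : x ^ (1 - γ) + (1 - γ) * ((x + y) ^ (-γ) * y) ≤ (x + y) ^ (1 - γ) := by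
  rcases hy.eq_or_lt with rfl | hy
  · simp
  have hw : 0 < x + y := by linarith
  have hb := rpow_one_add_le_one_add_mul_self (s := x / (x + y) - 1) (p := 1 - γ)
    (by have : 0 ≤ x / (x + y) := by positivity
        linarith) (by linarith) (by linarith)
  have e1 : 1 + (x / (x + y) - 1) = x / (x + y) := by ring
  rw [e1, Real.div_rpow hx hw.le, div_le_iff₀ (by positivity)] at hb
  have e2 : (x + y) ^ (1 - γ) = (x + y) ^ (-γ) * (x + y) := by
    rw [← Real.rpow_add_one hw.ne']; ring_nf
  have e3 : (1 + (1 - γ) * (x / (x + y) - 1)) * (x + y) ^ (1 - γ)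
      = (x + y) ^ (1 - γ) - (1 - γ) * ((x + y) ^ (-γ) * y) := by
    have : x / (x + y) - 1 = - y / (x + y) := by field_simp; ring
    rw [this, e2]
    field_simp
    ring
  linarith

/-- The fibering function with coefficients `P, Q, F, Z`. -/
noncomputable def fibFn (p q γ α P Q F Z t : ℝ) : ℝ :=
  t ^ (p - 1 + γ) * P + t ^ (q - 1 + γ) * Q - F - t ^ (α + γ) * Z

/-- The energy along a ray, with coefficients `P, Q, F, Z`. -/
noncomputable def rayFn (p q γ α P Q F Z t : ℝ) : ℝ :=
  t ^ p / p * P + t ^ q / q * Q - t ^ (1 - γ) / (1 - γ) * F - t ^ (α + 1) / (α + 1) * Z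

variable {p q γ α P Q F Z : ℝ}

lemma fibFn_one : fibFn p q γ α P Q F Z 1 = P + Q - F - Z := by
  simp [fibFn]

lemma continuous_rayFn (hγ1 : γ < 1) (hq : 1 < q) (hqp : q ≤ p) (hpα : p < α + 1) :
    Continuous (rayFn p q γ α P Q F Z) := by
  unfold rayFn
  have h1 : Continuous fun t : ℝ => t ^ p := Real.continuous_rpow_const (by linarith)
  have h2 : Continuous fun t : ℝ => t ^ q := Real.continuous_rpow_const (by linarith)
  have h3 : Continuous fun t : ℝ => t ^ (1 - γ) := Real.continuous_rpow_const (by linarith)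
  have h4 : Continuous fun t : ℝ => t ^ (α + 1) := Real.continuous_rpow_const (by linarith)
  fun_prop

lemma continuous_fibFn (hγ0 : 0 < γ) (hq : 1 < q) (hqp : q ≤ p) (hpα : p < α + 1) :
    Continuous (fibFn p q γ α P Q F Z) := by
  unfold fibFn
  have h1 : Continuous fun t : ℝ => t ^ (p - 1 + γ) := Real.continuous_rpow_const (by linarith)
  have h2 : Continuous fun t : ℝ => t ^ (q - 1 + γ) := Real.continuous_rpow_const (by linarith)
  have h4 : Continuous fun t : ℝ => t ^ (α + γ) := Real.continuous_rpow_const (by linarith)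
  fun_prop

lemma hasDerivAt_rayFn (hγ1 : γ < 1) (hq : 1 < q) (hqp : q ≤ p) (hpα : p < α + 1)
    {t : ℝ} (ht : 0 < t) :
    HasDerivAt (rayFn p q γ α P Q F Z) (t ^ (-γ) * fibFn p q γ α P Q F Z t) t := by
  have hd : ∀ s : ℝ, s ≠ 0 → HasDerivAt (fun t : ℝ => t ^ s / s) (t ^ (s - 1)) t := fun s hs => by
    have := (Real.hasDerivAt_rpow_const (x := t) (p := s) (Or.inl ht.ne')).div_const s
    rwa [mul_div_assoc, mul_comm, div_mul_cancel₀ _ hs] at this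
  have h := ((((hd p (by linarith)).mul_const P).add ((hd q (by linarith)).mul_const Q)).sub
    ((hd (1 - γ) (by linarith)).mul_const F)).sub ((hd (α + 1) (by linarith)).mul_const Z)
  have e : ∀ s : ℝ, t ^ (-γ) * t ^ s = t ^ (-γ + s) := fun s => (Real.rpow_add ht _ _).symm
  refine h.congr_deriv ?_
  rw [fibFn, mul_sub, mul_sub, mul_add, ← mul_assoc, ← mul_assoc, ← mul_assoc, e, e, e]
  ring_nf

lemma fibFn_le_tangent (hγ0 : 0 < γ) (hq : 1 < q) (hqp : q ≤ p) (hpα : p < α + 1)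
    (hQ : 0 ≤ Q) (hZ : 0 ≤ Z) {t : ℝ} (ht : 0 < t) :
    fibFn p q γ α P Q F Z t ≤ fibFn p q γ α P Q F Z 1 + (t ^ (p - 1 + γ) - 1) *
      (((p - 1 + γ) * P + (q - 1 + γ) * Q - (α + γ) * Z) / (p - 1 + γ)) := by
  have hk : 0 < p - 1 + γ := by linarith
  have hs : 0 < t ^ (p - 1 + γ) := by positivity
  have e : ∀ r : ℝ, t ^ r = (1 + (t ^ (p - 1 + γ) - 1)) ^ (r / (p - 1 + γ)) := fun r => by
    rw [add_sub_cancel, ← Real.rpow_mul ht.le]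
    congr 1
    field_simp
  have h1 : t ^ (q - 1 + γ) ≤ 1 + (q - 1 + γ) / (p - 1 + γ) * (t ^ (p - 1 + γ) - 1) := by
    rw [e (q - 1 + γ)]
    refine rpow_one_add_le_one_add_mul_self (by linarith) (div_nonneg (by linarith) hk.le) ?_
    rw [div_le_one hk]; linarith
  have h2 : 1 + (α + γ) / (p - 1 + γ) * (t ^ (p - 1 + γ) - 1) ≤ t ^ (α + γ) := by
    rw [e (α + γ)]
    refine one_add_mul_self_le_rpow_one_add (by linarith) ?_
    rw [one_le_div hk]; linarith
  rw [fibFn_one, fibFn]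
  have h3 := mul_le_mul_of_nonneg_right h1 hQ
  have h4 := mul_le_mul_of_nonneg_right h2 hZ
  have e5 : (t ^ (p - 1 + γ) - 1) *
      (((p - 1 + γ) * P + (q - 1 + γ) * Q - (α + γ) * Z) / (p - 1 + γ)) =
      (t ^ (p - 1 + γ) - 1) * P + (q - 1 + γ) / (p - 1 + γ) * (t ^ (p - 1 + γ) - 1) * Q
      - (α + γ) / (p - 1 + γ) * (t ^ (p - 1 + γ) - 1) * Z := by
    field_simp
  rw [e5]
  nlinarith

lemma fibSlope_neg (hγ0 : 0 < γ) (hq : 1 < q) (hqp : q ≤ p) (hpα : p < α + 1)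
    (hQ : 0 ≤ Q) (hZ : 0 ≤ Z) (h1 : fibFn p q γ α P Q F Z 1 = 0) {t : ℝ} (ht0 : 0 < t)
    (ht1 : t < 1) (ht : 0 < fibFn p q γ α P Q F Z t) :
    (p - 1 + γ) * P + (q - 1 + γ) * Q - (α + γ) * Z < 0 := by
  have hk : 0 < p - 1 + γ := by linarith
  have h := fibFn_le_tangent (P := P) (F := F) hγ0 hq hqp hpα hQ hZ ht0
  have hlt : t ^ (p - 1 + γ) < 1 := Real.rpow_lt_one ht0.le ht1 hk
  by_contra! hc
  have := div_nonneg hc hk.le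
  nlinarith

lemma fibSlope_pos (hγ0 : 0 < γ) (hq : 1 < q) (hqp : q ≤ p) (hpα : p < α + 1)
    (hQ : 0 ≤ Q) (hZ : 0 ≤ Z) (h1 : fibFn p q γ α P Q F Z 1 = 0) {t : ℝ}
    (ht1 : 1 < t) (ht : 0 < fibFn p q γ α P Q F Z t) :
    0 < (p - 1 + γ) * P + (q - 1 + γ) * Q - (α + γ) * Z := by
  have hk : 0 < p - 1 + γ := by linarith
  have h := fibFn_le_tangent (P := P) (F := F) hγ0 hq hqp hpα hQ hZ (by linarith : 0 < t)
  have hlt : 1 < t ^ (p - 1 + γ) := Real.one_lt_rpow ht1 hk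
  by_contra! hc
  have := div_nonpos_of_nonpos_of_nonneg hc hk.le
  nlinarith

lemma fibFn_nonneg_of_mem_Icc (hγ0 : 0 < γ) (hq : 1 < q) (hqp : q ≤ p)
    (hpα : p < α + 1) (hQ : 0 ≤ Q) (hZ : 0 ≤ Z) {r s t : ℝ} (hr : 0 < r)
    (hfr : 0 ≤ fibFn p q γ α P Q F Z r) (hfs : 0 ≤ fibFn p q γ α P Q F Z s)
    (ht : t ∈ Set.Icc r s) : 0 ≤ fibFn p q γ α P Q F Z t := by
  have hk : 0 < p - 1 + γ := by linarith
  set Φ : ℝ → ℝ := fun z =>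
    z * P + z ^ ((q - 1 + γ) / (p - 1 + γ)) * Q - F - z ^ ((α + γ) / (p - 1 + γ)) * Z with hΦ
  have e : ∀ t : ℝ, 0 < t → fibFn p q γ α P Q F Z t = Φ (t ^ (p - 1 + γ)) := fun t ht => by
    simp only [hΦ, fibFn]
    rw [← Real.rpow_mul ht.le, ← Real.rpow_mul ht.le]
    congr 5 <;> field_simp
  have c1 : ConcaveOn ℝ (Set.Ici 0) fun z : ℝ => z ^ ((q - 1 + γ) / (p - 1 + γ)) :=
    Real.concaveOn_rpow (div_nonneg (by linarith) hk.le) (by rw [div_le_one hk]; linarith)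
  have c2 : ConvexOn ℝ (Set.Ici 0) fun z : ℝ => z ^ ((α + γ) / (p - 1 + γ)) :=
    convexOn_rpow (by rw [one_le_div hk]; linarith)
  have hc : ConcaveOn ℝ (Set.Ici 0) Φ := by
    refine ⟨convex_Ici 0, fun x hx y hy a b ha hb hab => ?_⟩
    have h1 := mul_le_mul_of_nonneg_right (c1.2 hx hy ha hb hab) hQ
    have h2 := mul_le_mul_of_nonneg_right (c2.2 hx hy ha hb hab) hZ
    simp only [smul_eq_mul, hΦ] at h1 h2 ⊢
    have : F = a * F + b * F := by rw [← add_mul, hab, one_mul]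
    nlinarith
  have ht0 : 0 < t := hr.trans_le ht.1
  have hs0 : 0 < s := ht0.trans_le ht.2
  have hm := hc.min_le_of_mem_Icc (x := r ^ (p - 1 + γ)) (y := s ^ (p - 1 + γ))
    (z := t ^ (p - 1 + γ)) (by simp only [Set.mem_Ici]; positivity)
    (by simp only [Set.mem_Ici]; positivity)
    ⟨Real.rpow_le_rpow hr.le ht.1 hk.le, Real.rpow_le_rpow ht0.le ht.2 hk.le⟩
  rw [← e r hr, ← e s hs0, ← e t ht0] at hm
  exact (le_min hfr hfs).trans hm

lemma rayFn_le_rayFn_one (hγ0 : 0 < γ) (hγ1 : γ < 1) (hq : 1 < q) (hqp : q ≤ p)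
    (hpα : p < α + 1) (hQ : 0 ≤ Q) (hZ : 0 ≤ Z) (h1 : fibFn p q γ α P Q F Z 1 = 0) {r t : ℝ}
    (hr : 0 < r) (hr1 : r < 1) (hfr : 0 < fibFn p q γ α P Q F Z r) (ht : r ≤ t) :
    rayFn p q γ α P Q F Z t ≤ rayFn p q γ α P Q F Z 1 := by
  have hk : 0 < p - 1 + γ := by linarith
  have hcont := continuous_rayFn (P := P) (Q := Q) (F := F) (Z := Z) hγ1 hq hqp hpα
  rcases le_total t 1 with h | h
  · have hmono : MonotoneOn (rayFn p q γ α P Q F Z) (Set.Icc r 1) := by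
      refine monotoneOn_of_deriv_nonneg (convex_Icc r 1) hcont.continuousOn ?_ ?_ <;>
        intro x hx <;> rw [interior_Icc] at hx
      · exact (hasDerivAt_rayFn hγ1 hq hqp hpα (hr.trans hx.1)).differentiableAt
          |>.differentiableWithinAt
      · rw [(hasDerivAt_rayFn hγ1 hq hqp hpα (hr.trans hx.1)).deriv]
        refine mul_nonneg (Real.rpow_nonneg (hr.trans hx.1).le _) ?_
        exact fibFn_nonneg_of_mem_Icc hγ0 hq hqp hpα hQ hZ hr hfr.le h1.ge
          ⟨hx.1.le, hx.2.le⟩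
    exact hmono ⟨ht, h⟩ ⟨hr1.le, le_rfl⟩ h
  · have hneg := fibSlope_neg hγ0 hq hqp hpα hQ hZ h1 hr hr1 hfr
    have hanti : AntitoneOn (rayFn p q γ α P Q F Z) (Set.Ici 1) := by
      refine antitoneOn_of_deriv_nonpos (convex_Ici 1) hcont.continuousOn ?_ ?_ <;>
        intro x hx <;> rw [interior_Ici] at hx <;>
        have hx0 : 0 < x := one_pos.trans hx
      · exact (hasDerivAt_rayFn hγ1 hq hqp hpα hx0).differentiableAt.differentiableWithinAt
      · rw [(hasDerivAt_rayFn hγ1 hq hqp hpα hx0).deriv]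
        refine mul_nonpos_of_nonneg_of_nonpos (Real.rpow_nonneg hx0.le _) ?_
        have h2 := fibFn_le_tangent (P := P) (F := F) hγ0 hq hqp hpα hQ hZ hx0
        have h3 : 1 < x ^ (p - 1 + γ) := Real.one_lt_rpow hx hk
        have h4 := div_neg_of_neg_of_pos hneg hk
        nlinarith
    exact hanti Set.self_mem_Ici h h

end Scalar

namespace WeightedGraph

open Filter Topology

section Gradient

variable {V : Type*} (G : WeightedGraph V)

lemma mem_nbhd {x y : V} : y ∈ G.nbhd x ↔ G.graph.Adj x y := by
  simp [nbhd]

lemma weight_nonneg_of_mem {x y : V} (h : y ∈ G.nbhd x) : 0 ≤ G.weight x y :=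
  (G.weight_pos x y (G.mem_nbhd.1 h)).le

lemma Gam_add_right (u v w : V → ℝ) (x : V) :
    G.Gam u (v + w) x = G.Gam u v x + G.Gam u w x := by
  simp only [Gam, ← mul_add, ← Finset.sum_add_distrib, Pi.add_apply]
  congr 1
  exact Finset.sum_congr rfl fun y _ => by ring

lemma Gam_smul_right (t : ℝ) (u v : V → ℝ) (x : V) :
    G.Gam u (t • v) x = t * G.Gam u v x := by
  simp only [Gam, Pi.smul_apply, smul_eq_mul, Finset.mul_sum]
  exact Finset.sum_congr rfl fun y _ => by ring

lemma Gam_comm (u v : V → ℝ) (x : V) : G.Gam u v x = G.Gam v u x := by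
  simp only [Gam]
  congr 1
  exact Finset.sum_congr rfl fun y _ => by ring

lemma Gam_self_nonneg (u : V → ℝ) (x : V) : 0 ≤ G.Gam u u x := by
  have := G.meas_pos x
  refine mul_nonneg (by positivity) (Finset.sum_nonneg fun y hy => ?_)
  rw [mul_assoc]
  exact mul_nonneg (G.weight_nonneg_of_mem hy) (mul_self_nonneg _)

lemma gradLen_nonneg (u : V → ℝ) (x : V) : 0 ≤ G.gradLen u x := Real.sqrt_nonneg _

lemma gradLen_mul_self (u : V → ℝ) (x : V) : G.gradLen u x * G.gradLen u x = G.Gam u u x :=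
  Real.mul_self_sqrt (G.Gam_self_nonneg u x)

/-- The sum of the absolute values of the terms of `Γ(u, v)(x)`. -/
noncomputable def absGam (u v : V → ℝ) (x : V) : ℝ :=
  1 / (2 * G.meas x) * ∑ y ∈ G.nbhd x, G.weight x y * |u y - u x| * |v y - v x|

lemma absGam_le (u v : V → ℝ) (x : V) : G.absGam u v x ≤ G.gradLen u x * G.gradLen v x := by
  have hm := G.meas_pos x
  set c : ℝ := 1 / (2 * G.meas x) with hc
  have hc0 : 0 ≤ c := by positivity
  have key := Real.sum_mul_le_sqrt_mul_sqrt (G.nbhd x)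
    (fun y => Real.sqrt (c * G.weight x y) * |u y - u x|)
    (fun y => Real.sqrt (c * G.weight x y) * |v y - v x|)
  have e : ∀ w : V → ℝ, ∑ y ∈ G.nbhd x, (Real.sqrt (c * G.weight x y) * |w y - w x|) ^ 2
      = G.Gam w w x := fun w => by
    rw [Gam, Finset.mul_sum]
    refine Finset.sum_congr rfl fun y hy => ?_
    rw [mul_pow, Real.sq_sqrt (mul_nonneg hc0 (G.weight_nonneg_of_mem hy)), sq_abs]
    ring
  rw [e, e] at key
  refine le_trans (le_of_eq ?_) key
  rw [absGam, Finset.mul_sum]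
  refine Finset.sum_congr rfl fun y hy => ?_
  rw [mul_mul_mul_comm, Real.mul_self_sqrt (mul_nonneg hc0 (G.weight_nonneg_of_mem hy))]
  ring

lemma abs_Gam_le_absGam (u v : V → ℝ) (x : V) : |G.Gam u v x| ≤ G.absGam u v x := by
  have hm := G.meas_pos x
  rw [Gam, absGam, abs_mul, abs_of_pos (by positivity : 0 < 1 / (2 * G.meas x))]
  refine mul_le_mul_of_nonneg_left ((Finset.abs_sum_le_sum_abs _ _).trans (le_of_eq ?_))
    (by positivity)
  refine Finset.sum_congr rfl fun y hy => ?_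
  rw [abs_mul, abs_mul, abs_of_nonneg (G.weight_nonneg_of_mem hy)]

lemma abs_Gam_le (u v : V → ℝ) (x : V) : |G.Gam u v x| ≤ G.gradLen u x * G.gradLen v x :=
  (G.abs_Gam_le_absGam u v x).trans (G.absGam_le u v x)

lemma gradLen_mono {u v : V → ℝ} {x : V} (h : ∀ y, |u y - u x| ≤ |v y - v x|) :
    G.gradLen u x ≤ G.gradLen v x := by
  have hm := G.meas_pos x
  refine Real.sqrt_le_sqrt (mul_le_mul_of_nonneg_left (Finset.sum_le_sum fun y hy => ?_)
    (by positivity))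
  rw [mul_assoc, mul_assoc]
  exact mul_le_mul_of_nonneg_left (by simpa [sq] using sq_le_sq.2 (h y))
    (G.weight_nonneg_of_mem hy)

lemma Gam_add_self (u v : V → ℝ) (x : V) :
    G.Gam (u + v) (u + v) x = G.Gam u u x + 2 * G.Gam u v x + G.Gam v v x := by
  rw [Gam_add_right, Gam_comm, Gam_add_right, Gam_comm G (u + v) v, Gam_add_right,
    Gam_comm G v u]
  ring

lemma gradLen_add_le (u v : V → ℝ) (x : V) :
    G.gradLen (u + v) x ≤ G.gradLen u x + G.gradLen v x := by
  have hu := G.gradLen_nonneg u x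
  have hv := G.gradLen_nonneg v x
  refine abs_le_of_sq_le_sq' ?_ (by positivity) |>.2
  rw [sq, gradLen_mul_self, Gam_add_self, ← G.gradLen_mul_self u, ← G.gradLen_mul_self v]
  nlinarith [(abs_le.1 (G.abs_Gam_le u v x)).2]

lemma gradLen_smul (t : ℝ) (u : V → ℝ) (x : V) : G.gradLen (t • u) x = |t| * G.gradLen u x := by
  rw [gradLen, Gam_smul_right, Gam_comm, Gam_smul_right, ← mul_assoc,
    Real.sqrt_mul (mul_self_nonneg t), Real.sqrt_mul_self_eq_abs, gradLen]

lemma tendsto_Gam {ι : Type*} {l : Filter ι} {u v : ι → V → ℝ} {u' v' : V → ℝ}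
    (hu : ∀ y, Tendsto (fun i => u i y) l (𝓝 (u' y)))
    (hv : ∀ y, Tendsto (fun i => v i y) l (𝓝 (v' y))) (x : V) :
    Tendsto (fun i => G.Gam (u i) (v i) x) l (𝓝 (G.Gam u' v' x)) := by
  unfold Gam
  exact (tendsto_finsetSum _ fun y _ => (((hu y).sub (hu x)).const_mul _).mul
    ((hv y).sub (hv x))).const_mul _

lemma tendsto_gradLen {ι : Type*} {l : Filter ι} {u : ι → V → ℝ} {u' : V → ℝ}
    (hu : ∀ y, Tendsto (fun i => u i y) l (𝓝 (u' y))) (x : V) :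
    Tendsto (fun i => G.gradLen (u i) x) l (𝓝 (G.gradLen u' x)) :=
  (G.tendsto_Gam hu hu x).sqrt

lemma gradLen_rpow_mul_absGam_le (s : ℝ) (u v : V → ℝ) (x : V) :
    G.gradLen u x ^ (s - 2) * G.absGam u v x ≤ G.gradLen u x ^ (s - 1) * G.gradLen v x := by
  have hv := G.gradLen_nonneg v x
  have h := G.absGam_le u v x
  rcases (G.gradLen_nonneg u x).eq_or_lt with h0 | h0
  · rw [← h0, zero_mul] at h
    refine (mul_nonpos_of_nonneg_of_nonpos (Real.rpow_nonneg h0.le _) h).trans ?_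
    exact mul_nonneg (Real.rpow_nonneg h0.le _) hv
  · refine (mul_le_mul_of_nonneg_left h (Real.rpow_nonneg h0.le _)).trans (le_of_eq ?_)
    rw [← mul_assoc, ← Real.rpow_add_one h0.ne']
    ring_nf

lemma abs_gradLen_rpow_mul_Gam_le (s : ℝ) (u v : V → ℝ) (x : V) :
    |G.gradLen u x ^ (s - 2) * G.Gam u v x| ≤ G.gradLen u x ^ (s - 1) * G.gradLen v x := by
  rw [abs_mul, abs_of_nonneg (Real.rpow_nonneg (G.gradLen_nonneg u x) _)]
  exact (mul_le_mul_of_nonneg_left (G.abs_Gam_le_absGam u v x)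
    (Real.rpow_nonneg (G.gradLen_nonneg u x) _)).trans (G.gradLen_rpow_mul_absGam_le s u v x)

lemma tendsto_gradLen_rpow_mul_Gam {s : ℝ} (hs : 1 < s) {ι : Type*} {l : Filter ι}
    {u : ι → V → ℝ} {u' : V → ℝ} (hu : ∀ y, Tendsto (fun i => u i y) l (𝓝 (u' y)))
    (v : V → ℝ) (x : V) :
    Tendsto (fun i => G.gradLen (u i) x ^ (s - 2) * G.Gam (u i) v x) l
      (𝓝 (G.gradLen u' x ^ (s - 2) * G.Gam u' v x)) := by
  rcases (G.gradLen_nonneg u' x).eq_or_lt with h0 | h0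
  · have hz : G.Gam u' v x = 0 := by
      have := G.abs_Gam_le u' v x
      rw [← h0, zero_mul] at this
      exact abs_eq_zero.1 (le_antisymm this (abs_nonneg _))
    rw [hz, mul_zero]
    refine squeeze_zero_norm (fun i => G.abs_gradLen_rpow_mul_Gam_le s (u i) v x) ?_
    have h := ((G.tendsto_gradLen hu x).rpow_const (p := s - 1)
      (Or.inr (by linarith))).mul_const (G.gradLen v x)
    rwa [← h0, Real.zero_rpow (by linarith), zero_mul] at h
  · exact ((G.tendsto_gradLen hu x).rpow_const (Or.inl h0.ne')).mul
      (G.tendsto_Gam (v := fun _ => v) hu (fun y => tendsto_const_nhds) x)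

lemma gradLen_mul_rpow_self {s : ℝ} (hs : 1 < s) (u : V → ℝ) (x : V) :
    G.gradLen u x ^ (s - 2) * G.Gam u u x = G.gradLen u x ^ s := by
  rw [← gradLen_mul_self]
  rcases (G.gradLen_nonneg u x).eq_or_lt with h0 | h0
  · rw [← h0, Real.zero_rpow (by linarith : s ≠ 0)]; simp
  · rw [← mul_assoc, ← Real.rpow_add_one h0.ne', ← Real.rpow_add_one h0.ne']
    ring_nf

/-- Convexity of `u ↦ |∇u|^s`. -/
lemma gradLen_add_rpow_sub_le {s : ℝ} (hs : 1 < s) (u v : V → ℝ) (x : V) :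
    G.gradLen (u + v) x ^ s - G.gradLen u x ^ s ≤
      s * (G.gradLen (u + v) x ^ (s - 2) * G.Gam (u + v) v x) := by
  set w := u + v with hw
  have h1 := mul_rpow_sub_one_mul_le hs (G.gradLen_nonneg w x) (G.gradLen_nonneg u x)
  have h2 := (le_abs_self _).trans (G.abs_gradLen_rpow_mul_Gam_le s w u x)
  have h3 := G.gradLen_mul_rpow_self hs w x
  have h4 : G.Gam w w x = G.Gam w u x + G.Gam w v x := by
    conv_lhs => rw [hw, Gam_add_right]
  rw [h4, mul_add] at h3
  nlinarith

end Gradient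

section Integral

variable {V : Type*} {G : WeightedGraph V}

lemma Integrable.of_abs_le {ψ χ : V → ℝ} (hψ : G.Integrable ψ) (h : ∀ x, |χ x| ≤ ψ x) :
    G.Integrable χ := by
  refine Summable.of_norm_bounded hψ fun x => ?_
  rw [norm_mul, Real.norm_eq_abs, Real.norm_eq_abs, abs_of_pos (G.meas_pos x)]
  exact mul_le_mul_of_nonneg_left (h x) (G.meas_pos x).le

lemma Integrable.of_le {ψ χ : V → ℝ} (hψ : G.Integrable ψ) (h0 : ∀ x, 0 ≤ χ x)
    (h : ∀ x, χ x ≤ ψ x) : G.Integrable χ :=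
  hψ.of_abs_le fun x => by rw [abs_of_nonneg (h0 x)]; exact h x

lemma Integrable.add {ψ χ : V → ℝ} (hψ : G.Integrable ψ) (hχ : G.Integrable χ) :
    G.Integrable fun x => ψ x + χ x := by
  simpa only [Integrable, mul_add] using Summable.add hψ hχ

lemma Integrable.sub {ψ χ : V → ℝ} (hψ : G.Integrable ψ) (hχ : G.Integrable χ) :
    G.Integrable fun x => ψ x - χ x := by
  simpa only [Integrable, mul_sub] using Summable.sub hψ hχ

lemma Integrable.const_mul {ψ : V → ℝ} (hψ : G.Integrable ψ) (c : ℝ) :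
    G.Integrable fun x => c * ψ x := by
  simpa only [Integrable, mul_left_comm] using Summable.mul_left c hψ

lemma integral_add {ψ χ : V → ℝ} (hψ : G.Integrable ψ) (hχ : G.Integrable χ) :
    G.integral (fun x => ψ x + χ x) = G.integral ψ + G.integral χ := by
  simp only [integral, mul_add]
  exact Summable.tsum_add hψ hχ

lemma integral_sub {ψ χ : V → ℝ} (hψ : G.Integrable ψ) (hχ : G.Integrable χ) :
    G.integral (fun x => ψ x - χ x) = G.integral ψ - G.integral χ := by
  simp only [integral, mul_sub]
  exact Summable.tsum_sub hψ hχ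

lemma integral_const_mul (ψ : V → ℝ) (c : ℝ) :
    G.integral (fun x => c * ψ x) = c * G.integral ψ := by
  simp only [integral, mul_left_comm, tsum_mul_left]

lemma integral_nonneg {ψ : V → ℝ} (h : ∀ x, 0 ≤ ψ x) : 0 ≤ G.integral ψ :=
  tsum_nonneg fun x => mul_nonneg (G.meas_pos x).le (h x)

lemma integral_mono {ψ χ : V → ℝ} (hψ : G.Integrable ψ) (hχ : G.Integrable χ)
    (h : ∀ x, ψ x ≤ χ x) : G.integral ψ ≤ G.integral χ :=
  Summable.tsum_le_tsum (fun x => mul_le_mul_of_nonneg_left (h x) (G.meas_pos x).le) hψ hχ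

lemma meas_mul_le_integral {ψ : V → ℝ} (hψ : G.Integrable ψ) (h : ∀ x, 0 ≤ ψ x) (x : V) :
    G.meas x * ψ x ≤ G.integral ψ :=
  hψ.le_tsum x fun y _ => mul_nonneg (G.meas_pos y).le (h y)

lemma integral_pos {ψ : V → ℝ} (hψ : G.Integrable ψ) (h : ∀ x, 0 ≤ ψ x) {x : V}
    (hx : 0 < ψ x) : 0 < G.integral ψ :=
  (mul_pos (G.meas_pos x) hx).trans_le (meas_mul_le_integral hψ h x)

lemma integrable_of_finite {ψ : V → ℝ} {s : Set V} (hs : s.Finite) (h : ∀ x ∉ s, ψ x = 0) :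
    G.Integrable ψ :=
  summable_of_hasFiniteSupport (hs.subset fun x hx => by
    by_contra hc
    exact hx (by simp [h x hc]))

lemma tendsto_integral_of_dominated {ι : Type*} {l : Filter ι} {ψ : ι → V → ℝ} {ψ' b : V → ℝ}
    (hb : G.Integrable b) (hψ : ∀ x, Tendsto (fun i => ψ i x) l (𝓝 (ψ' x)))
    (h : ∀ᶠ i in l, ∀ x, |ψ i x| ≤ b x) :
    Tendsto (fun i => G.integral (ψ i)) l (𝓝 (G.integral ψ')) := by
  refine tendsto_tsum_of_dominated_convergence hb (fun x => (hψ x).const_mul _) ?_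
  filter_upwards [h] with i hi x
  rw [norm_mul, Real.norm_eq_abs, Real.norm_eq_abs, abs_of_pos (G.meas_pos x)]
  exact mul_le_mul_of_nonneg_left (hi x) (G.meas_pos x).le

/-- Fatou's lemma, in the form of a limit of upper bounds. -/
lemma integral_le_of_tendsto {ι : Type*} {l : Filter ι} [l.NeBot] {ψ : ι → V → ℝ} {ψ' : V → ℝ}
    {c : ι → ℝ} {c' : ℝ} (h0 : ∀ i x, 0 ≤ ψ i x) (hi : ∀ᶠ i in l, G.Integrable (ψ i))
    (hψ : ∀ x, Tendsto (fun i => ψ i x) l (𝓝 (ψ' x)))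
    (hc : ∀ᶠ i in l, G.integral (ψ i) ≤ c i) (hcl : Tendsto c l (𝓝 c')) :
    G.Integrable ψ' ∧ G.integral ψ' ≤ c' := by
  have hn : ∀ x, 0 ≤ G.meas x * ψ' x := fun x => mul_nonneg (G.meas_pos x).le
    (ge_of_tendsto' (hψ x) fun i => h0 i x)
  have hs : ∀ s : Finset V, ∑ x ∈ s, G.meas x * ψ' x ≤ c' := fun s => by
    refine le_of_tendsto_of_tendsto (tendsto_finsetSum s fun x _ => (hψ x).const_mul _) hcl ?_
    filter_upwards [hi, hc] with i hi hc
    exact (Summable.sum_le_tsum s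
      (fun x _ => mul_nonneg (G.meas_pos x).le (h0 i x)) hi).trans hc
  exact ⟨summable_of_sum_le hn hs, Real.tsum_le_of_sum_le hn hs⟩

end Integral

section Sobolev

variable {V : Type*} {G : WeightedGraph V}

/-- The density `|∇u|^s + h |u|^s` of the energy. -/
noncomputable def density (G : WeightedGraph V) (s : ℝ) (h u : V → ℝ) (x : V) : ℝ :=
  G.gradLen u x ^ s + h x * |u x| ^ s

/-- The `s`-th power of the norm of `W^{1,s}_h(V)`. -/
noncomputable def energy (G : WeightedGraph V) (s : ℝ) (h u : V → ℝ) : ℝ :=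
  G.integral (G.density s h u)

/-- The integrand of the derivative of `energy / s` at `u` in the direction `φ`. -/
noncomputable def form (G : WeightedGraph V) (s : ℝ) (h u φ : V → ℝ) (x : V) : ℝ :=
  G.gradLen u x ^ (s - 2) * G.Gam u φ x + h x * u x ^ (s - 1) * φ x

lemma gradLen_rpow_nonneg (s : ℝ) (u : V → ℝ) (x : V) : 0 ≤ G.gradLen u x ^ s :=
  Real.rpow_nonneg (G.gradLen_nonneg u x) s

variable {s h₀ : ℝ} {h u v φ : V → ℝ}

lemma pot_nonneg (hh : ∀ x, 0 ≤ h x) (u : V → ℝ) (x : V) : 0 ≤ h x * |u x| ^ s :=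
  mul_nonneg (hh x) (Real.rpow_nonneg (abs_nonneg _) _)

lemma density_nonneg (hh : ∀ x, 0 ≤ h x) (u : V → ℝ) (x : V) : 0 ≤ G.density s h u x :=
  add_nonneg (gradLen_rpow_nonneg s u x) (pot_nonneg hh u x)

lemma energy_nonneg (hh : ∀ x, 0 ≤ h x) (u : V → ℝ) : 0 ≤ G.energy s h u :=
  integral_nonneg (density_nonneg hh u)

lemma normW_rpow (hs : s ≠ 0) (hh : ∀ x, 0 ≤ h x) (u : V → ℝ) :
    G.normW s h u ^ s = G.energy s h u := by
  change (G.energy s h u ^ (1 / s)) ^ s = G.energy s h u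
  rw [← Real.rpow_mul (energy_nonneg hh u), one_div, inv_mul_cancel₀ hs, Real.rpow_one]

lemma normW_nonneg (hh : ∀ x, 0 ≤ h x) (u : V → ℝ) : 0 ≤ G.normW s h u :=
  Real.rpow_nonneg (energy_nonneg (s := s) hh u) _

lemma memW_iff (hh0 : 0 < h₀) (hh : ∀ x, h₀ ≤ h x) :
    G.MemW s h u ↔ G.Integrable (G.density s h u) := by
  have hh' : ∀ x, 0 ≤ h x := fun x => hh0.le.trans (hh x)
  refine ⟨fun hu => ?_, fun hu => ⟨?_, ?_⟩⟩
  · refine (hu.1.add hu.2).of_le (density_nonneg hh' u) fun x => ?_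
    have := Real.rpow_nonneg (abs_nonneg (u x)) s
    simp only [density]
    linarith
  · refine (hu.const_mul (1 + h₀⁻¹)).of_le (fun x => add_nonneg (gradLen_rpow_nonneg s u x)
      (Real.rpow_nonneg (abs_nonneg _) _)) fun x => ?_
    have h1 := Real.rpow_nonneg (abs_nonneg (u x)) s
    have h2 := gradLen_rpow_nonneg (G := G) s u x
    have h3 : |u x| ^ s ≤ h₀⁻¹ * (h x * |u x| ^ s) := by
      rw [← mul_assoc, ← div_eq_inv_mul]
      exact le_mul_of_one_le_left h1 ((one_le_div hh0).2 (hh x))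
    have h4 : 0 ≤ h₀⁻¹ * G.gradLen u x ^ s := by positivity
    have h5 := pot_nonneg (s := s) hh' u x
    simp only [density]
    nlinarith
  · exact hu.of_le (pot_nonneg hh' u) fun x => le_add_of_nonneg_left (gradLen_rpow_nonneg s u x)

lemma density_of_le (hs : 0 ≤ s) (hh : ∀ x, 0 ≤ h x) (h1 : ∀ x, |u x| ≤ |v x|)
    (h2 : ∀ x y, |u y - u x| ≤ |v y - v x|) (x : V) : G.density s h u x ≤ G.density s h v x :=
  add_le_add
    (Real.rpow_le_rpow (G.gradLen_nonneg _ _) (G.gradLen_mono (h2 x)) hs)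
    (mul_le_mul_of_nonneg_left (Real.rpow_le_rpow (abs_nonneg _) (h1 x) hs) (hh x))

lemma density_add_le (hs : 1 ≤ s) (hh : ∀ x, 0 ≤ h x) (u v : V → ℝ) (x : V) :
    G.density s h (u + v) x ≤ 2 ^ (s - 1) * (G.density s h u x + G.density s h v x) := by
  have e : ∀ a b c : ℝ, 0 ≤ a → 0 ≤ b → 0 ≤ c → a ≤ b + c →
      a ^ s ≤ 2 ^ (s - 1) * (b ^ s + c ^ s) := fun a b c ha hb hc habc => by
    refine (Real.rpow_le_rpow ha habc (by linarith)).trans ?_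
    lift b to NNReal using hb
    lift c to NNReal using hc
    exact_mod_cast NNReal.rpow_add_le_mul_rpow_add_rpow b c hs
  have h1 := e _ _ _ (G.gradLen_nonneg (u + v) x) (G.gradLen_nonneg u x) (G.gradLen_nonneg v x)
    (G.gradLen_add_le u v x)
  have h2 := e _ _ _ (abs_nonneg ((u + v) x)) (abs_nonneg (u x)) (abs_nonneg (v x))
    (abs_add_le _ _)
  have h3 := mul_le_mul_of_nonneg_left h2 (hh x)
  simp only [density]
  linarith

lemma density_smul (t : ℝ) (u : V → ℝ) (x : V) :
    G.density s h (t • u) x = |t| ^ s * G.density s h u x := by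
  simp only [density, gradLen_smul, Pi.smul_apply, smul_eq_mul, abs_mul]
  rw [Real.mul_rpow (abs_nonneg _) (G.gradLen_nonneg _ _),
    Real.mul_rpow (abs_nonneg _) (abs_nonneg _)]
  ring

lemma energy_smul (t : ℝ) (u : V → ℝ) : G.energy s h (t • u) = |t| ^ s * G.energy s h u := by
  rw [energy, energy, ← integral_const_mul]
  exact congrArg _ (funext (density_smul t u))

lemma normW_smul (hs : 0 < s) (hh : ∀ x, 0 ≤ h x) (t : ℝ) (u : V → ℝ) :
    G.normW s h (t • u) = |t| * G.normW s h u := by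
  change G.energy s h (t • u) ^ (1 / s) = |t| * G.energy s h u ^ (1 / s)
  rw [energy_smul, Real.mul_rpow (by positivity) (energy_nonneg hh u),
    ← Real.rpow_mul (abs_nonneg t), mul_one_div_cancel hs.ne', Real.rpow_one]

lemma density_line_le (hs : 1 < s) (hh : ∀ x, 0 ≤ h x) {t ε : ℝ} (ht0 : 0 ≤ t) (ht : t ≤ 2)
    (hε0 : 0 ≤ ε) (hε : ε ≤ 1) (x : V) :
    G.density s h (t • (u + ε • φ)) x ≤
      2 ^ s * (2 ^ (s - 1) * (G.density s h u x + G.density s h φ x)) := by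
  have d1 := density_nonneg (G := G) (s := s) hh φ x
  have d2 := density_nonneg (G := G) (s := s) hh (u + ε • φ) x
  have h1 := density_add_le (G := G) hs.le hh u (ε • φ) x
  have h2 : G.density s h (ε • φ) x ≤ G.density s h φ x := by
    rw [density_smul, abs_of_nonneg hε0]
    exact mul_le_of_le_one_left d1 (Real.rpow_le_one hε0 hε (by linarith))
  rw [density_smul, abs_of_nonneg ht0]
  refine mul_le_mul (Real.rpow_le_rpow ht0 ht (by linarith)) (h1.trans ?_) d2 (by positivity)
  gcongr

lemma abs_form_le (hs : 1 < s) (hh : ∀ x, 0 ≤ h x) (hu : ∀ x, 0 ≤ u x) (x : V) :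
    |G.form s h u φ x| ≤ G.density s h u x + G.density s h φ x := by
  have h1 := (G.abs_gradLen_rpow_mul_Gam_le s u φ x).trans
    (rpow_sub_one_mul_le_add hs (G.gradLen_nonneg u x) (G.gradLen_nonneg φ x))
  have h2 := mul_le_mul_of_nonneg_left
    (rpow_sub_one_mul_le_add hs (hu x) (abs_nonneg (φ x))) (hh x)
  have h3 : |h x * u x ^ (s - 1) * φ x| = h x * (u x ^ (s - 1) * |φ x|) := by
    rw [mul_assoc, abs_mul, abs_mul, abs_of_nonneg (hh x),
      abs_of_nonneg (Real.rpow_nonneg (hu x) _)]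
  refine (abs_add_le _ _).trans ?_
  rw [h3]
  simp only [density]
  rw [abs_of_nonneg (hu x)]
  linarith

lemma form_add_right (u φ ψ : V → ℝ) (x : V) :
    G.form s h u (φ + ψ) x = G.form s h u φ x + G.form s h u ψ x := by
  simp only [form, Gam_add_right, Pi.add_apply]
  ring

lemma form_smul_right (t : ℝ) (u φ : V → ℝ) (x : V) :
    G.form s h u (t • φ) x = t * G.form s h u φ x := by
  simp only [form, Gam_smul_right, Pi.smul_apply, smul_eq_mul]
  ring

lemma form_self (hs : 1 < s) (hu : ∀ x, 0 ≤ u x) (x : V) :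
    G.form s h u u x = G.density s h u x := by
  have e : u x ^ (s - 1) * u x = u x ^ s := by
    rcases (hu x).eq_or_lt with h0 | h0
    · rw [← h0, mul_zero, Real.zero_rpow (by linarith)]
    · rw [← Real.rpow_add_one h0.ne']
      ring_nf
  rw [form, density, gradLen_mul_rpow_self G hs, abs_of_nonneg (hu x), ← e, mul_assoc]

lemma density_add_sub_le (hs : 1 < s) (hh : ∀ x, 0 ≤ h x) (hu : ∀ x, 0 ≤ u x)
    (hφ : ∀ x, 0 ≤ φ x) (x : V) :
    G.density s h (u + φ) x - G.density s h u x ≤ s * G.form s h (u + φ) φ x := by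
  have h1 := G.gradLen_add_rpow_sub_le hs u φ x
  have h0 : 0 ≤ (u + φ) x := add_nonneg (hu x) (hφ x)
  have h2 := mul_rpow_sub_one_mul_le hs h0 (hu x)
  have e : (u + φ) x ^ (s - 1) * (u + φ) x = (u + φ) x ^ s := by
    rcases h0.eq_or_lt with h0 | h0
    · rw [← h0, mul_zero, Real.zero_rpow (by linarith)]
    · rw [← Real.rpow_add_one h0.ne']
      ring_nf
  have e2 : (u + φ) x ^ (s - 1) * (u + φ) x
      = (u + φ) x ^ (s - 1) * u x + (u + φ) x ^ (s - 1) * φ x := by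
    rw [← mul_add]; rfl
  have h3 : (u + φ) x ^ s - u x ^ s ≤ s * ((u + φ) x ^ (s - 1) * φ x) := by
    rw [e] at e2
    nlinarith
  have h4 := mul_le_mul_of_nonneg_left h3 (hh x)
  simp only [density, form]
  rw [abs_of_nonneg h0, abs_of_nonneg (hu x)]
  nlinarith

section Mem

lemma MemW.integrable_density (hu : G.MemW s h u) (hh : ∀ x, 0 ≤ h x) :
    G.Integrable (G.density s h u) := by
  refine (hu.1.add hu.2).of_le (density_nonneg hh u) fun x => ?_
  have := Real.rpow_nonneg (abs_nonneg (u x)) s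
  simp only [density]
  linarith

lemma MemW.integrable_form (hs : 1 < s) (hh : ∀ x, 0 ≤ h x) (hu0 : ∀ x, 0 ≤ u x)
    (hu : G.MemW s h u) (hφ : G.MemW s h φ) : G.Integrable (G.form s h u φ) :=
  ((hu.integrable_density hh).add (hφ.integrable_density hh)).of_abs_le (abs_form_le hs hh hu0)

lemma MemW.integrable_rpow (hu : G.MemW s h u) : G.Integrable fun x => |u x| ^ s :=
  hu.1.of_le (fun _ => Real.rpow_nonneg (abs_nonneg _) _) fun x =>
    le_add_of_nonneg_left (gradLen_rpow_nonneg s u x)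

lemma MemW.add (hh0 : 0 < h₀) (hh : ∀ x, h₀ ≤ h x)
    (hs : 1 ≤ s) (hu : G.MemW s h u) (hv : G.MemW s h v) : G.MemW s h (u + v) := by
  have hh' : ∀ x, 0 ≤ h x := fun x => hh0.le.trans (hh x)
  rw [memW_iff hh0 hh] at *
  exact ((hu.add hv).const_mul _).of_le (density_nonneg hh' _) (density_add_le hs hh' u v)

lemma MemW.smul (hh0 : 0 < h₀) (hh : ∀ x, h₀ ≤ h x) (t : ℝ) (hu : G.MemW s h u) : G.MemW s h (t • u) := by
  rw [memW_iff hh0 hh] at *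
  have := hu.const_mul (|t| ^ s)
  rwa [← funext (density_smul t u)] at this

lemma MemW.of_le (hh0 : 0 < h₀) (hh : ∀ x, h₀ ≤ h x)
    (hs : 0 ≤ s) (hv : G.MemW s h v) (h1 : ∀ x, |u x| ≤ |v x|)
    (h2 : ∀ x y, |u y - u x| ≤ |v y - v x|) : G.MemW s h u := by
  have hh' : ∀ x, 0 ≤ h x := fun x => hh0.le.trans (hh x)
  rw [memW_iff hh0 hh] at *
  exact hv.of_le (density_nonneg hh' u) (density_of_le hs hh' h1 h2)

lemma memW_of_finite_support (hh0 : 0 < h₀) (hh : ∀ x, h₀ ≤ h x)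
    (hs : 0 < s) (hu : (Function.support u).Finite) :
    G.MemW s h u := by
  rw [memW_iff hh0 hh]
  refine integrable_of_finite (s := Function.support u ∪
    ⋃ y ∈ Function.support u, G.graph.neighborSet y)
    (hu.union (hu.biUnion fun y _ => G.finite_neighbors y)) fun x hx => ?_
  simp only [Set.mem_union, Set.mem_iUnion, not_or, Function.mem_support, not_exists,
    SimpleGraph.mem_neighborSet, ne_eq, not_not] at hx
  have hg : G.Gam u u x = 0 := by
    rw [Gam, Finset.sum_eq_zero, mul_zero]
    intro y hy
    have hy0 : u y = 0 := by
      by_contra hc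
      exact hx.2 y hc (G.mem_nbhd.1 hy).symm
    rw [hx.1, hy0]
    ring
  rw [density, gradLen, hg, hx.1, Real.sqrt_zero, abs_zero, Real.zero_rpow hs.ne']
  ring

lemma MemW.abs_rpow_le (hh0 : 0 < h₀) (hh : ∀ x, h₀ ≤ h x)
    {μ₀ : ℝ} (hμ₀ : 0 < μ₀) (hμ : ∀ x, μ₀ ≤ G.meas x) (hu : G.MemW s h u)
    (x : V) : |u x| ^ s ≤ G.energy s h u / (μ₀ * h₀) := by
  have hh' : ∀ x, 0 ≤ h x := fun x => hh0.le.trans (hh x)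
  rw [le_div_iff₀ (by positivity)]
  have h1 := meas_mul_le_integral (hu.integrable_density hh') (density_nonneg hh' u) x
  have h2 := Real.rpow_nonneg (abs_nonneg (u x)) s
  have h3 : μ₀ * (h₀ * |u x| ^ s) ≤ G.meas x * G.density s h u x :=
    mul_le_mul (hμ x) ((mul_le_mul_of_nonneg_right (hh x) h2).trans
      (le_add_of_nonneg_left (gradLen_rpow_nonneg s u x))) (by positivity) (G.meas_pos x).le
  calc |u x| ^ s * (μ₀ * h₀) = μ₀ * (h₀ * |u x| ^ s) := by ring
    _ ≤ _ := h3.trans h1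

lemma MemW.energy_pos (hh0 : 0 < h₀) (hh : ∀ x, h₀ ≤ h x)
    (hu : G.MemW s h u) {x : V} (hx : u x ≠ 0) : 0 < G.energy s h u := by
  have hh' : ∀ x, 0 ≤ h x := fun x => hh0.le.trans (hh x)
  refine integral_pos (hu.integrable_density hh') (density_nonneg hh' u) (x := x) ?_
  exact add_pos_of_nonneg_of_pos (gradLen_rpow_nonneg s u x)
    (mul_pos (hh0.trans_le (hh x)) (Real.rpow_pos_of_pos (abs_pos.2 hx) _))

lemma memW_of_tendsto (hh0 : 0 < h₀) (hh : ∀ x, h₀ ≤ h x)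
    {ι : Type*} {l : Filter ι} [l.NeBot] (hs : 0 ≤ s) {w : ι → V → ℝ}
    (hw : ∀ i, G.MemW s h (w i)) (hu : ∀ y, Tendsto (fun i => w i y) l (𝓝 (u y))) {c : ℝ}
    (hc : Tendsto (fun i => G.energy s h (w i)) l (𝓝 c)) :
    G.MemW s h u ∧ G.energy s h u ≤ c := by
  have hh' : ∀ x, 0 ≤ h x := fun x => hh0.le.trans (hh x)
  rw [memW_iff hh0 hh]
  exact integral_le_of_tendsto (fun i => density_nonneg hh' (w i))
    (Eventually.of_forall fun i => (hw i).integrable_density hh')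
    (fun x => ((G.tendsto_gradLen hu x).rpow_const (Or.inr hs)).add
      (((hu x).abs.rpow_const (Or.inr hs)).const_mul _))
    (Eventually.of_forall fun i => le_rfl) hc

end Mem

lemma tendsto_line {ι : Type*} {l : Filter ι} {t ε : ι → ℝ} (ht : Tendsto t l (𝓝 1))
    (hε : Tendsto ε l (𝓝 0)) (u φ : V → ℝ) (y : V) :
    Tendsto (fun i => (t i • (u + ε i • φ)) y) l (𝓝 (u y)) := by
  have := ht.mul ((hε.mul_const (φ y)).const_add (u y))
  simpa using this

lemma tendsto_energy_line {ι : Type*} {l : Filter ι} (hs : 1 < s) (hh : ∀ x, 0 ≤ h x)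
    (hu : G.MemW s h u) (hφ : G.MemW s h φ) {ε : ι → ℝ} (hε : Tendsto ε l (𝓝 0))
    (hε0 : ∀ᶠ i in l, 0 ≤ ε i) :
    Tendsto (fun i => G.energy s h (u + ε i • φ)) l (𝓝 (G.energy s h u)) := by
  have hb := (((hu.integrable_density hh).add (hφ.integrable_density hh)).const_mul
    (2 ^ (s - 1))).const_mul (2 ^ s)
  have hl := tendsto_line (t := fun _ => (1 : ℝ)) tendsto_const_nhds hε u φ
  simp only [one_smul] at hl
  refine tendsto_integral_of_dominated hb
    (fun x => ((G.tendsto_gradLen hl x).rpow_const (Or.inr (by linarith))).add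
      (((hl x).abs.rpow_const (Or.inr (by linarith))).const_mul _)) ?_
  filter_upwards [hε0, hε.eventually_le_const one_pos] with i h0 h1 x
  have := density_line_le (G := G) (u := u) (φ := φ) hs hh zero_le_one one_le_two h0 h1 x
  rw [one_smul] at this
  rwa [abs_of_nonneg (density_nonneg hh _ x)]

lemma tendsto_form_line {ι : Type*} {l : Filter ι} (hs : 1 < s) (hh : ∀ x, 0 ≤ h x)
    (hu0 : ∀ x, 0 ≤ u x) (hφ0 : ∀ x, 0 ≤ φ x)
    (hu : G.MemW s h u) (hφ : G.MemW s h φ) {t ε : ι → ℝ} (ht : Tendsto t l (𝓝 1))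
    (hε : Tendsto ε l (𝓝 0)) (hε0 : ∀ᶠ i in l, 0 ≤ ε i) :
    Tendsto (fun i => G.integral (G.form s h (t i • (u + ε i • φ)) φ)) l
      (𝓝 (G.integral (G.form s h u φ))) := by
  have hb := ((((hu.integrable_density hh).add (hφ.integrable_density hh)).const_mul
    (2 ^ (s - 1))).const_mul (2 ^ s)).add (hφ.integrable_density hh)
  have hl := tendsto_line ht hε u φ
  refine tendsto_integral_of_dominated hb
    (fun x => (G.tendsto_gradLen_rpow_mul_Gam hs hl φ x).add
      ((((hl x).rpow_const (Or.inr (by linarith))).const_mul _).mul_const _)) ?_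
  filter_upwards [hε0, hε.eventually_le_const one_pos, ht.eventually_le_const one_lt_two,
    ht.eventually_const_le zero_lt_one] with i h0 h1 h2 h3 x
  refine (abs_form_le hs hh (fun y => mul_nonneg h3 (add_nonneg (hu0 y)
    (mul_nonneg h0 (hφ0 y)))) x).trans ?_
  gcongr
  exact density_line_le hs hh h3 h2 h0 h1 x

end Sobolev

end WeightedGraph

section Bounds

variable {p γ α μ₀ a₀ Nf Ng lam : ℝ}

lemma boundX_pos (hk : 0 < p - 1 + γ) (hd : 0 < α + 1 - p) (hμ : 0 < μ₀)
    (ha : 0 < a₀) (hg : 0 < Ng) (hl : 0 < lam) : 0 < boundX p γ α μ₀ a₀ Ng lam := by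
  have : 0 < α + γ := by linarith
  unfold boundX
  positivity

lemma boundX₀_pos (hk : 0 < p - 1 + γ) (hd : 0 < α + 1 - p)
    (ha : 0 < a₀) (hf : 0 < Nf) : 0 < boundX₀ p γ α a₀ Nf := by
  have : 0 < α + γ := by linarith
  unfold boundX₀
  positivity

lemma boundS_pos (hk : 0 < p - 1 + γ) (hd : 0 < α + 1 - p) (hμ : 0 < μ₀)
    (ha : 0 < a₀) (hg : 0 < Ng) (hl : 0 < lam) : 0 < boundS p γ α μ₀ a₀ Ng lam := by
  have : 0 < α + γ := by linarith
  unfold boundS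
  positivity

lemma boundS₀_pos (hk : 0 < p - 1 + γ) (hd : 0 < α + 1 - p) (hμ : 0 < μ₀)
    (ha : 0 < a₀) (hf : 0 < Nf) : 0 < boundS₀ p γ α μ₀ a₀ Nf := by
  have : 0 < α + γ := by linarith
  unfold boundS₀
  positivity

lemma log_boundX (hk : 0 < p - 1 + γ) (hd : 0 < α + 1 - p) (hμ : 0 < μ₀)
    (ha : 0 < a₀) (hg : 0 < Ng) (hl : 0 < lam) :
    Real.log (boundX p γ α μ₀ a₀ Ng lam) = 1 / (α + 1 - p) * (Real.log (p - 1 + γ) -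
      (Real.log lam + Real.log (α + γ) + Real.log Ng + (p - 1 - α) / p * Real.log μ₀
        + -((α + 1) / p) * Real.log a₀)) := by
  have : 0 < α + γ := by linarith
  rw [boundX, Real.log_rpow (by positivity), Real.log_div (by positivity) (by positivity),
    Real.log_mul (by positivity) (by positivity), Real.log_mul (by positivity) (by positivity),
    Real.log_mul (by positivity) (by positivity), Real.log_mul (by positivity) (by positivity),
    Real.log_rpow hμ, Real.log_rpow ha]

lemma log_boundX₀ (hk : 0 < p - 1 + γ) (hd : 0 < α + 1 - p) (ha : 0 < a₀) (hf : 0 < Nf) :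
    Real.log (boundX₀ p γ α a₀ Nf) =
      1 / (p - 1 + γ) * (Real.log (α + γ) - Real.log (α + 1 - p))
      + -((1 - γ) / (p * (p - 1 + γ))) * Real.log a₀ + 1 / (p - 1 + γ) * Real.log Nf := by
  have : 0 < α + γ := by linarith
  rw [boundX₀, Real.log_mul (by positivity) (by positivity),
    Real.log_mul (by positivity) (by positivity),
    Real.log_rpow (by positivity), Real.log_div (by positivity) (by positivity),
    Real.log_rpow ha, Real.log_rpow hf]

lemma log_boundS (hk : 0 < p - 1 + γ) (hd : 0 < α + 1 - p) (hμ : 0 < μ₀)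
    (ha : 0 < a₀) (hg : 0 < Ng) (hl : 0 < lam) :
    Real.log (boundS p γ α μ₀ a₀ Ng lam) = 1 / (α + 1 - p) * (Real.log (p - 1 + γ) -
      (Real.log lam + Real.log (α + γ))) + 1 / (α + 1) * Real.log μ₀
      + 1 / (α + 1 - p) * Real.log a₀ - 1 / (α + 1 - p) * Real.log Ng := by
  have : 0 < α + γ := by linarith
  rw [boundS, Real.log_mul (by positivity) (by positivity),
    Real.log_mul (by positivity) (by positivity), Real.log_mul (by positivity) (by positivity),
    Real.log_rpow (by positivity), Real.log_rpow (by positivity), Real.log_rpow ha,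
    Real.log_rpow (by positivity), Real.log_div (by positivity) (by positivity),
    Real.log_mul (by positivity) (by positivity), one_div μ₀, one_div Ng, Real.log_inv,
    Real.log_inv]
  ring

lemma log_boundS₀ (hk : 0 < p - 1 + γ) (hd : 0 < α + 1 - p) (hμ : 0 < μ₀)
    (ha : 0 < a₀) (hf : 0 < Nf) :
    Real.log (boundS₀ p γ α μ₀ a₀ Nf) =
      1 / (p - 1 + γ) * (Real.log (α + γ) - Real.log (α + 1 - p))
      - (α + 1 - p) / (p * (α + 1)) * Real.log μ₀
      - 1 / (p - 1 + γ) * Real.log a₀ + 1 / (p - 1 + γ) * Real.log Nf := by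
  have : 0 < α + γ := by linarith
  rw [boundS₀, Real.log_mul (by positivity) (by positivity),
    Real.log_mul (by positivity) (by positivity), Real.log_mul (by positivity) (by positivity),
    Real.log_rpow (by positivity), Real.log_rpow (by positivity), Real.log_rpow ha,
    Real.log_rpow hf, Real.log_div (by positivity) (by positivity), one_div μ₀, Real.log_inv]
  ring

lemma log_lamStar (hk : 0 < p - 1 + γ) (hd : 0 < α + 1 - p) (hμ : 0 < μ₀)
    (ha : 0 < a₀) (hf : 0 < Nf) (hg : 0 < Ng) :
    Real.log (lamStar p γ α μ₀ a₀ Nf Ng) =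
      (α + γ) / (p - 1 + γ) * (Real.log (p - 1 + γ) - Real.log (α + γ))
      + (α + 1 - p) / (p - 1 + γ) * (Real.log (α + 1 - p) - Real.log (p - 1 + γ))
      - Real.log Ng + (α + 1 - p) / p * Real.log μ₀ + (α + γ) / (p - 1 + γ) * Real.log a₀
      - (α + 1 - p) / (p - 1 + γ) * Real.log Nf := by
  have : 0 < α + γ := by linarith
  have e : p + γ - 1 = p - 1 + γ := by ring
  rw [lamStar, e, Real.log_mul (by positivity) (by positivity),
    Real.log_mul (by positivity) (by positivity), Real.log_mul (by positivity) (by positivity),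
    Real.log_mul (by positivity) (by positivity), Real.log_mul (by positivity) (by positivity),
    Real.log_rpow (by positivity), Real.log_rpow (by positivity), Real.log_rpow ha,
    Real.log_rpow hμ, Real.log_rpow (by positivity), Real.log_div (by positivity) (by positivity),
    Real.log_div (by positivity) (by positivity), one_div Ng, one_div Nf, Real.log_inv,
    Real.log_inv]
  ring

lemma boundX₀_lt_boundX (hp : 0 < p) (hk : 0 < p - 1 + γ) (hd : 0 < α + 1 - p) (hμ : 0 < μ₀)
    (ha : 0 < a₀) (hf : 0 < Nf) (hg : 0 < Ng) (hl : 0 < lam)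
    (h : lam < lamStar p γ α μ₀ a₀ Nf Ng) :
    boundX₀ p γ α a₀ Nf < boundX p γ α μ₀ a₀ Ng lam := by
  have h := Real.log_lt_log hl h
  rw [log_lamStar hk hd hμ ha hf hg] at h
  rw [← Real.log_lt_log_iff (boundX₀_pos hk hd ha hf) (boundX_pos hk hd hμ ha hg hl),
    log_boundX₀ hk hd ha hf, log_boundX hk hd hμ ha hg hl, ← sub_pos]
  rw [← sub_pos] at h
  refine (div_pos h hd).trans_eq ?_
  field_simp
  ring

lemma boundS₀_lt_boundS (hp : 0 < p) (hk : 0 < p - 1 + γ) (hd : 0 < α + 1 - p) (hμ : 0 < μ₀)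
    (ha : 0 < a₀) (hf : 0 < Nf) (hg : 0 < Ng) (hl : 0 < lam)
    (h : lam < lamStar p γ α μ₀ a₀ Nf Ng) :
    boundS₀ p γ α μ₀ a₀ Nf < boundS p γ α μ₀ a₀ Ng lam := by
  have h := Real.log_lt_log hl h
  have hα : 0 < α + 1 := by linarith
  rw [log_lamStar hk hd hμ ha hf hg] at h
  rw [← Real.log_lt_log_iff (boundS₀_pos hk hd hμ ha hf) (boundS_pos hk hd hμ ha hg hl),
    log_boundS₀ hk hd hμ ha hf, log_boundS hk hd hμ ha hg hl, ← sub_pos]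
  rw [← sub_pos] at h
  refine (div_pos h hd).trans_eq ?_
  field_simp
  ring

variable {P L T : ℝ}

lemma log_le_of_embedding (hμ : 0 < μ₀)
    (hL : 0 < L) (hT : 0 < T) (hTL : T ≤ (L / μ₀) ^ ((α + 1 - p) / p) * L) :
    Real.log T ≤ (α + 1 - p) / p * (Real.log L - Real.log μ₀) + Real.log L := by
  refine (Real.log_le_log hT hTL).trans_eq ?_
  rw [Real.log_mul (by positivity) hL.ne', Real.log_rpow (by positivity),
    Real.log_div hL.ne' hμ.ne']

lemma boundX_lt_of (hp : 0 < p) (hk : 0 < p - 1 + γ) (hd : 0 < α + 1 - p) (hμ : 0 < μ₀)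
    (ha : 0 < a₀) (hg : 0 < Ng) (hl : 0 < lam) (hL : 0 < L) (hT : 0 < T)
    (hTL : T ≤ (L / μ₀) ^ ((α + 1 - p) / p) * L) (hLP : a₀ * L ≤ P)
    (h : (p - 1 + γ) * P < (α + γ) * (lam * (Ng * T))) :
    boundX p γ α μ₀ a₀ Ng lam < P ^ (1 / p) := by
  have hα : 0 < α + γ := by linarith
  have hα1 : 0 < α + 1 := by linarith
  have hP : 0 < P := lt_of_lt_of_le (by positivity) hLP
  have h1 := log_le_of_embedding hμ hL hT hTL
  have h2 := Real.log_le_log (by positivity) hLP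
  have h3 := Real.log_lt_log (by positivity) h
  rw [Real.log_mul ha.ne' hL.ne'] at h2
  rw [Real.log_mul hk.ne' hP.ne', Real.log_mul hα.ne' (by positivity),
    Real.log_mul hl.ne' (by positivity), Real.log_mul hg.ne' hT.ne'] at h3
  rw [← Real.log_lt_log_iff (boundX_pos hk hd hμ ha hg hl) (by positivity), Real.log_rpow hP,
    log_boundX hk hd hμ ha hg hl, ← sub_pos]
  have h4 := mul_le_mul_of_nonneg_left h2 (by positivity : 0 ≤ (α + 1) / p)
  have h5 : 0 < Real.log (α + γ) + (Real.log lam + (Real.log Ng + ((α + 1 - p) / p *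
    (Real.log L - Real.log μ₀) + Real.log L))) - Real.log (p - 1 + γ) - Real.log P +
    ((α + 1) / p * Real.log P - (α + 1) / p * (Real.log a₀ + Real.log L)) := by linarith
  refine (div_pos h5 hd).trans_eq ?_
  field_simp
  ring

lemma boundS_lt_of (hp : 0 < p) (hk : 0 < p - 1 + γ) (hd : 0 < α + 1 - p) (hμ : 0 < μ₀)
    (ha : 0 < a₀) (hg : 0 < Ng) (hl : 0 < lam) (hL : 0 < L) (hT : 0 < T)
    (hTL : T ≤ (L / μ₀) ^ ((α + 1 - p) / p) * L) (hLP : a₀ * L ≤ P)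
    (h : (p - 1 + γ) * P < (α + γ) * (lam * (Ng * T))) :
    boundS p γ α μ₀ a₀ Ng lam < T ^ (1 / (α + 1)) := by
  have hα : 0 < α + γ := by linarith
  have hα1 : 0 < α + 1 := by linarith
  have h1 := log_le_of_embedding hμ hL hT hTL
  have h3 := Real.log_lt_log (by positivity)
    ((mul_le_mul_of_nonneg_left hLP hk.le).trans_lt h)
  rw [Real.log_mul hk.ne' (by positivity), Real.log_mul ha.ne' hL.ne',
    Real.log_mul hα.ne' (by positivity),
    Real.log_mul hl.ne' (by positivity), Real.log_mul hg.ne' hT.ne'] at h3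
  rw [← Real.log_lt_log_iff (boundS_pos hk hd hμ ha hg hl) (by positivity), Real.log_rpow hT,
    log_boundS hk hd hμ ha hg hl, ← sub_pos]
  have h4 := mul_le_mul_of_nonneg_left h1 (by positivity : 0 ≤ p / (α + 1))
  have h5 : 0 < Real.log (α + γ) + (Real.log lam + (Real.log Ng + Real.log T)) -
    (Real.log (p - 1 + γ) + (Real.log a₀ + Real.log L)) + (p / (α + 1) * ((α + 1 - p) / p *
    (Real.log L - Real.log μ₀) + Real.log L) - p / (α + 1) * Real.log T) := by linarith
  refine (div_pos h5 hd).trans_eq ?_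
  field_simp
  ring

variable {F : ℝ}

lemma lt_boundX₀_of (hp : 0 < p) (hk : 0 < p - 1 + γ) (hd : 0 < α + 1 - p) (hγ : γ < 1)
    (ha : 0 < a₀) (hf : 0 < Nf) (hL : 0 < L) (hLP : a₀ * L ≤ P)
    (hF : F ≤ Nf * L ^ ((1 - γ) / p)) (h : (α + 1 - p) * P < (α + γ) * F) :
    P ^ (1 / p) < boundX₀ p γ α a₀ Nf := by
  have hα : 0 < α + γ := by linarith
  have hγ' : 0 < 1 - γ := by linarith
  have hP : 0 < P := lt_of_lt_of_le (by positivity) hLP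
  have h2 := Real.log_le_log (by positivity) hLP
  have h3 := Real.log_lt_log (by positivity) (h.trans_le (mul_le_mul_of_nonneg_left hF hα.le))
  rw [Real.log_mul ha.ne' hL.ne'] at h2
  rw [Real.log_mul hd.ne' hP.ne', Real.log_mul hα.ne' (by positivity),
    Real.log_mul hf.ne' (by positivity), Real.log_rpow hL] at h3
  rw [← Real.log_lt_log_iff (by positivity) (boundX₀_pos hk hd ha hf), Real.log_rpow hP,
    log_boundX₀ hk hd ha hf, ← sub_pos]
  have h4 := mul_le_mul_of_nonneg_left h2 (by positivity : 0 ≤ (1 - γ) / p)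
  have h5 : 0 < Real.log (α + γ) + (Real.log Nf + (1 - γ) / p * Real.log L)
    - (Real.log (α + 1 - p) + Real.log P)
    + ((1 - γ) / p * Real.log P - (1 - γ) / p * (Real.log a₀ + Real.log L)) := by linarith
  refine (div_pos h5 hk).trans_eq ?_
  field_simp
  ring

lemma lt_boundS₀_of (hp : 0 < p) (hk : 0 < p - 1 + γ) (hd : 0 < α + 1 - p)
    (hμ : 0 < μ₀) (ha : 0 < a₀) (hf : 0 < Nf) (hL : 0 < L) (hT : 0 < T)
    (hTL : T ≤ (L / μ₀) ^ ((α + 1 - p) / p) * L) (hLP : a₀ * L ≤ P)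
    (hF : F ≤ Nf * L ^ ((1 - γ) / p)) (h : (α + 1 - p) * P < (α + γ) * F) :
    T ^ (1 / (α + 1)) < boundS₀ p γ α μ₀ a₀ Nf := by
  have hα : 0 < α + γ := by linarith
  have hα1 : 0 < α + 1 := by linarith
  have h1 := log_le_of_embedding hμ hL hT hTL
  have h3 := Real.log_lt_log (by positivity) ((mul_le_mul_of_nonneg_left hLP hd.le).trans_lt
    (h.trans_le (mul_le_mul_of_nonneg_left hF hα.le)))
  rw [Real.log_mul hd.ne' (by positivity), Real.log_mul ha.ne' hL.ne',
    Real.log_mul hα.ne' (by positivity),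
    Real.log_mul hf.ne' (by positivity), Real.log_rpow hL] at h3
  rw [← Real.log_lt_log_iff (by positivity) (boundS₀_pos hk hd hμ ha hf), Real.log_rpow hT,
    log_boundS₀ hk hd hμ ha hf, ← sub_pos]
  have h4 := mul_le_mul_of_nonneg_left h1 (by positivity : 0 ≤ (p - 1 + γ) / (α + 1))
  have h5 : 0 < Real.log (α + γ) + (Real.log Nf + (1 - γ) / p * Real.log L)
    - (Real.log (α + 1 - p) + (Real.log a₀ + Real.log L))
    + ((p - 1 + γ) / (α + 1) * ((α + 1 - p) / p *
    (Real.log L - Real.log μ₀) + Real.log L) - (p - 1 + γ) / (α + 1) * Real.log T) := by linarith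
  refine (div_pos h5 hk).trans_eq ?_
  field_simp
  ring

end Bounds

namespace WeightedGraph

open Filter Topology

section PowerIntegral

variable {V : Type*} {G : WeightedGraph V} {κ w : V → ℝ} {r R : ℝ}

/-- The integral `∫ κ w^r dμ`. -/
noncomputable def powInt (G : WeightedGraph V) (κ : V → ℝ) (r : ℝ) (w : V → ℝ) : ℝ :=
  G.integral fun x => κ x * w x ^ r

lemma powInt_nonneg (hκ : ∀ x, 0 ≤ κ x) (hw : ∀ x, 0 ≤ w x) : 0 ≤ G.powInt κ r w :=
  integral_nonneg fun x => mul_nonneg (hκ x) (Real.rpow_nonneg (hw x) _)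

lemma integrable_mul_rpow (hκ : ∀ x, 0 ≤ κ x) (hi : G.Integrable κ) (hr : 0 ≤ r)
    (hw : ∀ x, 0 ≤ w x) (hR : ∀ x, w x ≤ R) : G.Integrable fun x => κ x * w x ^ r := by
  refine (hi.const_mul (R ^ r)).of_le
    (fun x => mul_nonneg (hκ x) (Real.rpow_nonneg (hw x) _)) fun x => ?_
  rw [mul_comm]
  exact mul_le_mul_of_nonneg_right (Real.rpow_le_rpow (hw x) (hR x) hr) (hκ x)

lemma tendsto_powInt {ι : Type*} {l : Filter ι} (hκ : ∀ x, 0 ≤ κ x) (hi : G.Integrable κ)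
    (hr : 0 ≤ r) {u : ι → V → ℝ} (hu0 : ∀ᶠ i in l, ∀ x, 0 ≤ u i x)
    (huR : ∀ᶠ i in l, ∀ x, u i x ≤ R) (hu : ∀ x, Tendsto (fun i => u i x) l (𝓝 (w x))) :
    Tendsto (fun i => G.powInt κ r (u i)) l (𝓝 (G.powInt κ r w)) := by
  refine tendsto_integral_of_dominated (hi.const_mul (R ^ r))
    (fun x => ((hu x).rpow_const (Or.inr hr)).const_mul _) ?_
  filter_upwards [hu0, huR] with i h0 hR x
  rw [abs_of_nonneg (mul_nonneg (hκ x) (Real.rpow_nonneg (h0 x) _)), mul_comm]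
  exact mul_le_mul_of_nonneg_right (Real.rpow_le_rpow (h0 x) (hR x) hr) (hκ x)

lemma powInt_smul {t : ℝ} (ht : 0 ≤ t) (hw : ∀ x, 0 ≤ w x) :
    G.powInt κ r (t • w) = t ^ r * G.powInt κ r w := by
  rw [powInt, powInt, ← integral_const_mul]
  refine congrArg _ (funext fun x => ?_)
  rw [Pi.smul_apply, smul_eq_mul, Real.mul_rpow ht (hw x)]
  ring

/-- Hölder's inequality. -/
lemma powInt_le_of_memL {p γ : ℝ} (hp : 1 < p) (hγ0 : 0 < γ) (hγ1 : γ < 1)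
    (hκ : ∀ x, 0 ≤ κ x) (hi : G.MemL (p / (p - 1 + γ)) κ) (hw0 : ∀ x, 0 ≤ w x)
    (hw : G.Integrable fun x => w x ^ p) :
    G.powInt κ (1 - γ) w ≤
      G.normL (p / (p - 1 + γ)) κ * (G.integral fun x => w x ^ p) ^ ((1 - γ) / p) := by
  have hk : 0 < p - 1 + γ := by linarith
  have hγ' : 0 < 1 - γ := by linarith
  set r := p / (p - 1 + γ) with hr
  set r' := p / (1 - γ) with hr'
  have hr0 : 0 < r := by positivity
  have hr0' : 0 < r' := by positivity
  have hc : r.HolderConjugate r' := by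
    rw [Real.holderConjugate_iff]
    refine ⟨by rw [hr, one_lt_div hk]; linarith, ?_⟩
    rw [hr, hr', inv_div, inv_div, ← add_div]
    rw [show p - 1 + γ + (1 - γ) = p by ring, div_self (by linarith)]
  have e1 : ∀ x, (G.meas x ^ (1 / r) * κ x) ^ r = G.meas x * |κ x| ^ r := fun x => by
    rw [Real.mul_rpow (Real.rpow_nonneg (G.meas_pos x).le _) (hκ x),
      ← Real.rpow_mul (G.meas_pos x).le, one_div_mul_cancel hr0.ne', Real.rpow_one,
      abs_of_nonneg (hκ x)]
  have e2 : ∀ x, (G.meas x ^ (1 / r') * w x ^ (1 - γ)) ^ r' = G.meas x * w x ^ p := fun x => by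
    rw [Real.mul_rpow (Real.rpow_nonneg (G.meas_pos x).le _) (Real.rpow_nonneg (hw0 x) _),
      ← Real.rpow_mul (G.meas_pos x).le, one_div_mul_cancel hr0'.ne', Real.rpow_one,
      ← Real.rpow_mul (hw0 x), hr', mul_div_cancel₀ _ hγ'.ne']
  have h := Real.inner_le_Lp_mul_Lq_tsum_of_nonneg hc
    (f := fun x => G.meas x ^ (1 / r) * κ x) (g := fun x => G.meas x ^ (1 / r') * w x ^ (1 - γ))
    (fun x => mul_nonneg (Real.rpow_nonneg (G.meas_pos x).le _) (hκ x))
    (fun x => mul_nonneg (Real.rpow_nonneg (G.meas_pos x).le _) (Real.rpow_nonneg (hw0 x) _))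
    (by simpa only [e1] using (show Summable _ from hi))
    (by simpa only [e2] using (show Summable _ from hw))
  simp only [e1, e2] at h
  have e3 : ∀ x, G.meas x ^ (1 / r) * κ x * (G.meas x ^ (1 / r') * w x ^ (1 - γ)) =
      G.meas x * (κ x * w x ^ (1 - γ)) := fun x => by
    have : G.meas x ^ (1 / r) * G.meas x ^ (1 / r') = G.meas x := by
      rw [← Real.rpow_add (G.meas_pos x), one_div, one_div, hc.inv_add_inv_eq_one, Real.rpow_one]
    calc _ = (G.meas x ^ (1 / r) * G.meas x ^ (1 / r')) * (κ x * w x ^ (1 - γ)) := by ring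
      _ = _ := by rw [this]
  simp only [e3] at h
  rw [show (1 - γ) / p = 1 / r' by rw [hr', one_div_div]]
  exact h

/-- The embedding of `L^p` into `L^s` for `p ≤ s` on a graph with measure bounded below. -/
lemma integral_rpow_embedding {μ₀ p s : ℝ} (hμ₀ : 0 < μ₀) (hμ : ∀ x, μ₀ ≤ G.meas x)
    (hp : 0 < p) (hps : p ≤ s) (hw0 : ∀ x, 0 ≤ w x) (hw : G.Integrable fun x => w x ^ p) :
    (G.Integrable fun x => w x ^ s) ∧ (G.integral fun x => w x ^ s) ≤
      ((G.integral fun x => w x ^ p) / μ₀) ^ ((s - p) / p) * G.integral fun x => w x ^ p := by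
  set L := G.integral fun x => w x ^ p
  have hn : ∀ (r : ℝ) x, 0 ≤ w x ^ r := fun r x => Real.rpow_nonneg (hw0 x) r
  have hb : ∀ x, w x ^ s ≤ (L / μ₀) ^ ((s - p) / p) * w x ^ p := fun x => by
    have h1 : w x ^ p ≤ L / μ₀ := by
      rw [le_div_iff₀ hμ₀, mul_comm]
      exact (mul_le_mul_of_nonneg_right (hμ x) (hn p x)).trans
        (meas_mul_le_integral hw (hn p) x)
    have h2 : w x ^ s = (w x ^ p) ^ ((s - p) / p) * w x ^ p := by
      rcases (hw0 x).eq_or_lt with h0 | h0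
      · rw [← h0, Real.zero_rpow hp.ne', Real.zero_rpow (by linarith), mul_zero]
      · rw [← Real.rpow_mul (hw0 x), mul_div_cancel₀ _ hp.ne', ← Real.rpow_add h0]
        ring_nf
    rw [h2]
    exact mul_le_mul_of_nonneg_right
      (Real.rpow_le_rpow (hn p x) h1 (div_nonneg (by linarith) hp.le)) (hn p x)
  have hi := (hw.const_mul ((L / μ₀) ^ ((s - p) / p))).of_le (hn s) hb
  refine ⟨hi, (integral_mono hi (hw.const_mul _) hb).trans_eq (integral_const_mul _ _)⟩

end PowerIntegral

/-- The standing assumptions on the data of the problem. -/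
structure Admissible {V : Type*} (G : WeightedGraph V) (μ₀ a₀ b₀ p q γ α lam : ℝ)
    (a b f g : V → ℝ) : Prop where
  μ₀_pos : 0 < μ₀
  μ₀_le : ∀ x, μ₀ ≤ G.meas x
  γ_pos : 0 < γ
  γ_lt : γ < 1
  one_lt_q : 1 < q
  q_le : q ≤ p
  p_lt : p < α + 1
  a₀_pos : 0 < a₀
  a₀_le : ∀ x, a₀ ≤ a x
  b₀_pos : 0 < b₀
  b₀_le : ∀ x, b₀ ≤ b x
  f_pos : ∀ x, 0 < f x
  f_int : G.Integrable f
  f_mem : G.MemL (p / (p - 1 + γ)) f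
  g_nonneg : ∀ x, 0 ≤ g x
  g_ne : ∃ x, g x ≠ 0
  g_int : G.Integrable g
  g_bdd : MemLinfty g
  lam_pos : 0 < lam
  lam_lt : lam < lamStar p γ α μ₀ a₀ (G.normL (p / (p - 1 + γ)) f) (supNorm g)

/-- The fibering function of `w`. -/
noncomputable def fib {V : Type*} (G : WeightedGraph V) (p q γ α lam : ℝ) (a b f g w : V → ℝ) :
    ℝ → ℝ :=
  fibFn p q γ α (G.energy p a w) (G.energy q b w) (G.powInt f (1 - γ) w)
    (lam * G.powInt g (α + 1) w)

/-- The energy functional along the ray through `w`. -/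
noncomputable def ray {V : Type*} (G : WeightedGraph V) (p q γ α lam : ℝ) (a b f g w : V → ℝ) :
    ℝ → ℝ :=
  rayFn p q γ α (G.energy p a w) (G.energy q b w) (G.powInt f (1 - γ) w)
    (lam * G.powInt g (α + 1) w)

namespace Admissible

variable {V : Type*} {G : WeightedGraph V} {μ₀ a₀ b₀ p q γ α lam : ℝ} {a b f g : V → ℝ}
  {w : V → ℝ}

lemma a_nonneg (H : Admissible G μ₀ a₀ b₀ p q γ α lam a b f g) (x : V) : 0 ≤ a x :=
  H.a₀_pos.le.trans (H.a₀_le x)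

lemma b_nonneg (H : Admissible G μ₀ a₀ b₀ p q γ α lam a b f g) (x : V) : 0 ≤ b x :=
  H.b₀_pos.le.trans (H.b₀_le x)

lemma one_lt_p (H : Admissible G μ₀ a₀ b₀ p q γ α lam a b f g) : 1 < p :=
  H.one_lt_q.trans_le H.q_le

lemma slope_pos (H : Admissible G μ₀ a₀ b₀ p q γ α lam a b f g) : 0 < p - 1 + γ := by
  linarith [H.one_lt_p, H.γ_pos]

lemma gap_pos (H : Admissible G μ₀ a₀ b₀ p q γ α lam a b f g) : 0 < α + 1 - p := by
  linarith [H.p_lt]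

lemma g_le (H : Admissible G μ₀ a₀ b₀ p q γ α lam a b f g) (x : V) : g x ≤ supNorm g :=
  (le_abs_self _).trans (le_ciSup H.g_bdd x)

lemma supNorm_pos (H : Admissible G μ₀ a₀ b₀ p q γ α lam a b f g) : 0 < supNorm g := by
  obtain ⟨x, hx⟩ := H.g_ne
  exact (lt_of_le_of_ne (H.g_nonneg x) hx.symm).trans_le (H.g_le x)

lemma normL_pos (H : Admissible G μ₀ a₀ b₀ p q γ α lam a b f g) :
    0 < G.normL (p / (p - 1 + γ)) f := by
  obtain ⟨x, -⟩ := H.g_ne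
  exact Real.rpow_pos_of_pos (integral_pos H.f_mem
    (fun x => Real.rpow_nonneg (abs_nonneg _) _) (x := x)
    (Real.rpow_pos_of_pos (abs_pos.2 (H.f_pos x).ne') _)) _

lemma le_of_energy_le (H : Admissible G μ₀ a₀ b₀ p q γ α lam a b f g)
    (hw : w ∈ G.coneW p q a b) {M : ℝ} (hM : G.energy p a w ≤ M) (x : V) :
    w x ≤ (M / (μ₀ * a₀)) ^ (1 / p) := by
  have hp : 0 < p := by linarith [H.one_lt_p]
  have hc : 0 < μ₀ * a₀ := mul_pos H.μ₀_pos H.a₀_pos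
  have h := hw.1.1.abs_rpow_le H.a₀_pos H.a₀_le H.μ₀_pos H.μ₀_le x
  rw [abs_of_nonneg (hw.2 x)] at h
  have h2 := Real.rpow_le_rpow (Real.rpow_nonneg (hw.2 x) _)
    (h.trans (div_le_div_of_nonneg_right hM hc.le)) (by positivity : 0 ≤ 1 / p)
  rwa [← Real.rpow_mul (hw.2 x), mul_one_div_cancel hp.ne', Real.rpow_one] at h2

lemma integrable_sing (H : Admissible G μ₀ a₀ b₀ p q γ α lam a b f g)
    (hw : w ∈ G.coneW p q a b) : G.Integrable fun x => f x * w x ^ (1 - γ) :=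
  integrable_mul_rpow (fun x => (H.f_pos x).le) H.f_int (by linarith [H.γ_lt]) hw.2
    (H.le_of_energy_le hw le_rfl)

lemma integrable_super (H : Admissible G μ₀ a₀ b₀ p q γ α lam a b f g)
    (hw : w ∈ G.coneW p q a b) : G.Integrable fun x => g x * w x ^ (α + 1) :=
  integrable_mul_rpow H.g_nonneg H.g_int (by linarith [H.one_lt_p, H.p_lt]) hw.2
    (H.le_of_energy_le hw le_rfl)

lemma sing_pos (H : Admissible G μ₀ a₀ b₀ p q γ α lam a b f g)
    (hw : w ∈ G.coneW p q a b) {x : V} (hx : w x ≠ 0) : 0 < G.powInt f (1 - γ) w :=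
  integral_pos (H.integrable_sing hw)
    (fun y => mul_nonneg (H.f_pos y).le (Real.rpow_nonneg (hw.2 y) _)) (x := x)
    (mul_pos (H.f_pos x) (Real.rpow_pos_of_pos (lt_of_le_of_ne (hw.2 x) hx.symm) _))

lemma super_nonneg (H : Admissible G μ₀ a₀ b₀ p q γ α lam a b f g)
    (hw : w ∈ G.coneW p q a b) : 0 ≤ lam * G.powInt g (α + 1) w :=
  mul_nonneg H.lam_pos.le (powInt_nonneg H.g_nonneg hw.2)

lemma smul_mem_cone (H : Admissible G μ₀ a₀ b₀ p q γ α lam a b f g)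
    (hw : w ∈ G.coneW p q a b) {t : ℝ} (ht : 0 ≤ t) : t • w ∈ G.coneW p q a b :=
  ⟨⟨hw.1.1.smul H.a₀_pos H.a₀_le t, hw.1.2.smul H.b₀_pos H.b₀_le t⟩,
    fun x => mul_nonneg ht (hw.2 x)⟩

lemma add_mem_cone (H : Admissible G μ₀ a₀ b₀ p q γ α lam a b f g)
    {v : V → ℝ} (hw : w ∈ G.coneW p q a b) (hv : v ∈ G.coneW p q a b) :
    w + v ∈ G.coneW p q a b :=
  ⟨⟨hw.1.1.add H.a₀_pos H.a₀_le H.one_lt_p.le hv.1.1,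
    hw.1.2.add H.b₀_pos H.b₀_le H.one_lt_q.le hv.1.2⟩, fun x => add_nonneg (hw.2 x) (hv.2 x)⟩

lemma fib_smul (hw : w ∈ G.coneW p q a b) {t : ℝ} (ht : 0 < t) :
    G.fib p q γ α lam a b f g (t • w) 1 = t ^ (1 - γ) * G.fib p q γ α lam a b f g w t := by
  have e : ∀ r s : ℝ, t ^ (1 - γ) * (t ^ r * s) = t ^ (1 - γ + r) * s := fun r s => by
    rw [← mul_assoc, ← Real.rpow_add ht]
  rw [fib, fib, fibFn_one, fibFn, energy_smul, energy_smul, powInt_smul ht.le hw.2,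
    powInt_smul ht.le hw.2, abs_of_pos ht, mul_sub, mul_sub, mul_add, e, e, e]
  ring_nf

lemma ray_smul (hw : w ∈ G.coneW p q a b) {t : ℝ} (ht : 0 ≤ t) :
    G.ray p q γ α lam a b f g (t • w) 1 = G.ray p q γ α lam a b f g w t := by
  rw [ray, ray, rayFn, rayFn, energy_smul, energy_smul, powInt_smul ht hw.2,
    powInt_smul ht hw.2, abs_of_nonneg ht]
  simp only [Real.one_rpow]
  ring

lemma fiber_eq (H : Admissible G μ₀ a₀ b₀ p q γ α lam a b f g) (w : V → ℝ) (t : ℝ) :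
    G.fiber p q γ α lam a b f g w t = G.fib p q γ α lam a b f g w t := by
  have hq : 0 < q := by linarith [H.one_lt_q]
  have hp : 0 < p := by linarith [H.one_lt_p]
  rw [fiber, fib, fibFn, normW_rpow hp.ne' H.a_nonneg, normW_rpow hq.ne' H.b_nonneg, powInt,
    powInt]
  ring

lemma nehariSign_eq (H : Admissible G μ₀ a₀ b₀ p q γ α lam a b f g) (w : V → ℝ) :
    G.nehariSign p q γ α lam a b g w = (p - 1 + γ) * G.energy p a w +
      (q - 1 + γ) * G.energy q b w - (α + γ) * (lam * G.powInt g (α + 1) w) := by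
  have hq : 0 < q := by linarith [H.one_lt_q]
  have hp : 0 < p := by linarith [H.one_lt_p]
  rw [nehariSign, normW_rpow hp.ne' H.a_nonneg, normW_rpow hq.ne' H.b_nonneg, powInt]
  ring

lemma mem_nehari_iff (H : Admissible G μ₀ a₀ b₀ p q γ α lam a b f g) :
    w ∈ G.nehari p q γ α lam a b f g ↔
      w ∈ G.coneW p q a b ∧ G.fib p q γ α lam a b f g w 1 = 0 := by
  constructor
  · rintro ⟨u, hu, t, ht, h, rfl⟩
    rw [H.fiber_eq] at h
    exact ⟨H.smul_mem_cone hu ht.le, by rw [fib_smul hu ht, h, mul_zero]⟩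
  · rintro ⟨hw, h⟩
    exact ⟨w, hw, 1, one_pos, by rw [H.fiber_eq, h], (one_smul ℝ w).symm⟩

lemma integrable_rpow (hw : w ∈ G.coneW p q a b) : G.Integrable fun x => w x ^ p := by
  have := hw.1.1.integrable_rpow
  simpa only [abs_of_nonneg (hw.2 _)] using this

lemma a₀_mul_le_energy (H : Admissible G μ₀ a₀ b₀ p q γ α lam a b f g)
    (hw : w ∈ G.coneW p q a b) : a₀ * (G.integral fun x => w x ^ p) ≤ G.energy p a w := by
  rw [← integral_const_mul]
  refine integral_mono ((integrable_rpow hw).const_mul _)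
    (hw.1.1.integrable_density H.a_nonneg) fun x => ?_
  rw [density, abs_of_nonneg (hw.2 x)]
  exact (mul_le_mul_of_nonneg_right (H.a₀_le x) (Real.rpow_nonneg (hw.2 x) _)).trans
    (le_add_of_nonneg_left (gradLen_rpow_nonneg _ _ _))

lemma sing_le (H : Admissible G μ₀ a₀ b₀ p q γ α lam a b f g)
    (hw : w ∈ G.coneW p q a b) : G.powInt f (1 - γ) w ≤
      G.normL (p / (p - 1 + γ)) f * (G.integral fun x => w x ^ p) ^ ((1 - γ) / p) :=
  powInt_le_of_memL H.one_lt_p H.γ_pos H.γ_lt (fun x => (H.f_pos x).le) H.f_mem hw.2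
    (integrable_rpow hw)

lemma embedding (H : Admissible G μ₀ a₀ b₀ p q γ α lam a b f g)
    (hw : w ∈ G.coneW p q a b) : (G.Integrable fun x => w x ^ (α + 1)) ∧
      (G.integral fun x => w x ^ (α + 1)) ≤ ((G.integral fun x => w x ^ p) / μ₀) ^
        ((α + 1 - p) / p) * G.integral fun x => w x ^ p :=
  integral_rpow_embedding H.μ₀_pos H.μ₀_le (by linarith [H.one_lt_p]) H.p_lt.le hw.2
    (integrable_rpow hw)

lemma super_le (H : Admissible G μ₀ a₀ b₀ p q γ α lam a b f g)
    (hw : w ∈ G.coneW p q a b) :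
    G.powInt g (α + 1) w ≤ supNorm g * G.integral fun x => w x ^ (α + 1) := by
  rw [← integral_const_mul]
  exact integral_mono (H.integrable_super hw) ((H.embedding hw).1.const_mul _) fun x =>
    mul_le_mul_of_nonneg_right (H.g_le x) (Real.rpow_nonneg (hw.2 x) _)

lemma integral_rpow_pos (hw : w ∈ G.coneW p q a b) {r : ℝ}
    (hi : G.Integrable fun x => w x ^ r) {x : V} (hx : w x ≠ 0) :
    0 < G.integral fun x => w x ^ r :=
  integral_pos hi (fun y => Real.rpow_nonneg (hw.2 y) _) (x := x)
    (Real.rpow_pos_of_pos (lt_of_le_of_ne (hw.2 x) hx.symm) _)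

lemma normL_eq (hw : w ∈ G.coneW p q a b) (r : ℝ) :
    G.normL r w = (G.integral fun x => w x ^ r) ^ (1 / r) := by
  simp only [normL, abs_of_nonneg (hw.2 _)]

lemma exists_ne_of_super_pos (hα : 0 < α + 1) (h : 0 < G.powInt g (α + 1) w) :
    ∃ x, w x ≠ 0 := by
  by_contra! hc
  simp [powInt, integral, hc, Real.zero_rpow hα.ne'] at h

lemma exists_ne_of_energy_pos {s : ℝ} {h : V → ℝ} (hs : s ≠ 0) (hw : 0 < G.energy s h w) :
    ∃ x, w x ≠ 0 := by
  by_contra! hc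
  simp [energy, density, gradLen, Gam, integral, hc, Real.zero_rpow hs] at hw

/-- The inequality that defines `D⁻` forces the norm beyond `X(lam)`. -/
lemma lt_of_slope_lt (H : Admissible G μ₀ a₀ b₀ p q γ α lam a b f g)
    (hw : w ∈ G.coneW p q a b)
    (h : (p - 1 + γ) * G.energy p a w < (α + γ) * (lam * G.powInt g (α + 1) w)) :
    boundX p γ α μ₀ a₀ (supNorm g) lam < G.normW p a w ∧
      boundS p γ α μ₀ a₀ (supNorm g) lam < G.normL (α + 1) w := by
  have hα : 0 < α + γ := by linarith [H.slope_pos, H.p_lt]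
  have hp : 0 < p := by linarith [H.one_lt_p]
  have h0 : 0 < lam * G.powInt g (α + 1) w :=
    pos_of_mul_pos_right ((mul_nonneg H.slope_pos.le (energy_nonneg H.a_nonneg w)).trans_lt h) hα.le
  obtain ⟨x, hx⟩ := exists_ne_of_super_pos (by linarith [H.p_lt])
    (pos_of_mul_pos_right h0 H.lam_pos.le)
  have hL := integral_rpow_pos hw (integrable_rpow hw) hx
  have hT := integral_rpow_pos hw (H.embedding hw).1 hx
  have h' := h.trans_le (mul_le_mul_of_nonneg_left
    (mul_le_mul_of_nonneg_left (H.super_le hw) H.lam_pos.le) hα.le)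
  refine ⟨boundX_lt_of hp H.slope_pos H.gap_pos H.μ₀_pos H.a₀_pos H.supNorm_pos H.lam_pos hL hT
    (H.embedding hw).2 (H.a₀_mul_le_energy hw) h', ?_⟩
  rw [normL_eq hw]
  exact boundS_lt_of hp H.slope_pos H.gap_pos H.μ₀_pos H.a₀_pos H.supNorm_pos H.lam_pos hL hT
    (H.embedding hw).2 (H.a₀_mul_le_energy hw) h'

/-- The inequality satisfied on `D⁺` keeps the norm below `X₀`. -/
lemma lt_of_lt_sing (H : Admissible G μ₀ a₀ b₀ p q γ α lam a b f g)
    (hw : w ∈ G.coneW p q a b) (hne : ∃ x, w x ≠ 0)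
    (h : (α + 1 - p) * G.energy p a w < (α + γ) * G.powInt f (1 - γ) w) :
    G.normW p a w < boundX₀ p γ α a₀ (G.normL (p / (p - 1 + γ)) f) ∧
      G.normL (α + 1) w < boundS₀ p γ α μ₀ a₀ (G.normL (p / (p - 1 + γ)) f) := by
  have hp : 0 < p := by linarith [H.one_lt_p]
  obtain ⟨x, hx⟩ := hne
  have hL := integral_rpow_pos hw (integrable_rpow hw) hx
  have hT := integral_rpow_pos hw (H.embedding hw).1 hx
  refine ⟨lt_boundX₀_of hp H.slope_pos H.gap_pos H.γ_lt H.a₀_pos H.normL_pos hL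
    (H.a₀_mul_le_energy hw) (H.sing_le hw) h, ?_⟩
  rw [normL_eq hw]
  exact lt_boundS₀_of hp H.slope_pos H.gap_pos H.μ₀_pos H.a₀_pos H.normL_pos hL hT
    (H.embedding hw).2 (H.a₀_mul_le_energy hw) (H.sing_le hw) h

lemma bounds_of_mem_nehariMinus (H : Admissible G μ₀ a₀ b₀ p q γ α lam a b f g)
    (hw : w ∈ G.nehariMinus p q γ α lam a b f g) :
    boundX p γ α μ₀ a₀ (supNorm g) lam < G.normW p a w ∧
      boundS p γ α μ₀ a₀ (supNorm g) lam < G.normL (α + 1) w ∧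
      G.normW p a w < G.normWW p q a b w := by
  have hc := (H.mem_nehari_iff.1 hw.1).1
  have hs := hw.2
  rw [H.nehariSign_eq] at hs
  have hq : 0 < q - 1 + γ := by linarith [H.one_lt_q, H.γ_pos]
  have hQ := mul_nonneg hq.le (energy_nonneg (G := G) (s := q) H.b_nonneg w)
  have h1 := H.lt_of_slope_lt hc (by linarith)
  refine ⟨h1.1, h1.2, lt_add_of_pos_right _ ?_⟩
  have hA := (boundX_pos H.slope_pos H.gap_pos H.μ₀_pos H.a₀_pos H.supNorm_pos H.lam_pos).trans h1.1
  have hp0 : p ≠ 0 := by linarith [H.one_lt_p]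
  have hP : 0 < G.energy p a w := by
    rw [← normW_rpow hp0 H.a_nonneg]
    exact Real.rpow_pos_of_pos hA _
  obtain ⟨x, hx⟩ := exists_ne_of_energy_pos hp0 hP
  exact Real.rpow_pos_of_pos (hc.1.2.energy_pos H.b₀_pos H.b₀_le hx) _

lemma bounds_of_mem_nehariPlus (H : Admissible G μ₀ a₀ b₀ p q γ α lam a b f g)
    (hne : ∃ x, w x ≠ 0) (hw : w ∈ G.nehariPlus p q γ α lam a b f g) :
    G.normW p a w < boundX₀ p γ α a₀ (G.normL (p / (p - 1 + γ)) f) ∧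
      G.normL (α + 1) w < boundS₀ p γ α μ₀ a₀ (G.normL (p / (p - 1 + γ)) f) := by
  obtain ⟨hc, h0⟩ := H.mem_nehari_iff.1 hw.1
  have hs := hw.2
  rw [H.nehariSign_eq] at hs
  rw [fib, fibFn_one] at h0
  have hq : 0 < α + 1 - q := by linarith [H.p_lt, H.q_le]
  have hQ := mul_nonneg hq.le (energy_nonneg (G := G) (s := q) H.b_nonneg w)
  refine H.lt_of_lt_sing hc hne ?_
  have : lam * G.powInt g (α + 1) w
      = G.energy p a w + G.energy q b w - G.powInt f (1 - γ) w := by linarith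
  rw [this] at hs
  nlinarith

lemma X₀_pos (H : Admissible G μ₀ a₀ b₀ p q γ α lam a b f g) :
    0 < boundX₀ p γ α a₀ (G.normL (p / (p - 1 + γ)) f) :=
  boundX₀_pos H.slope_pos H.gap_pos H.a₀_pos H.normL_pos

lemma X₀_lt_X (H : Admissible G μ₀ a₀ b₀ p q γ α lam a b f g) :
    boundX₀ p γ α a₀ (G.normL (p / (p - 1 + γ)) f) < boundX p γ α μ₀ a₀ (supNorm g) lam :=
  boundX₀_lt_boundX (by linarith [H.one_lt_p]) H.slope_pos H.gap_pos H.μ₀_pos H.a₀_pos H.normL_pos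
    H.supNorm_pos H.lam_pos H.lam_lt

/-- The fibering function is positive when the norm is in the gap `[X₀, X(lam)]`. -/
lemma fib_one_pos (H : Admissible G μ₀ a₀ b₀ p q γ α lam a b f g)
    (hw : w ∈ G.coneW p q a b)
    (h1 : boundX₀ p γ α a₀ (G.normL (p / (p - 1 + γ)) f) ≤ G.normW p a w)
    (h2 : G.normW p a w ≤ boundX p γ α μ₀ a₀ (supNorm g) lam) :
    0 < G.fib p q γ α lam a b f g w 1 := by
  have hA := H.X₀_pos.trans_le h1
  have hp0 : p ≠ 0 := by linarith [H.one_lt_p]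
  have hP : 0 < G.energy p a w := by
    rw [← normW_rpow hp0 H.a_nonneg]
    exact Real.rpow_pos_of_pos hA _
  obtain ⟨x, hx⟩ := exists_ne_of_energy_pos hp0 hP
  have hQ := hw.1.2.energy_pos H.b₀_pos H.b₀_le hx
  have e1 : (α + γ) * (lam * G.powInt g (α + 1) w) ≤ (p - 1 + γ) * G.energy p a w := by
    by_contra! hc
    exact absurd (H.lt_of_slope_lt hw hc).1 h2.not_gt
  have e2 : (α + γ) * G.powInt f (1 - γ) w ≤ (α + 1 - p) * G.energy p a w := by
    by_contra! hc
    exact absurd (H.lt_of_lt_sing hw ⟨x, hx⟩ hc).1 h1.not_gt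
  have hα : 0 < α + γ := by linarith [H.slope_pos, H.p_lt]
  rw [fib, fibFn_one]
  have : 0 < (α + γ) * (G.energy p a w + G.energy q b w - G.powInt f (1 - γ) w
    - lam * G.powInt g (α + 1) w) := by nlinarith
  exact pos_of_mul_pos_right this hα.le

lemma fib_pos (H : Admissible G μ₀ a₀ b₀ p q γ α lam a b f g)
    (hw : w ∈ G.coneW p q a b) {t : ℝ} (ht : 0 < t)
    (h1 : boundX₀ p γ α a₀ (G.normL (p / (p - 1 + γ)) f) ≤ t * G.normW p a w)
    (h2 : t * G.normW p a w ≤ boundX p γ α μ₀ a₀ (supNorm g) lam) :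
    0 < G.fib p q γ α lam a b f g w t := by
  have hp : 0 < p := by linarith [H.one_lt_p]
  have e : G.normW p a (t • w) = t * G.normW p a w := by
    rw [normW_smul hp H.a_nonneg, abs_of_pos ht]
  have := H.fib_one_pos (H.smul_mem_cone hw ht.le) (by rwa [e]) (by rwa [e])
  rw [fib_smul hw ht] at this
  exact pos_of_mul_pos_right this (Real.rpow_nonneg ht.le _)

lemma mem_nehariMinus (H : Admissible G μ₀ a₀ b₀ p q γ α lam a b f g)
    (hw : w ∈ G.coneW p q a b) (h0 : G.fib p q γ α lam a b f g w 1 = 0)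
    (h : boundX p γ α μ₀ a₀ (supNorm g) lam < G.normW p a w) :
    w ∈ G.nehariMinus p q γ α lam a b f g := by
  refine ⟨H.mem_nehari_iff.2 ⟨hw, h0⟩, ?_⟩
  have hX := H.X₀_pos.trans H.X₀_lt_X
  have hA := hX.trans h
  rw [H.nehariSign_eq]
  refine fibSlope_neg H.γ_pos H.one_lt_q H.q_le H.p_lt (energy_nonneg H.b_nonneg w)
    (H.super_nonneg hw) h0 (t := boundX p γ α μ₀ a₀ (supNorm g) lam / G.normW p a w)
    (by positivity) ((div_lt_one hA).2 h) ?_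
  exact H.fib_pos hw (by positivity) (by rw [div_mul_cancel₀ _ hA.ne']; exact H.X₀_lt_X.le)
    (by rw [div_mul_cancel₀ _ hA.ne'])

lemma mem_nehariPlus (H : Admissible G μ₀ a₀ b₀ p q γ α lam a b f g)
    (hw : w ∈ G.coneW p q a b) (hne : ∃ x, w x ≠ 0) (h0 : G.fib p q γ α lam a b f g w 1 = 0)
    (h : G.normW p a w < boundX₀ p γ α a₀ (G.normL (p / (p - 1 + γ)) f)) :
    w ∈ G.nehariPlus p q γ α lam a b f g := by
  refine ⟨H.mem_nehari_iff.2 ⟨hw, h0⟩, ?_⟩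
  obtain ⟨x, hx⟩ := hne
  have hA : 0 < G.normW p a w :=
    Real.rpow_pos_of_pos (hw.1.1.energy_pos H.a₀_pos H.a₀_le hx) _
  have hX := H.X₀_pos
  rw [H.nehariSign_eq]
  refine fibSlope_pos H.γ_pos H.one_lt_q H.q_le H.p_lt (energy_nonneg H.b_nonneg w)
    (H.super_nonneg hw) h0 (t := boundX₀ p γ α a₀ (G.normL (p / (p - 1 + γ)) f) / G.normW p a w)
    ((one_lt_div hA).2 h) ?_
  exact H.fib_pos hw (by positivity) (by rw [div_mul_cancel₀ _ hA.ne'])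
    (by rw [div_mul_cancel₀ _ hA.ne']; exact H.X₀_lt_X.le)

/-- On `D⁻` the energy is maximal along the part of the ray beyond `X₀`. -/
lemma ray_le_of_mem_nehariMinus (H : Admissible G μ₀ a₀ b₀ p q γ α lam a b f g)
    (hw : w ∈ G.nehariMinus p q γ α lam a b f g) {t : ℝ}
    (ht : boundX₀ p γ α a₀ (G.normL (p / (p - 1 + γ)) f) ≤ t * G.normW p a w) :
    G.ray p q γ α lam a b f g w t ≤ G.ray p q γ α lam a b f g w 1 := by
  obtain ⟨hc, h0⟩ := H.mem_nehari_iff.1 hw.1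
  have h := H.X₀_lt_X.trans (H.bounds_of_mem_nehariMinus hw).1
  have hX := H.X₀_pos
  have hA := hX.trans h
  refine rayFn_le_rayFn_one H.γ_pos H.γ_lt H.one_lt_q H.q_le H.p_lt (energy_nonneg H.b_nonneg w)
    (H.super_nonneg hc) h0 (r := boundX₀ p γ α a₀ (G.normL (p / (p - 1 + γ)) f) / G.normW p a w)
    (by positivity) ((div_lt_one hA).2 h) ?_ ((div_le_iff₀ hA).2 ht)
  exact H.fib_pos hc (by positivity) (by rw [div_mul_cancel₀ _ hA.ne'])
    (by rw [div_mul_cancel₀ _ hA.ne']; exact H.X₀_lt_X.le)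

end Admissible

section Truncation

variable {V : Type*} {G : WeightedGraph V} {s h₀ : ℝ} {h v φ : V → ℝ}

/-- The excess `(φ - k v)⁺` of `φ` over `k v`. -/
noncomputable def excess (φ v : V → ℝ) (k : ℝ) (x : V) : ℝ := max (φ x - k * v x) 0

lemma excess_nonneg (φ v : V → ℝ) (k : ℝ) (x : V) : 0 ≤ excess φ v k x := le_max_right _ _

lemma excess_le (hv : ∀ x, 0 ≤ v x) (hφ : ∀ x, 0 ≤ φ x) {k : ℝ} (hk : 0 ≤ k) (x : V) :
    excess φ v k x ≤ φ x :=
  max_le (sub_le_self _ (mul_nonneg hk (hv x))) (hφ x)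

lemma excess_ge (φ v : V → ℝ) (k : ℝ) (x : V) : φ x - k * v x ≤ excess φ v k x := le_max_left _ _

lemma tendsto_excess (hv : ∀ x, 0 < v x) (φ : V → ℝ) (x : V) :
    Tendsto (fun k : ℕ => excess φ v k x) atTop (𝓝 0) := by
  refine tendsto_const_nhds.congr' ?_
  obtain ⟨n, hn⟩ := exists_nat_ge (φ x / v x)
  filter_upwards [eventually_ge_atTop n] with k hk
  have h1 : φ x / v x ≤ k := hn.trans (Nat.cast_le.2 hk)
  rw [div_le_iff₀ (hv x)] at h1
  rw [excess, max_eq_right (by linarith)]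

lemma sub_mul_excess_sub_le (φ v : V → ℝ) {k : ℝ} (hk : 0 ≤ k) (x y : V) :
    (v y - v x) * (excess φ v k y - excess φ v k x) ≤ |v y - v x| * |φ y - φ x| := by
  have key : ∀ x y, 0 ≤ v y - v x →
      (v y - v x) * (excess φ v k y - excess φ v k x) ≤ |v y - v x| * |φ y - φ x| := by
    intro x y hd
    rw [abs_of_nonneg hd]
    refine mul_le_mul_of_nonneg_left ?_ hd
    have h1 := excess_ge φ v k x
    have h2 := excess_nonneg φ v k x
    have h3 := le_abs_self (φ y - φ x)
    have h4 := abs_nonneg (φ y - φ x)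
    have h5 := mul_nonneg hk hd
    have h6 : excess φ v k y ≤ excess φ v k x + |φ y - φ x| :=
      max_le (by linarith) (by linarith)
    linarith
  rcases le_total 0 (v y - v x) with hd | hd
  · exact key x y hd
  · have := key y x (by linarith)
    rw [abs_sub_comm (v y), abs_sub_comm (φ y)]
    linarith

lemma integral_form_excess_le (hs : 1 < s) (hh : ∀ x, 0 ≤ h x) (hv0 : ∀ x, 0 < v x)
    (hφ0 : ∀ x, 0 ≤ φ x) (hv : G.MemW s h v) (hφ : G.MemW s h φ)
    (he : ∀ k : ℕ, G.MemW s h (excess φ v k)) :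
    ∃ c : ℕ → ℝ, Tendsto c atTop (𝓝 0) ∧
      ∀ k : ℕ, G.integral (G.form s h v (excess φ v k)) ≤ c k := by
  have hv' : ∀ x, 0 ≤ v x := fun x => (hv0 x).le
  set U : ℕ → V → ℝ := fun k x => G.gradLen v x ^ (s - 2) * (1 / (2 * G.meas x) *
    ∑ y ∈ G.nbhd x, G.weight x y * max ((v y - v x) * (excess φ v k y - excess φ v k x)) 0)
    + h x * v x ^ (s - 1) * excess φ v k x with hU
  have hg : ∀ x, 0 ≤ G.gradLen v x ^ (s - 2) := gradLen_rpow_nonneg _ _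
  have hm : ∀ x, 0 ≤ 1 / (2 * G.meas x) := fun x => by have := G.meas_pos x; positivity
  have hp : ∀ x, 0 ≤ h x * v x ^ (s - 1) := fun x =>
    mul_nonneg (hh x) (Real.rpow_nonneg (hv' x) _)
  have hU0 : ∀ k x, 0 ≤ U k x := fun k x => by
    refine add_nonneg (mul_nonneg (hg x) (mul_nonneg (hm x) (Finset.sum_nonneg fun y hy => ?_)))
      (mul_nonneg (hp x) (excess_nonneg _ _ _ _))
    exact mul_nonneg (G.weight_nonneg_of_mem hy) (le_max_right _ _)
  have hUb : ∀ k x, U k x ≤ G.density s h v x + G.density s h φ x := fun k x => by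
    have h1 : G.gradLen v x ^ (s - 2) * (1 / (2 * G.meas x) *
        ∑ y ∈ G.nbhd x, G.weight x y * max ((v y - v x) * (excess φ v k y - excess φ v k x)) 0)
        ≤ G.gradLen v x ^ s + G.gradLen φ x ^ s := by
      refine (mul_le_mul_of_nonneg_left (mul_le_mul_of_nonneg_left
        (Finset.sum_le_sum fun y hy => ?_) (hm x)) (hg x)).trans
        ((G.gradLen_rpow_mul_absGam_le s v φ x).trans
          (rpow_sub_one_mul_le_add hs (G.gradLen_nonneg v x) (G.gradLen_nonneg φ x)))
      rw [mul_assoc]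
      exact mul_le_mul_of_nonneg_left (max_le (sub_mul_excess_sub_le φ v k.cast_nonneg x y)
        (by positivity)) (G.weight_nonneg_of_mem hy)
    have h2 := mul_le_mul_of_nonneg_left (excess_le hv' hφ0 (k.cast_nonneg) x) (hp x)
    have h3 := mul_le_mul_of_nonneg_left (rpow_sub_one_mul_le_add hs (hv' x) (hφ0 x)) (hh x)
    simp only [hU, density]
    rw [abs_of_nonneg (hv' x), abs_of_nonneg (hφ0 x)]
    linarith
  have hi := (hv.integrable_density hh).add (hφ.integrable_density hh)
  refine ⟨fun k => G.integral (U k), ?_, fun k => ?_⟩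
  · have h0 : G.integral (fun _ => (0 : ℝ)) = 0 := by simp [integral]
    rw [← h0]
    refine tendsto_integral_of_dominated hi (fun x => ?_)
      (Eventually.of_forall fun k x => by rw [abs_of_nonneg (hU0 k x)]; exact hUb k x)
    have hl := tendsto_excess hv0 φ
    have := ((((tendsto_finsetSum (G.nbhd x) fun y _ => ((((hl y).sub (hl x)).const_mul
      (v y - v x)).max (tendsto_const_nhds (x := (0 : ℝ)))).const_mul
      (G.weight x y)).const_mul (1 / (2 * G.meas x))).const_mul
      (G.gradLen v x ^ (s - 2))).add ((hl x).const_mul (h x * v x ^ (s - 1))))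
    simpa [hU] using this
  · refine integral_mono (hv.integrable_form hs hh hv' (he k)) (hi.of_le (hU0 k) (hUb k))
      fun x => ?_
    refine add_le_add (mul_le_mul_of_nonneg_left (mul_le_mul_of_nonneg_left
      (Finset.sum_le_sum fun y hy => ?_) (hm x)) (hg x)) le_rfl
    rw [mul_assoc]
    exact mul_le_mul_of_nonneg_left (le_max_left _ _) (G.weight_nonneg_of_mem hy)

end Truncation

/-- The difference of the two sides of the weak formulation. -/
noncomputable def residual {V : Type*} (G : WeightedGraph V) (p q γ α lam : ℝ)
    (a b f g v φ : V → ℝ) : ℝ :=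
  G.integral (G.form p a v φ) + G.integral (G.form q b v φ)
    - lam * G.integral (fun x => g x * v x ^ α * φ x)
    - G.integral (fun x => f x * v x ^ (-γ) * φ x)

namespace Admissible

variable {V : Type*} {G : WeightedGraph V} {μ₀ a₀ b₀ p q γ α lam : ℝ} {a b f g : V → ℝ}
  {u v φ ψ : V → ℝ}

lemma smul_mem (H : Admissible G μ₀ a₀ b₀ p q γ α lam a b f g) (t : ℝ)
    (hφ : φ ∈ G.spaceW p q a b) : t • φ ∈ G.spaceW p q a b :=
  ⟨hφ.1.smul H.a₀_pos H.a₀_le t, hφ.2.smul H.b₀_pos H.b₀_le t⟩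

lemma add_mem (H : Admissible G μ₀ a₀ b₀ p q γ α lam a b f g)
    (hφ : φ ∈ G.spaceW p q a b) (hψ : ψ ∈ G.spaceW p q a b) : φ + ψ ∈ G.spaceW p q a b :=
  ⟨hφ.1.add H.a₀_pos H.a₀_le H.one_lt_p.le hψ.1, hφ.2.add H.b₀_pos H.b₀_le H.one_lt_q.le hψ.2⟩

lemma mem_of_le (H : Admissible G μ₀ a₀ b₀ p q γ α lam a b f g)
    (hφ : φ ∈ G.spaceW p q a b) (h1 : ∀ x, |ψ x| ≤ |φ x|)
    (h2 : ∀ x y, |ψ y - ψ x| ≤ |φ y - φ x|) : ψ ∈ G.spaceW p q a b :=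
  ⟨hφ.1.of_le H.a₀_pos H.a₀_le (by linarith [H.one_lt_p]) h1 h2,
    hφ.2.of_le H.b₀_pos H.b₀_le (by linarith [H.one_lt_q]) h1 h2⟩

lemma posPart_mem (H : Admissible G μ₀ a₀ b₀ p q γ α lam a b f g)
    (hφ : φ ∈ G.spaceW p q a b) : (fun x => max (φ x) 0) ∈ G.coneW p q a b := by
  refine ⟨H.mem_of_le hφ (fun x => ?_) fun x y => ?_, fun x => le_max_right _ _⟩
  · simpa using abs_max_sub_max_le_abs (φ x) 0 0
  · exact abs_max_sub_max_le_abs (φ y) (φ x) 0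

lemma abs_mem (H : Admissible G μ₀ a₀ b₀ p q γ α lam a b f g)
    (hφ : φ ∈ G.spaceW p q a b) : (fun x => |φ x|) ∈ G.coneW p q a b :=
  ⟨H.mem_of_le hφ (fun _ => (abs_abs _).le) fun _ _ => abs_abs_sub_abs_le _ _,
    fun _ => abs_nonneg _⟩

lemma indicator_mem (H : Admissible G μ₀ a₀ b₀ p q γ α lam a b f g) (x : V) :
    Set.indicator {x} (fun _ => (1 : ℝ)) ∈ G.coneW p q a b := by
  have hs : (Function.support (Set.indicator {x} (fun _ : V => (1 : ℝ)))).Finite :=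
    (Set.finite_singleton x).subset Set.support_indicator_subset
  exact ⟨⟨memW_of_finite_support H.a₀_pos H.a₀_le (by linarith [H.one_lt_p]) hs,
    memW_of_finite_support H.b₀_pos H.b₀_le (by linarith [H.one_lt_q]) hs⟩,
    fun y => Set.indicator_nonneg (fun _ _ => zero_le_one) y⟩

lemma integrable_super_mul (H : Admissible G μ₀ a₀ b₀ p q γ α lam a b f g)
    (hv : v ∈ G.coneW p q a b) (hφ : φ ∈ G.spaceW p q a b) :
    G.Integrable fun x => g x * v x ^ α * φ x := by
  refine ((H.integrable_super hv).add (H.integrable_super (H.abs_mem hφ))).of_abs_le fun x => ?_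
  have h1 := rpow_sub_one_mul_le_add (s := α + 1) (by linarith [H.one_lt_p, H.p_lt]) (hv.2 x)
    (abs_nonneg (φ x))
  rw [add_sub_cancel_right] at h1
  rw [mul_assoc, abs_mul, abs_mul, abs_of_nonneg (H.g_nonneg x),
    abs_of_nonneg (Real.rpow_nonneg (hv.2 x) _), ← mul_add]
  exact mul_le_mul_of_nonneg_left h1 (H.g_nonneg x)

lemma energy_add_sub_le {s : ℝ} {h : V → ℝ} (hs : 1 < s) (hh : ∀ x, 0 ≤ h x)
    (hu0 : ∀ x, 0 ≤ u x) (hψ0 : ∀ x, 0 ≤ ψ x) (hu : G.MemW s h u) (hψ : G.MemW s h ψ)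
    (huψ : G.MemW s h (u + ψ)) :
    (G.energy s h (u + ψ) - G.energy s h u) / s ≤ G.integral (G.form s h (u + ψ) ψ) := by
  have hs0 : 0 < s := by linarith
  rw [div_le_iff₀' hs0, energy, energy,
    ← integral_sub (huψ.integrable_density hh) (hu.integrable_density hh), ← integral_const_mul]
  exact integral_mono ((huψ.integrable_density hh).sub (hu.integrable_density hh))
    ((huψ.integrable_form hs hh (fun x => add_nonneg (hu0 x) (hψ0 x)) hψ).const_mul s)
    (density_add_sub_le hs hh hu0 hψ0)

/-- If the energy does not decrease from `u` to `u + ψ`, convexity and concavity give one half of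
the weak formulation at the pair of points. -/
lemma sing_le_of_ray_le (H : Admissible G μ₀ a₀ b₀ p q γ α lam a b f g)
    (hu : u ∈ G.coneW p q a b) (hψ : ψ ∈ G.coneW p q a b)
    (h : G.ray p q γ α lam a b f g u 1 ≤ G.ray p q γ α lam a b f g (u + ψ) 1) :
    (G.Integrable fun x => f x * (u + ψ) x ^ (-γ) * ψ x) ∧
      (G.integral fun x => f x * (u + ψ) x ^ (-γ) * ψ x) ≤
        G.integral (G.form p a (u + ψ) ψ) + G.integral (G.form q b (u + ψ) ψ)
          - lam * G.integral (fun x => g x * u x ^ α * ψ x) := by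
  have hw := H.add_mem_cone hu hψ
  have hγ : 0 < 1 - γ := by linarith [H.γ_lt]
  have hα : 0 < α + 1 := by linarith [H.one_lt_p, H.p_lt]
  have hα1 : 1 < α + 1 := by linarith [H.one_lt_p, H.p_lt]
  have hlp := energy_add_sub_le H.one_lt_p H.a_nonneg hu.2 hψ.2 hu.1.1 hψ.1.1 hw.1.1
  have hlq := energy_add_sub_le H.one_lt_q H.b_nonneg hu.2 hψ.2 hu.1.2 hψ.1.2 hw.1.2
  have hfp : ∀ x, (1 - γ) * (f x * (u + ψ) x ^ (-γ) * ψ x) ≤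
      f x * (u + ψ) x ^ (1 - γ) - f x * u x ^ (1 - γ) := fun x => by
    have := mul_le_mul_of_nonneg_left
      (rpow_add_mul_le_rpow_of_lt_one H.γ_pos H.γ_lt (hu.2 x) (hψ.2 x)) (H.f_pos x).le
    simp only [Pi.add_apply]
    linarith
  have hfd := (H.integrable_sing hw).sub (H.integrable_sing hu)
  have hf0 : ∀ x, 0 ≤ f x * (u + ψ) x ^ (-γ) * ψ x := fun x =>
    mul_nonneg (mul_nonneg (H.f_pos x).le (Real.rpow_nonneg (hw.2 x) _)) (hψ.2 x)
  have hfi : G.Integrable fun x => f x * (u + ψ) x ^ (-γ) * ψ x :=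
    (hfd.const_mul (1 - γ)⁻¹).of_le hf0 fun x => by
      rw [← div_eq_inv_mul, le_div_iff₀' hγ]
      exact hfp x
  have hF := integral_mono (hfi.const_mul (1 - γ)) hfd hfp
  rw [integral_const_mul, integral_sub (H.integrable_sing hw) (H.integrable_sing hu)] at hF
  have hgd := (H.integrable_super hw).sub (H.integrable_super hu)
  have hgp : ∀ x, (α + 1) * (g x * u x ^ α * ψ x) ≤
      g x * (u + ψ) x ^ (α + 1) - g x * u x ^ (α + 1) := fun x => by
    have := mul_le_mul_of_nonneg_left
      (rpow_add_mul_le_rpow hα1 (hu.2 x) (hψ.2 x)) (H.g_nonneg x)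
    rw [add_sub_cancel_right] at this
    simp only [Pi.add_apply]
    linarith
  have hG := integral_mono ((H.integrable_super_mul hu hψ.1).const_mul (α + 1)) hgd hgp
  rw [integral_const_mul, integral_sub (H.integrable_super hw) (H.integrable_super hu)] at hG
  refine ⟨hfi, ?_⟩
  simp only [ray, rayFn, Real.one_rpow] at h
  change _ ≤ G.powInt f (1 - γ) (u + ψ) - G.powInt f (1 - γ) u at hF
  change _ ≤ G.powInt g (α + 1) (u + ψ) - G.powInt g (α + 1) u at hG
  rw [mul_comm, ← le_div_iff₀ hγ] at hF
  rw [mul_comm, ← le_div_iff₀ hα] at hG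
  have hG' := mul_le_mul_of_nonneg_left hG H.lam_pos.le
  have e1 : lam * ((G.powInt g (α + 1) (u + ψ) - G.powInt g (α + 1) u) / (α + 1)) =
      1 / (α + 1) * (lam * G.powInt g (α + 1) (u + ψ))
        - 1 / (α + 1) * (lam * G.powInt g (α + 1) u) := by ring
  have e2 : (G.powInt f (1 - γ) (u + ψ) - G.powInt f (1 - γ) u) / (1 - γ) =
      1 / (1 - γ) * G.powInt f (1 - γ) (u + ψ) - 1 / (1 - γ) * G.powInt f (1 - γ) u := by ring
  have e3 : (G.energy p a (u + ψ) - G.energy p a u) / p =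
      1 / p * G.energy p a (u + ψ) - 1 / p * G.energy p a u := by ring
  have e4 : (G.energy q b (u + ψ) - G.energy q b u) / q =
      1 / q * G.energy q b (u + ψ) - 1 / q * G.energy q b u := by ring
  rw [e1] at hG'
  rw [e2] at hF
  rw [e3] at hlp
  rw [e4] at hlq
  linarith

lemma sing_line_le (H : Admissible G μ₀ a₀ b₀ p q γ α lam a b f g)
    (hv : v ∈ G.coneW p q a b) (hφ : φ ∈ G.coneW p q a b) {t ε : ℝ} (ht : 0 < t) (hε : 0 < ε)
    (h : G.ray p q γ α lam a b f g (t • v) 1 ≤ G.ray p q γ α lam a b f g (t • (v + ε • φ)) 1) :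
    (G.Integrable fun x => f x * (t • (v + ε • φ)) x ^ (-γ) * φ x) ∧
      (G.integral fun x => f x * (t • (v + ε • φ)) x ^ (-γ) * φ x) ≤
        G.integral (G.form p a (t • (v + ε • φ)) φ) + G.integral (G.form q b (t • (v + ε • φ)) φ)
          - lam * (t ^ α * G.integral (fun x => g x * v x ^ α * φ x)) := by
  have htε : 0 < t * ε := mul_pos ht hε
  have hu := H.smul_mem_cone hv ht.le
  have hψ := H.smul_mem_cone hφ htε.le
  have e : t • (v + ε • φ) = t • v + (t * ε) • φ := by rw [smul_add, smul_smul]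
  rw [e] at h ⊢
  obtain ⟨h1, h2⟩ := H.sing_le_of_ray_le hu hψ h
  have e1 : ∀ x, f x * (t • v + (t * ε) • φ) x ^ (-γ) * ((t * ε) • φ) x =
      (t * ε) * (f x * (t • v + (t * ε) • φ) x ^ (-γ) * φ x) := fun x => by
    simp only [Pi.smul_apply, smul_eq_mul]
    ring
  have e2 : ∀ x, g x * (t • v) x ^ α * ((t * ε) • φ) x =
      (t * ε) * (t ^ α * (g x * v x ^ α * φ x)) := fun x => by
    simp only [Pi.smul_apply, smul_eq_mul]
    rw [Real.mul_rpow ht.le (hv.2 x)]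
    ring
  simp only [e1] at h1 h2
  simp only [e2] at h2
  constructor
  · have := h1.const_mul (t * ε)⁻¹
    simpa only [inv_mul_cancel_left₀ htε.ne'] using this
  · rw [funext (form_smul_right (s := p) (h := a) (t * ε) _ φ),
      funext (form_smul_right (s := q) (h := b) (t * ε) _ φ), integral_const_mul,
      integral_const_mul, integral_const_mul, integral_const_mul, integral_const_mul] at h2
    refine le_of_mul_le_mul_left (h2.trans_eq ?_) htε
    ring

/-- The energy does not decrease to first order from `v` in the directions of the cone, up to
a rescaling. -/
def FirstOrderMin (G : WeightedGraph V) (p q γ α lam : ℝ) (a b f g v : V → ℝ) : Prop :=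
  ∀ φ ∈ G.coneW p q a b, ∃ t ε : ℕ → ℝ, (∀ n, 0 < t n) ∧ (∀ n, 0 < ε n) ∧
    Tendsto t atTop (𝓝 1) ∧ Tendsto ε atTop (𝓝 0) ∧
    ∀ n, G.ray p q γ α lam a b f g (t n • v) 1 ≤
      G.ray p q γ α lam a b f g (t n • (v + ε n • φ)) 1

lemma tendsto_upper (H : Admissible G μ₀ a₀ b₀ p q γ α lam a b f g)
    (hv : v ∈ G.coneW p q a b) (hφ : φ ∈ G.coneW p q a b) {t ε : ℕ → ℝ}
    (hε0 : ∀ n, 0 < ε n) (ht : Tendsto t atTop (𝓝 1)) (hε : Tendsto ε atTop (𝓝 0)) :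
    Tendsto (fun n => G.integral (G.form p a (t n • (v + ε n • φ)) φ) +
      G.integral (G.form q b (t n • (v + ε n • φ)) φ)
      - lam * (t n ^ α * G.integral (fun x => g x * v x ^ α * φ x))) atTop
      (𝓝 (G.integral (G.form p a v φ) + G.integral (G.form q b v φ)
        - lam * G.integral (fun x => g x * v x ^ α * φ x))) := by
  have hε0' : ∀ᶠ n in atTop, 0 ≤ ε n := Eventually.of_forall fun n => (hε0 n).le
  have h3 := (((ht.rpow_const (p := α) (Or.inl one_ne_zero)).mul_const
    (G.integral (fun x => g x * v x ^ α * φ x))).const_mul lam)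
  rw [Real.one_rpow, one_mul] at h3
  exact ((tendsto_form_line H.one_lt_p H.a_nonneg hv.2 hφ.2 hv.1.1 hφ.1.1 ht hε hε0').add
    (tendsto_form_line H.one_lt_q H.b_nonneg hv.2 hφ.2 hv.1.2 hφ.1.2 ht hε hε0')).sub h3

lemma pos_of_firstOrderMin (H : Admissible G μ₀ a₀ b₀ p q γ α lam a b f g)
    (hv : v ∈ G.coneW p q a b) (hm : FirstOrderMin G p q γ α lam a b f g v) (x : V) :
    0 < v x := by
  by_contra hc
  have hvx : v x = 0 := le_antisymm (not_lt.1 hc) (hv.2 x)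
  have hφ := H.indicator_mem x
  set φ : V → ℝ := Set.indicator {x} fun _ => (1 : ℝ) with hφd
  have hφx : φ x = 1 := by simp [hφd]
  obtain ⟨t, ε, ht0, hε0, ht, hε, h⟩ := hm φ hφ
  have hl := H.tendsto_upper hv hφ hε0 ht hε
  have hz : Tendsto (fun n => (t n * ε n) ^ γ) atTop (𝓝 0) := by
    have := (ht.mul hε).rpow_const (p := γ) (Or.inr H.γ_pos.le)
    rwa [mul_zero, Real.zero_rpow H.γ_pos.ne'] at this
  have hlz := hl.mul hz
  rw [mul_zero] at hlz
  have hpos : 0 < G.meas x * f x := mul_pos (G.meas_pos x) (H.f_pos x)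
  refine hpos.not_ge (ge_of_tendsto' hlz fun n => ?_)
  obtain ⟨h1, h2⟩ := H.sing_line_le hv hφ (ht0 n) (hε0 n) (h n)
  have hw := H.smul_mem_cone (H.add_mem_cone hv (H.smul_mem_cone hφ (hε0 n).le)) (ht0 n).le
  have h3 := (meas_mul_le_integral h1 (fun y => mul_nonneg (mul_nonneg (H.f_pos y).le
    (Real.rpow_nonneg (hw.2 y) _)) (hφ.2 y)) x).trans h2
  have hte : 0 < t n * ε n := mul_pos (ht0 n) (hε0 n)
  have e : (t n • (v + ε n • φ)) x = t n * ε n := by simp [hvx, hφx]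
  rw [e, hφx, mul_one] at h3
  refine le_trans (le_of_eq ?_) (mul_le_mul_of_nonneg_right h3 (Real.rpow_nonneg hte.le γ))
  rw [mul_assoc, mul_assoc, ← Real.rpow_add hte, neg_add_cancel, Real.rpow_zero, mul_one]

lemma sing_le_of_firstOrderMin (H : Admissible G μ₀ a₀ b₀ p q γ α lam a b f g)
    (hv : v ∈ G.coneW p q a b) (hm : FirstOrderMin G p q γ α lam a b f g v)
    (hφ : φ ∈ G.coneW p q a b) :
    (G.Integrable fun x => f x * v x ^ (-γ) * φ x) ∧
      0 ≤ G.residual p q γ α lam a b f g v φ := by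
  have hpos := H.pos_of_firstOrderMin hv hm
  obtain ⟨t, ε, ht0, hε0, ht, hε, h⟩ := hm φ hφ
  have hl := H.tendsto_upper hv hφ hε0 ht hε
  have hw : ∀ n, t n • (v + ε n • φ) ∈ G.coneW p q a b := fun n =>
    H.smul_mem_cone (H.add_mem_cone hv (H.smul_mem_cone hφ (hε0 n).le)) (ht0 n).le
  have hF := integral_le_of_tendsto (G := G) (l := atTop)
    (ψ := fun n x => f x * (t n • (v + ε n • φ)) x ^ (-γ) * φ x)
    (ψ' := fun x => f x * v x ^ (-γ) * φ x)
    (fun n x => mul_nonneg (mul_nonneg (H.f_pos x).le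
    (Real.rpow_nonneg ((hw n).2 x) _)) (hφ.2 x))
    (Eventually.of_forall fun n => (H.sing_line_le hv hφ (ht0 n) (hε0 n) (h n)).1)
    (fun x => (((tendsto_line ht hε v φ x).rpow_const (Or.inl (hpos x).ne')).const_mul
      (f x)).mul_const (φ x))
    (Eventually.of_forall fun n => (H.sing_line_le hv hφ (ht0 n) (hε0 n) (h n)).2) hl
  exact ⟨hF.1, sub_nonneg.2 hF.2⟩

section Residual

lemma integrable_sing_mul (H : Admissible G μ₀ a₀ b₀ p q γ α lam a b f g)
    (hv : v ∈ G.coneW p q a b) (hm : FirstOrderMin G p q γ α lam a b f g v)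
    (hφ : φ ∈ G.spaceW p q a b) : G.Integrable fun x => f x * v x ^ (-γ) * φ x := by
  refine (H.sing_le_of_firstOrderMin hv hm (H.abs_mem hφ)).1.of_abs_le fun x => ?_
  rw [abs_mul, abs_of_nonneg (mul_nonneg (H.f_pos x).le (Real.rpow_nonneg (hv.2 x) _))]

lemma residual_add (H : Admissible G μ₀ a₀ b₀ p q γ α lam a b f g)
    (hv : v ∈ G.coneW p q a b) (hm : FirstOrderMin G p q γ α lam a b f g v)
    (hφ : φ ∈ G.spaceW p q a b) (hψ : ψ ∈ G.spaceW p q a b) :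
    G.residual p q γ α lam a b f g v (φ + ψ) =
      G.residual p q γ α lam a b f g v φ + G.residual p q γ α lam a b f g v ψ := by
  simp only [residual, Pi.add_apply, mul_add]
  rw [funext (form_add_right (s := p) (h := a) v φ ψ),
    funext (form_add_right (s := q) (h := b) v φ ψ),
    integral_add (hv.1.1.integrable_form H.one_lt_p H.a_nonneg hv.2 hφ.1)
      (hv.1.1.integrable_form H.one_lt_p H.a_nonneg hv.2 hψ.1),
    integral_add (hv.1.2.integrable_form H.one_lt_q H.b_nonneg hv.2 hφ.2)
      (hv.1.2.integrable_form H.one_lt_q H.b_nonneg hv.2 hψ.2),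
    integral_add (H.integrable_super_mul hv hφ) (H.integrable_super_mul hv hψ),
    integral_add (H.integrable_sing_mul hv hm hφ) (H.integrable_sing_mul hv hm hψ)]
  ring

lemma residual_smul (t : ℝ) (v φ : V → ℝ) :
    G.residual p q γ α lam a b f g v (t • φ) = t * G.residual p q γ α lam a b f g v φ := by
  simp only [residual, Pi.smul_apply, smul_eq_mul, mul_left_comm _ t]
  rw [funext (form_smul_right (s := p) (h := a) t v φ),
    funext (form_smul_right (s := q) (h := b) t v φ), integral_const_mul, integral_const_mul,
    integral_const_mul, integral_const_mul]
  ring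

lemma residual_self (H : Admissible G μ₀ a₀ b₀ p q γ α lam a b f g)
    (hv : v ∈ G.coneW p q a b) (hpos : ∀ x, 0 < v x) :
    G.residual p q γ α lam a b f g v v = G.fib p q γ α lam a b f g v 1 := by
  have e1 : (fun x => g x * v x ^ α * v x) = fun x => g x * v x ^ (α + 1) := funext fun x => by
    rw [mul_assoc, ← Real.rpow_add_one (hpos x).ne']
  have e2 : (fun x => f x * v x ^ (-γ) * v x) = fun x => f x * v x ^ (1 - γ) := funext fun x => by
    rw [mul_assoc, ← Real.rpow_add_one (hpos x).ne', neg_add_eq_sub]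
  rw [residual, e1, e2, funext (form_self H.one_lt_p hv.2), funext (form_self H.one_lt_q hv.2),
    fib, fibFn_one]
  simp only [energy, powInt]
  ring

lemma excess_mem (H : Admissible G μ₀ a₀ b₀ p q γ α lam a b f g)
    (hv : v ∈ G.spaceW p q a b) (hφ : φ ∈ G.spaceW p q a b) (k : ℝ) :
    excess φ v k ∈ G.coneW p q a b := by
  have := H.posPart_mem (H.add_mem hφ (H.smul_mem (-k) hv))
  convert this using 3
  simp [excess, sub_eq_add_neg]

lemma residual_eq_zero_of_mem_cone (H : Admissible G μ₀ a₀ b₀ p q γ α lam a b f g)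
    (hv : v ∈ G.coneW p q a b) (hm : FirstOrderMin G p q γ α lam a b f g v)
    (h0 : G.fib p q γ α lam a b f g v 1 = 0) (hφ : φ ∈ G.coneW p q a b) :
    G.residual p q γ α lam a b f g v φ = 0 := by
  have hpos := H.pos_of_firstOrderMin hv hm
  refine le_antisymm ?_ (H.sing_le_of_firstOrderMin hv hm hφ).2
  have he : ∀ k : ℕ, excess φ v k ∈ G.coneW p q a b := fun k => H.excess_mem hv.1 hφ.1 k
  obtain ⟨c, hc, hcb⟩ := integral_form_excess_le H.one_lt_p H.a_nonneg hpos hφ.2 hv.1.1 hφ.1.1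
    fun k => (he k).1.1
  obtain ⟨d, hd, hdb⟩ := integral_form_excess_le H.one_lt_q H.b_nonneg hpos hφ.2 hv.1.2 hφ.1.2
    fun k => (he k).1.2
  have hcd := hc.add hd
  rw [add_zero] at hcd
  refine ge_of_tendsto' hcd fun k => ?_
  have hmin : φ + (-1 : ℝ) • excess φ v k ∈ G.coneW p q a b := by
    refine ⟨H.add_mem hφ.1 (H.smul_mem _ (he k).1), fun x => ?_⟩
    have := excess_le hv.2 hφ.2 (k.cast_nonneg (α := ℝ)) x
    simp only [Pi.add_apply, Pi.smul_apply, smul_eq_mul]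
    linarith
  have hrest : (k : ℝ) • v + (-1 : ℝ) • (φ + (-1 : ℝ) • excess φ v k) ∈ G.coneW p q a b := by
    refine ⟨H.add_mem (H.smul_mem _ hv.1) (H.smul_mem _ hmin.1), fun x => ?_⟩
    have := excess_ge φ v k x
    simp only [Pi.add_apply, Pi.smul_apply, smul_eq_mul]
    linarith
  have h1 := (H.sing_le_of_firstOrderMin hv hm hrest).2
  rw [H.residual_add hv hm (H.smul_mem _ hv.1) (H.smul_mem _ hmin.1), residual_smul,
    residual_smul, H.residual_self hv hpos, h0,
    H.residual_add hv hm hφ.1 (H.smul_mem _ (he k).1), residual_smul] at h1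
  have h2 : G.residual p q γ α lam a b f g v (excess φ v k) ≤
      G.integral (G.form p a v (excess φ v k)) + G.integral (G.form q b v (excess φ v k)) := by
    have h3 : 0 ≤ lam * G.integral (fun x => g x * v x ^ α * excess φ v k x) :=
      mul_nonneg H.lam_pos.le (integral_nonneg fun x => mul_nonneg (mul_nonneg (H.g_nonneg x)
        (Real.rpow_nonneg (hv.2 x) _)) (excess_nonneg _ _ _ _))
    have h4 : 0 ≤ G.integral (fun x => f x * v x ^ (-γ) * excess φ v k x) :=
      integral_nonneg fun x => mul_nonneg (mul_nonneg (H.f_pos x).le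
        (Real.rpow_nonneg (hv.2 x) _)) (excess_nonneg _ _ _ _)
    rw [residual]
    linarith
  linarith [hcb k, hdb k]

lemma isWeakSolution (H : Admissible G μ₀ a₀ b₀ p q γ α lam a b f g)
    (hv : v ∈ G.coneW p q a b) (hm : FirstOrderMin G p q γ α lam a b f g v)
    (h0 : G.fib p q γ α lam a b f g v 1 = 0) :
    G.IsWeakSolution p q γ α lam a b f g v := by
  refine ⟨hv.1, H.pos_of_firstOrderMin hv hm, fun φ hφ => ?_⟩
  refine ⟨hv.1.1.integrable_form H.one_lt_p H.a_nonneg hv.2 hφ.1,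
    hv.1.2.integrable_form H.one_lt_q H.b_nonneg hv.2 hφ.2, H.integrable_sing_mul hv hm hφ,
    H.integrable_super_mul hv hφ, ?_⟩
  have hneg := H.posPart_mem (H.smul_mem (-1) hφ)
  have hpos := H.posPart_mem hφ
  have e : φ = (fun x => max (φ x) 0) + (-1 : ℝ) • fun x => max (((-1 : ℝ) • φ) x) 0 := by
    funext x
    simp only [Pi.add_apply, Pi.smul_apply, smul_eq_mul]
    rcases le_total 0 (φ x) with h | h
    · rw [max_eq_left h, max_eq_right (by linarith)]; ring
    · rw [max_eq_right h, max_eq_left (by linarith)]; ring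
  have hr : G.residual p q γ α lam a b f g v φ = 0 := by
    rw [e, H.residual_add hv hm hpos.1 (H.smul_mem _ hneg.1), residual_smul,
      H.residual_eq_zero_of_mem_cone hv hm h0 hpos, H.residual_eq_zero_of_mem_cone hv hm h0 hneg]
    ring
  rw [residual] at hr
  change G.integral (G.form p a v φ) + G.integral (G.form q b v φ) = _
  linarith

end Residual

end Admissible

end WeightedGraph

lemma exists_rpow_le_mul_add {θ δ : ℝ} (hθ0 : 0 < θ) (hθ1 : θ < 1) (hδ : 0 < δ) :
    ∃ K : ℝ, ∀ x : ℝ, 0 ≤ x → x ^ θ ≤ δ * x + K := by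
  have h1 : 0 < 1 - θ := by linarith
  set y : ℝ := (1 / δ) ^ (1 / (1 - θ)) with hy
  have hy0 : 0 < y := by positivity
  have hyδ : y ^ (1 - θ) = 1 / δ := by
    rw [hy, ← Real.rpow_mul (by positivity), one_div_mul_cancel h1.ne', Real.rpow_one]
  refine ⟨y ^ θ, fun x hx => ?_⟩
  rcases le_total x y with h | h
  · have := Real.rpow_le_rpow hx h hθ0.le
    nlinarith
  · have hx0 : 0 < x := hy0.trans_le h
    have h2 := Real.rpow_le_rpow hy0.le h h1.le
    rw [hyδ, div_le_iff₀ hδ] at h2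
    have h3 : x ^ θ * x ^ (1 - θ) = x := by
      rw [← Real.rpow_add hx0, add_sub_cancel, Real.rpow_one]
    have h4 := mul_le_mul_of_nonneg_left h2 (Real.rpow_nonneg hx θ)
    have h5 := Real.rpow_nonneg hy0.le θ
    nlinarith

namespace WeightedGraph

open Filter Topology

lemma powInt_le {V : Type*} {G : WeightedGraph V} {κ w : V → ℝ} {r R : ℝ}
    (hκ : ∀ x, 0 ≤ κ x) (hi : G.Integrable κ) (hr : 0 ≤ r)
    (hw : ∀ x, 0 ≤ w x) (hR : ∀ x, w x ≤ R) : G.powInt κ r w ≤ R ^ r * G.integral κ := by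
  rw [← integral_const_mul]
  refine integral_mono (integrable_mul_rpow hκ hi hr hw hR) (hi.const_mul _) fun x => ?_
  rw [mul_comm]
  exact mul_le_mul_of_nonneg_right (Real.rpow_le_rpow (hw x) (hR x) hr) (hκ x)

namespace Admissible

variable {V : Type*} {G : WeightedGraph V} {μ₀ a₀ b₀ p q γ α lam : ℝ} {a b f g : V → ℝ}
  {u v w φ : V → ℝ}

lemma countable (H : Admissible G μ₀ a₀ b₀ p q γ α lam a b f g) : Countable V := by
  have h : Summable fun x => G.meas x * f x := H.f_int
  have hc := h.countable_support
  have e : (Function.support fun x => G.meas x * f x) = Set.univ := by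
    ext x
    simp [(G.meas_pos x).ne', (H.f_pos x).ne']
  rwa [e, Set.countable_univ_iff] at hc

/-- A bounded sequence in the cone has a subsequence along which everything converges. -/
lemma exists_subseq (H : Admissible G μ₀ a₀ b₀ p q γ α lam a b f g) {w : ℕ → V → ℝ} {M M' : ℝ}
    (hw : ∀ n, w n ∈ G.coneW p q a b) (hM : ∀ n, G.energy p a (w n) ≤ M)
    (hM' : ∀ n, G.energy q b (w n) ≤ M') :
    ∃ (u : V → ℝ) (θ : ℕ → ℕ) (P Q : ℝ), u ∈ G.coneW p q a b ∧ StrictMono θ ∧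
      G.energy p a u ≤ P ∧ G.energy q b u ≤ Q ∧
      Tendsto (fun n => G.energy p a (w (θ n))) atTop (𝓝 P) ∧
      Tendsto (fun n => G.energy q b (w (θ n))) atTop (𝓝 Q) ∧
      Tendsto (fun n => G.powInt f (1 - γ) (w (θ n))) atTop (𝓝 (G.powInt f (1 - γ) u)) ∧
      Tendsto (fun n => G.powInt g (α + 1) (w (θ n))) atTop (𝓝 (G.powInt g (α + 1) u)) := by
  have := H.countable
  set R := (M / (μ₀ * a₀)) ^ (1 / p)
  have hR : ∀ n x, w n x ≤ R := fun n => H.le_of_energy_le (hw n) (hM n)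
  have hK : IsCompact (Set.Icc 0 M ×ˢ Set.Icc 0 M' ×ˢ Set.pi Set.univ fun _ : V => Set.Icc 0 R) :=
    isCompact_Icc.prod (isCompact_Icc.prod (isCompact_univ_pi fun _ => isCompact_Icc))
  obtain ⟨⟨P, Q, u⟩, -, θ, hθ, hl⟩ := hK.tendsto_subseq
    (x := fun n => (G.energy p a (w n), G.energy q b (w n), w n))
    fun n => ⟨⟨energy_nonneg H.a_nonneg _, hM n⟩, ⟨energy_nonneg H.b_nonneg _, hM' n⟩,
      fun x _ => ⟨(hw n).2 x, hR n x⟩⟩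
  have hP := (continuous_fst.tendsto _).comp hl
  have hQ := (continuous_fst.tendsto _).comp ((continuous_snd.tendsto _).comp hl)
  have hu := tendsto_pi_nhds.1 ((continuous_snd.tendsto _).comp ((continuous_snd.tendsto _).comp hl))
  obtain ⟨hup, huP⟩ := memW_of_tendsto H.a₀_pos H.a₀_le (by linarith [H.one_lt_p])
    (fun n => (hw (θ n)).1.1) hu hP
  obtain ⟨huq, huQ⟩ := memW_of_tendsto H.b₀_pos H.b₀_le (by linarith [H.one_lt_q])
    (fun n => (hw (θ n)).1.2) hu hQ
  have h0 : ∀ᶠ n in atTop, ∀ x, 0 ≤ w (θ n) x := Eventually.of_forall fun n => (hw (θ n)).2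
  have h1 : ∀ᶠ n in atTop, ∀ x, w (θ n) x ≤ R := Eventually.of_forall fun n => hR (θ n)
  exact ⟨u, θ, P, Q, ⟨⟨hup, huq⟩, fun x => ge_of_tendsto' (hu x) fun n => (hw (θ n)).2 x⟩, hθ,
    huP, huQ, hP, hQ,
    tendsto_powInt (fun x => (H.f_pos x).le) H.f_int (by linarith [H.γ_lt]) h0 h1 hu,
    tendsto_powInt H.g_nonneg H.g_int (by linarith [H.one_lt_p, H.p_lt]) h0 h1 hu⟩

lemma ray_one (w : V → ℝ) : G.ray p q γ α lam a b f g w 1 =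
    1 / p * G.energy p a w + 1 / q * G.energy q b w - 1 / (1 - γ) * G.powInt f (1 - γ) w
      - 1 / (α + 1) * (lam * G.powInt g (α + 1) w) := by
  simp only [ray, rayFn, Real.one_rpow]

lemma hasDerivAt_ray (H : Admissible G μ₀ a₀ b₀ p q γ α lam a b f g) (w : V → ℝ) :
    HasDerivAt (G.ray p q γ α lam a b f g w) (G.fib p q γ α lam a b f g w 1) 1 := by
  have := hasDerivAt_rayFn (P := G.energy p a w) (Q := G.energy q b w)
    (F := G.powInt f (1 - γ) w) (Z := lam * G.powInt g (α + 1) w) H.γ_lt H.one_lt_q H.q_le H.p_lt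
    one_pos
  rwa [Real.one_rpow, one_mul] at this

/-- `u` minimizes the energy functional on a ball of `W^{1,p}_a` in the cone. -/
def IsBallMin (G : WeightedGraph V) (p q γ α lam : ℝ) (a b f g : V → ℝ) (M : ℝ) (u : V → ℝ) :
    Prop :=
  u ∈ G.coneW p q a b ∧ G.energy p a u ≤ M ∧ ∀ w ∈ G.coneW p q a b, G.energy p a w ≤ M →
    G.ray p q γ α lam a b f g u 1 ≤ G.ray p q γ α lam a b f g w 1

lemma exists_isBallMin (H : Admissible G μ₀ a₀ b₀ p q γ α lam a b f g) {M : ℝ} (hM : 0 ≤ M) :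
    ∃ u, IsBallMin G p q γ α lam a b f g M u := by
  have hq : 0 < q := by linarith [H.one_lt_q]
  have hp : 0 < p := by linarith [H.one_lt_p]
  have hγ : 0 < 1 - γ := by linarith [H.γ_lt]
  have hα : 0 < α + 1 := by linarith [H.p_lt]
  set S : Set (V → ℝ) := {w | w ∈ G.coneW p q a b ∧ G.energy p a w ≤ M}
  set J : (V → ℝ) → ℝ := fun w => G.ray p q γ α lam a b f g w 1
  set R := (M / (μ₀ * a₀)) ^ (1 / p)
  obtain ⟨K, hK⟩ : ∃ K, ∀ w ∈ S, 1 / q * G.energy q b w ≤ J w + K := by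
    refine ⟨1 / (1 - γ) * (R ^ (1 - γ) * G.integral f)
      + 1 / (α + 1) * (lam * (R ^ (α + 1) * G.integral g)), fun w hw => ?_⟩
    have hR := H.le_of_energy_le hw.1 hw.2
    have h1 := mul_le_mul_of_nonneg_left (powInt_le (r := 1 - γ) (fun x => (H.f_pos x).le) H.f_int
      hγ.le hw.1.2 hR) (by positivity : 0 ≤ 1 / (1 - γ))
    have h2 := mul_le_mul_of_nonneg_left (mul_le_mul_of_nonneg_left
      (powInt_le (r := α + 1) H.g_nonneg H.g_int hα.le hw.1.2 hR) H.lam_pos.le)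
      (by positivity : 0 ≤ 1 / (α + 1))
    have h3 : 0 ≤ 1 / p * G.energy p a w :=
      mul_nonneg (by positivity) (energy_nonneg H.a_nonneg w)
    simp only [J, ray_one]
    linarith
  have hne : S.Nonempty := by
    obtain ⟨x, -⟩ := H.g_ne
    refine ⟨(0 : ℝ) • Set.indicator {x} (fun _ => (1 : ℝ)),
      H.smul_mem_cone (H.indicator_mem x) le_rfl, ?_⟩
    rwa [energy_smul, abs_zero, Real.zero_rpow hp.ne', zero_mul]
  have hbdd : BddBelow (J '' S) := by
    refine ⟨-K, ?_⟩
    rintro _ ⟨w, hw, rfl⟩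
    have : 0 ≤ 1 / q * G.energy q b w :=
      mul_nonneg (by positivity) (energy_nonneg H.b_nonneg w)
    linarith [hK w hw]
  obtain ⟨y, -, hy, hyS⟩ := exists_seq_tendsto_sInf (hne.image J) hbdd
  choose w hwS hwy using hyS
  have hJ : Tendsto (fun n => J (w n)) atTop (𝓝 (sInf (J '' S))) := by simpa only [hwy] using hy
  obtain ⟨B, hB⟩ := hJ.bddAbove_range
  have hQ : ∀ n, G.energy q b (w n) ≤ q * (B + K) := fun n => by
    have h1 := hK _ (hwS n)
    have h2 : J (w n) ≤ B := hB ⟨n, rfl⟩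
    rw [one_div, inv_mul_le_iff₀ hq] at h1
    exact h1.trans (mul_le_mul_of_nonneg_left (by linarith) hq.le)
  obtain ⟨u, θ, P, Q, hu, hθ, hP, hQ', hlP, hlQ, hlF, hlG⟩ :=
    H.exists_subseq (fun n => (hwS n).1) (fun n => (hwS n).2) hQ
  refine ⟨u, hu, hP.trans (le_of_tendsto' hlP fun n => (hwS (θ n)).2), fun w' hw' hM' => ?_⟩
  refine le_trans ?_ (csInf_le hbdd ⟨w', ⟨hw', hM'⟩, rfl⟩)
  have hl := (((hlP.const_mul (1 / p)).add (hlQ.const_mul (1 / q))).sub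
    (hlF.const_mul (1 / (1 - γ)))).sub ((hlG.const_mul lam).const_mul (1 / (α + 1)))
  have hl2 : Tendsto (fun n => J (w (θ n))) atTop (𝓝 (sInf (J '' S))) := hJ.comp hθ.tendsto_atTop
  rw [tendsto_nhds_unique hl2 (hl.congr fun n => (ray_one (w (θ n))).symm), ray_one]
  have h1 := mul_le_mul_of_nonneg_left hP (by positivity : 0 ≤ 1 / p)
  have h2 := mul_le_mul_of_nonneg_left hQ' (by positivity : 0 ≤ 1 / q)
  linarith

lemma energy_le_iff (H : Admissible G μ₀ a₀ b₀ p q γ α lam a b f g) {r : ℝ} (hr : 0 ≤ r)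
    (w : V → ℝ) : G.energy p a w ≤ r ^ p ↔ G.normW p a w ≤ r := by
  have hp : 0 < p := by linarith [H.one_lt_p]
  rw [← normW_rpow hp.ne' H.a_nonneg, Real.rpow_le_rpow_iff (normW_nonneg H.a_nonneg w) hr hp]

lemma lt_energy_iff (H : Admissible G μ₀ a₀ b₀ p q γ α lam a b f g) {r : ℝ} (hr : 0 ≤ r)
    (w : V → ℝ) : r ^ p < G.energy p a w ↔ r < G.normW p a w := by
  rw [← not_le, H.energy_le_iff hr, not_le]

lemma exists_ray_neg (H : Admissible G μ₀ a₀ b₀ p q γ α lam a b f g) {M : ℝ} (hM : 0 < M) :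
    ∃ w ∈ G.coneW p q a b, G.energy p a w ≤ M ∧ G.ray p q γ α lam a b f g w 1 < 0 := by
  have hp : 0 < p := by linarith [H.one_lt_p]
  have hk := H.slope_pos
  have hk' : 0 < q - 1 + γ := by linarith [H.one_lt_q, H.γ_pos]
  have hα : 0 < α + 1 := by linarith [H.p_lt]
  have hγ : 0 < 1 - γ := by linarith [H.γ_lt]
  obtain ⟨x, -⟩ := H.g_ne
  have hw := H.indicator_mem x
  set w : V → ℝ := Set.indicator {x} fun _ => (1 : ℝ) with hwd
  have hF : 0 < G.powInt f (1 - γ) w := H.sing_pos hw (x := x) (by simp [hwd])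
  have hlim : ∀ r c : ℝ, 0 < r → Tendsto (fun t : ℝ => t ^ r * c) (𝓝[>] 0) (𝓝 0) := fun r c hr => by
    have h0 : Tendsto (fun t : ℝ => t) (𝓝[>] 0) (𝓝 0) := tendsto_nhdsWithin_of_tendsto_nhds tendsto_id
    have := (h0.rpow_const (p := r) (Or.inr hr.le)).mul_const c
    rwa [Real.zero_rpow hr.ne', zero_mul] at this
  have h1 := (hlim (p - 1 + γ) (1 / p * G.energy p a w) hk).add
    (hlim (q - 1 + γ) (1 / q * G.energy q b w) hk')
  rw [add_zero] at h1
  have hF' : 0 < 1 / (1 - γ) * G.powInt f (1 - γ) w := by positivity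
  obtain ⟨t, ⟨h2, h3⟩, ht⟩ := ((h1.eventually_lt_const hF').and
    ((hlim p (G.energy p a w) hp).eventually_le_const hM)).and self_mem_nhdsWithin |>.exists
  replace ht : 0 < t := ht
  refine ⟨t • w, H.smul_mem_cone hw ht.le, by rwa [energy_smul, abs_of_pos ht], ?_⟩
  have e : ∀ r s : ℝ, t ^ (1 - γ) * (t ^ r * s) = t ^ (1 - γ + r) * s := fun r s => by
    rw [← mul_assoc, ← Real.rpow_add ht]
  have h4 := mul_lt_mul_of_pos_left h2 (Real.rpow_pos_of_pos ht (1 - γ))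
  rw [mul_add, e, e, show 1 - γ + (p - 1 + γ) = p by ring,
    show 1 - γ + (q - 1 + γ) = q by ring] at h4
  have h5 : 0 ≤ 1 / (α + 1) * (lam * (t ^ (α + 1) * G.powInt g (α + 1) w)) :=
    mul_nonneg (by positivity) (mul_nonneg H.lam_pos.le (mul_nonneg (by positivity)
      (powInt_nonneg H.g_nonneg hw.2)))
  rw [ray_one, energy_smul, energy_smul, powInt_smul ht.le hw.2, powInt_smul ht.le hw.2,
    abs_of_pos ht]
  linarith

lemma IsBallMin.spec (H : Admissible G μ₀ a₀ b₀ p q γ α lam a b f g)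
    (hu : IsBallMin G p q γ α lam a b f g
      (boundX₀ p γ α a₀ (G.normL (p / (p - 1 + γ)) f) ^ p) u) :
    (∃ x, u x ≠ 0) ∧ G.fib p q γ α lam a b f g u 1 = 0 ∧
      G.normW p a u < boundX₀ p γ α a₀ (G.normL (p / (p - 1 + γ)) f) := by
  obtain ⟨hc, hM, hmin⟩ := hu
  set X₀ := boundX₀ p γ α a₀ (G.normL (p / (p - 1 + γ)) f) with hX₀
  have hX : 0 < X₀ := H.X₀_pos
  have hp : 0 < p := by linarith [H.one_lt_p]
  have hq : 0 < q := by linarith [H.one_lt_q]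
  have hγ : 0 < 1 - γ := by linarith [H.γ_lt]
  have hα : 0 < α + 1 := by linarith [H.p_lt]
  have hne : ∃ x, u x ≠ 0 := by
    by_contra! hz
    obtain ⟨w, hw, hwM, hneg⟩ := H.exists_ray_neg (Real.rpow_pos_of_pos hX p)
    have e : u = (0 : ℝ) • u := by funext x; simp [hz x]
    have h1 := hmin w hw hwM
    rw [e, ray_smul hc le_rfl, ray, rayFn, Real.zero_rpow hp.ne', Real.zero_rpow hq.ne',
      Real.zero_rpow hγ.ne', Real.zero_rpow hα.ne'] at h1
    simp only [zero_div, zero_mul, add_zero, sub_zero] at h1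
    linarith
  have hmin' : ∀ t : ℝ, 0 ≤ t → t * G.normW p a u ≤ X₀ →
      G.ray p q γ α lam a b f g u 1 ≤ G.ray p q γ α lam a b f g u t := fun t ht htX => by
    rw [← ray_smul hc ht]
    refine hmin _ (H.smul_mem_cone hc ht) ?_
    rwa [H.energy_le_iff hX.le, normW_smul hp H.a_nonneg, abs_of_nonneg ht]
  have hA := (H.energy_le_iff hX.le u).1 hM
  have hA0 := normW_nonneg (s := p) (G := G) H.a_nonneg u
  have hd := H.hasDerivAt_ray u
  have hlt : G.normW p a u < X₀ := by
    refine lt_of_le_of_ne hA fun he => ?_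
    have hpos := H.fib_one_pos hc he.ge (he.le.trans H.X₀_lt_X.le)
    have hsl := (hasDerivAt_iff_tendsto_slope.1 hd).mono_left
      (nhdsWithin_mono _ fun x (hx : x < 1) => hx.ne : 𝓝[<] (1 : ℝ) ≤ 𝓝[≠] 1)
    refine hpos.not_ge (le_of_tendsto hsl ?_)
    have h01 : ∀ᶠ t : ℝ in 𝓝[<] 1, 0 ≤ t :=
      tendsto_nhdsWithin_of_tendsto_nhds tendsto_id |>.eventually_const_le zero_lt_one
    filter_upwards [h01, self_mem_nhdsWithin] with t ht ht1
    replace ht1 : t < 1 := ht1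
    rw [slope_def_field]
    refine div_nonpos_of_nonneg_of_nonpos (sub_nonneg.2 (hmin' t ht ?_)) (by linarith)
    exact (mul_le_of_le_one_left hA0 ht1.le).trans hA
  refine ⟨hne, ?_, hlt⟩
  refine IsLocalMin.hasDerivAt_eq_zero (f := G.ray p q γ α lam a b f g u) (a := 1) ?_ hd
  have hl : Tendsto (fun t : ℝ => t * G.normW p a u) (𝓝 1) (𝓝 (1 * G.normW p a u)) :=
    tendsto_id.mul_const _
  rw [one_mul] at hl
  have h01 : ∀ᶠ t : ℝ in 𝓝 1, 0 ≤ t := eventually_ge_nhds zero_lt_one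
  filter_upwards [h01, hl.eventually_le_const hlt] with t ht ht' using hmin' t ht ht'

lemma IsBallMin.firstOrderMin (H : Admissible G μ₀ a₀ b₀ p q γ α lam a b f g) {M : ℝ}
    (hu : IsBallMin G p q γ α lam a b f g M u) (hM : G.energy p a u < M) :
    FirstOrderMin G p q γ α lam a b f g u := by
  intro φ hφ
  have hε : Tendsto (fun n : ℕ => 1 / ((n : ℝ) + 1)) atTop (𝓝 0) :=
    tendsto_one_div_add_atTop_nhds_zero_nat
  have hε0 : ∀ n : ℕ, 0 < 1 / ((n : ℝ) + 1) := fun n => by positivity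
  have hl := tendsto_energy_line H.one_lt_p H.a_nonneg hu.1.1.1 hφ.1.1 hε
    (Eventually.of_forall fun n => (hε0 n).le)
  obtain ⟨N, hN⟩ := eventually_atTop.1 (hl.eventually_le_const hM)
  refine ⟨fun _ => 1, fun n => 1 / (((n + N : ℕ) : ℝ) + 1), fun _ => one_pos,
    fun n => hε0 (n + N), tendsto_const_nhds, hε.comp (tendsto_add_atTop_nat N), fun n => ?_⟩
  simp only [one_smul]
  exact hu.2.2 _ (H.add_mem_cone hu.1 (H.smul_mem_cone hφ (hε0 (n + N)).le)) (hN _ (by omega))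

lemma exists_nehariPlus_solution (H : Admissible G μ₀ a₀ b₀ p q γ α lam a b f g) :
    ∃ u, (∃ x, u x ≠ 0) ∧ u ∈ G.nehariPlus p q γ α lam a b f g ∧
      G.IsWeakSolution p q γ α lam a b f g u := by
  have hX := H.X₀_pos
  obtain ⟨u, hu⟩ := H.exists_isBallMin (Real.rpow_pos_of_pos hX p).le
  obtain ⟨hne, h0, hlt⟩ := IsBallMin.spec H hu
  refine ⟨u, hne, H.mem_nehariPlus hu.1 hne h0 hlt, H.isWeakSolution hu.1 ?_ h0⟩
  refine IsBallMin.firstOrderMin H hu ?_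
  have hp : 0 < p := by linarith [H.one_lt_p]
  rw [← normW_rpow hp.ne' H.a_nonneg]
  exact Real.rpow_lt_rpow (normW_nonneg H.a_nonneg u) hlt hp

lemma exists_fib_neg (H : Admissible G μ₀ a₀ b₀ p q γ α lam a b f g)
    (hw : w ∈ G.coneW p q a b) (hZ : 0 < G.powInt g (α + 1) w) (T : ℝ) :
    ∃ t, T ≤ t ∧ G.fib p q γ α lam a b f g w t < 0 := by
  have hk : 0 < p - 1 + γ := H.slope_pos
  have hk' : 0 < q - 1 + γ := by linarith [H.one_lt_q, H.γ_pos]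
  have hd : 0 < α + 1 - p := H.gap_pos
  have hP := energy_nonneg (G := G) (s := p) H.a_nonneg w
  have hQ := energy_nonneg (G := G) (s := q) H.b_nonneg w
  have hF := powInt_nonneg (G := G) (r := 1 - γ) (fun x => (H.f_pos x).le) hw.2
  have hZ' : 0 < lam * G.powInt g (α + 1) w := mul_pos H.lam_pos hZ
  have h1 := (tendsto_rpow_atTop hd).atTop_mul_const hZ'
  obtain ⟨t, ⟨h2, h3⟩, h4⟩ := (((h1.eventually_gt_atTop
    (G.energy p a w + G.energy q b w)).and (eventually_ge_atTop T)).and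
    (eventually_ge_atTop 1)).exists
  refine ⟨t, h3, ?_⟩
  have ht : 0 < t := by linarith
  have e : t ^ (α + γ) = t ^ (p - 1 + γ) * t ^ (α + 1 - p) := by
    rw [← Real.rpow_add ht]; ring_nf
  have h5 : t ^ (q - 1 + γ) ≤ t ^ (p - 1 + γ) :=
    Real.rpow_le_rpow_of_exponent_le h4 (by linarith [H.q_le])
  have h6 : 0 < t ^ (p - 1 + γ) := by positivity
  have h7 := mul_le_mul_of_nonneg_right h5 hQ
  have h8 := mul_lt_mul_of_pos_left h2 h6
  rw [fib, fibFn, e, mul_assoc (t ^ (p - 1 + γ))]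
  linarith

lemma continuous_fib (H : Admissible G μ₀ a₀ b₀ p q γ α lam a b f g) (w : V → ℝ) :
    Continuous (G.fib p q γ α lam a b f g w) :=
  continuous_fibFn H.γ_pos H.one_lt_q H.q_le H.p_lt

lemma smul_mem_nehariMinus (H : Admissible G μ₀ a₀ b₀ p q γ α lam a b f g)
    (hw : w ∈ G.coneW p q a b) {t : ℝ} (ht : 0 < t) (h0 : G.fib p q γ α lam a b f g w t = 0)
    (h : boundX p γ α μ₀ a₀ (supNorm g) lam < t * G.normW p a w) :
    t • w ∈ G.nehariMinus p q γ α lam a b f g := by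
  refine H.mem_nehariMinus (H.smul_mem_cone hw ht.le) (by rw [fib_smul hw ht, h0, mul_zero]) ?_
  rwa [normW_smul (by linarith [H.one_lt_p]) H.a_nonneg, abs_of_pos ht]

lemma exists_smul_mem_nehariMinus (H : Admissible G μ₀ a₀ b₀ p q γ α lam a b f g)
    (hw : w ∈ G.coneW p q a b) (hZ : 0 < G.powInt g (α + 1) w) :
    ∃ t, 0 < t ∧ t • w ∈ G.nehariMinus p q γ α lam a b f g ∧
      boundX p γ α μ₀ a₀ (supNorm g) lam < t * G.normW p a w := by
  obtain ⟨x, hx⟩ := exists_ne_of_super_pos (by linarith [H.p_lt, H.one_lt_p]) hZ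
  have hA : 0 < G.normW p a w :=
    Real.rpow_pos_of_pos (hw.1.1.energy_pos H.a₀_pos H.a₀_le hx) _
  set X := boundX p γ α μ₀ a₀ (supNorm g) lam with hX
  have hX0 : 0 < X := H.X₀_pos.trans H.X₀_lt_X
  have hr : 0 < X / G.normW p a w := by positivity
  have e : X / G.normW p a w * G.normW p a w = X := div_mul_cancel₀ _ hA.ne'
  have h1 := H.fib_pos hw hr (by rw [e]; exact H.X₀_lt_X.le) e.le
  obtain ⟨T, hT, h2⟩ := H.exists_fib_neg hw hZ (X / G.normW p a w)
  obtain ⟨t, ⟨ht1, ht2⟩, h3⟩ :=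
    intermediate_value_Icc' hT (H.continuous_fib w).continuousOn ⟨h2.le, h1.le⟩
  have ht : X / G.normW p a w < t := lt_of_le_of_ne ht1 fun hc => by
    rw [hc, h3] at h1
    exact h1.false
  have hlt : X < t * G.normW p a w := (div_lt_iff₀ hA).1 ht
  exact ⟨t, hr.trans ht, H.smul_mem_nehariMinus hw (hr.trans ht) h3 hlt, hlt⟩

lemma fib_neg_of_one_lt (H : Admissible G μ₀ a₀ b₀ p q γ α lam a b f g)
    (hw : w ∈ G.nehariMinus p q γ α lam a b f g) {t : ℝ} (ht : 1 < t) :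
    G.fib p q γ α lam a b f g w t < 0 := by
  obtain ⟨hc, h0⟩ := H.mem_nehari_iff.1 hw.1
  have hs := hw.2
  rw [H.nehariSign_eq] at hs
  have h := fibFn_le_tangent (P := G.energy p a w) (F := G.powInt f (1 - γ) w) H.γ_pos H.one_lt_q
    H.q_le H.p_lt (energy_nonneg (G := G) (s := q) H.b_nonneg w) (H.super_nonneg hc)
    (by linarith : 0 < t)
  change _ ≤ G.fib p q γ α lam a b f g w 1 + _ at h
  rw [h0, zero_add] at h
  refine lt_of_le_of_lt h (mul_neg_of_pos_of_neg ?_ (div_neg_of_neg_of_pos hs H.slope_pos))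
  linarith [Real.one_lt_rpow ht H.slope_pos]

lemma fib_pos_of_lt_one (H : Admissible G μ₀ a₀ b₀ p q γ α lam a b f g)
    (hw : w ∈ G.nehariMinus p q γ α lam a b f g) {t : ℝ} (ht0 : 0 < t) (ht : t < 1)
    (hX : boundX p γ α μ₀ a₀ (supNorm g) lam < t * G.normW p a w) :
    0 < G.fib p q γ α lam a b f g w t := by
  obtain ⟨hc, h0⟩ := H.mem_nehari_iff.1 hw.1
  set X := boundX p γ α μ₀ a₀ (supNorm g) lam with hXd
  have hX0 : 0 < X := H.X₀_pos.trans H.X₀_lt_X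
  have hA : 0 < G.normW p a w := pos_of_mul_pos_right (hX0.trans hX) ht0.le
  have hr : 0 < X / G.normW p a w := by positivity
  have e : X / G.normW p a w * G.normW p a w = X := div_mul_cancel₀ _ hA.ne'
  have h1 := H.fib_pos hc hr (by rw [e]; exact H.X₀_lt_X.le) e.le
  have hnn : 0 ≤ G.fib p q γ α lam a b f g w t :=
    fibFn_nonneg_of_mem_Icc H.γ_pos H.one_lt_q H.q_le H.p_lt
      (energy_nonneg (G := G) (s := q) H.b_nonneg w) (H.super_nonneg hc) hr h1.le h0.ge
      ⟨((div_lt_iff₀ hA).2 hX).le, ht.le⟩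
  refine lt_of_le_of_ne hnn fun hz => ?_
  have hm := H.smul_mem_nehariMinus hc ht0 hz.symm hX
  have hneg := H.fib_neg_of_one_lt hm ((one_lt_div ht0).2 ht)
  have e2 := fib_smul (γ := γ) (α := α) (lam := lam) (f := f) (g := g)
    (H.smul_mem_cone hc ht0.le) (one_div_pos.2 ht0)
  rw [smul_smul, one_div_mul_cancel ht0.ne', one_smul, h0] at e2
  have := mul_neg_of_pos_of_neg (Real.rpow_pos_of_pos (one_div_pos.2 ht0) (1 - γ)) hneg
  linarith

/-- The energy functional is coercive on the Nehari manifold. -/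
lemma exists_coercive (H : Admissible G μ₀ a₀ b₀ p q γ α lam a b f g) :
    ∃ c K : ℝ, 0 < c ∧ ∀ w ∈ G.nehari p q γ α lam a b f g,
      c * (G.energy p a w + G.energy q b w) ≤ G.ray p q γ α lam a b f g w 1 + K := by
  have hp : 0 < p := by linarith [H.one_lt_p]
  have hq : 0 < q := by linarith [H.one_lt_q]
  have hα : 0 < α + 1 := by linarith [H.p_lt]
  have hγ : 0 < 1 - γ := by linarith [H.γ_lt]
  set N := G.normL (p / (p - 1 + γ)) f
  have hN : 0 < N := H.normL_pos
  set c := 1 / p - 1 / (α + 1) with hc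
  have hc0 : 0 < c := sub_pos.2 (one_div_lt_one_div_of_lt hp H.p_lt)
  have hcq : c ≤ 1 / q - 1 / (α + 1) :=
    sub_le_sub_right (one_div_le_one_div_of_le hq H.q_le) _
  set m := (1 / (1 - γ) - 1 / (α + 1)) * (N * a₀⁻¹ ^ ((1 - γ) / p)) with hm
  have h1γ : 0 < 1 / (1 - γ) - 1 / (α + 1) :=
    sub_pos.2 (one_div_lt_one_div_of_lt hγ (by linarith [H.γ_pos, H.one_lt_p, H.p_lt]))
  have ha : 0 < a₀⁻¹ := inv_pos.2 H.a₀_pos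
  have hm0 : 0 < m := by positivity
  obtain ⟨K, hK⟩ := exists_rpow_le_mul_add (θ := (1 - γ) / p) (δ := c / 2 / m) (by positivity)
    (by rw [div_lt_one hp]; linarith [H.one_lt_p, H.γ_pos]) (by positivity)
  refine ⟨c / 2, m * K, by positivity, fun w hw => ?_⟩
  obtain ⟨hcn, h0⟩ := H.mem_nehari_iff.1 hw
  rw [fib, fibFn_one] at h0
  have hP := energy_nonneg (G := G) (s := p) H.a_nonneg w
  have hQ := energy_nonneg (G := G) (s := q) H.b_nonneg w
  have hL : (G.integral fun x => w x ^ p) ≤ a₀⁻¹ * G.energy p a w := by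
    rw [← div_eq_inv_mul, le_div_iff₀' H.a₀_pos]
    exact H.a₀_mul_le_energy hcn
  have hF : G.powInt f (1 - γ) w ≤ N * a₀⁻¹ ^ ((1 - γ) / p) * G.energy p a w ^ ((1 - γ) / p) := by
    refine (H.sing_le hcn).trans ?_
    rw [mul_assoc, ← Real.mul_rpow ha.le hP]
    exact mul_le_mul_of_nonneg_left (Real.rpow_le_rpow
      (integral_nonneg fun x => Real.rpow_nonneg (hcn.2 x) _) hL (by positivity)) hN.le
  have h2 := mul_le_mul_of_nonneg_left hF h1γ.le
  have h3 := mul_le_mul_of_nonneg_left (hK _ hP) hm0.le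
  have e3 : m * (c / 2 / m * G.energy p a w + K) = c / 2 * G.energy p a w + m * K := by
    field_simp
  rw [e3] at h3
  have e2 : (1 / (1 - γ) - 1 / (α + 1)) *
      (N * a₀⁻¹ ^ ((1 - γ) / p) * G.energy p a w ^ ((1 - γ) / p)) =
      m * G.energy p a w ^ ((1 - γ) / p) := by rw [hm]; ring
  rw [e2] at h2
  have h4 := mul_le_mul_of_nonneg_right hcq hQ
  have h5 : 0 ≤ c / 2 * G.energy q b w := mul_nonneg (by positivity) hQ
  have hZ : lam * G.powInt g (α + 1) w
      = G.energy p a w + G.energy q b w - G.powInt f (1 - γ) w := by linarith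
  have e6 : G.ray p q γ α lam a b f g w 1 = c * G.energy p a w
      + (1 / q - 1 / (α + 1)) * G.energy q b w
      - (1 / (1 - γ) - 1 / (α + 1)) * G.powInt f (1 - γ) w := by
    rw [ray_one, hZ, hc]; ring
  rw [e6]
  linarith

lemma tendsto_rayFn {l : Filter ℕ} {P Q F Z : ℕ → ℝ} {P' Q' F' Z' : ℝ}
    (hP : Tendsto P l (𝓝 P')) (hQ : Tendsto Q l (𝓝 Q')) (hF : Tendsto F l (𝓝 F'))
    (hZ : Tendsto Z l (𝓝 Z')) (t : ℝ) :
    Tendsto (fun n => rayFn p q γ α (P n) (Q n) (F n) (Z n) t) l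
      (𝓝 (rayFn p q γ α P' Q' F' Z' t)) :=
  (((hP.const_mul _).add (hQ.const_mul _)).sub (hF.const_mul _)).sub (hZ.const_mul _)

lemma exists_isMinOn_nehariMinus (H : Admissible G μ₀ a₀ b₀ p q γ α lam a b f g) :
    ∃ v ∈ G.nehariMinus p q γ α lam a b f g, ∀ w ∈ G.nehariMinus p q γ α lam a b f g,
      G.ray p q γ α lam a b f g v 1 ≤ G.ray p q γ α lam a b f g w 1 := by
  have hp : 0 < p := by linarith [H.one_lt_p]
  have hq : 0 < q := by linarith [H.one_lt_q]
  set D := G.nehariMinus p q γ α lam a b f g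
  set J : (V → ℝ) → ℝ := fun w => G.ray p q γ α lam a b f g w 1
  set X := boundX p γ α μ₀ a₀ (supNorm g) lam with hX
  have hX0 : 0 < X := H.X₀_pos.trans H.X₀_lt_X
  obtain ⟨c, K, hc0, hK⟩ := H.exists_coercive
  have hne : D.Nonempty := by
    obtain ⟨x, hx⟩ := H.g_ne
    have hi := H.indicator_mem x
    obtain ⟨t, -, h, -⟩ := H.exists_smul_mem_nehariMinus hi (integral_pos (H.integrable_super hi)
      (fun y => mul_nonneg (H.g_nonneg y) (Real.rpow_nonneg (hi.2 y) _)) (x := x)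
      (by simpa using lt_of_le_of_ne (H.g_nonneg x) hx.symm))
    exact ⟨_, h⟩
  have hnn : ∀ w, 0 ≤ G.energy p a w ∧ 0 ≤ G.energy q b w := fun w =>
    ⟨energy_nonneg H.a_nonneg w, energy_nonneg H.b_nonneg w⟩
  have hbdd : BddBelow (J '' D) := by
    refine ⟨-K, ?_⟩
    rintro _ ⟨w, hw, rfl⟩
    have := mul_nonneg hc0.le (add_nonneg (hnn w).1 (hnn w).2)
    linarith [hK w hw.1]
  obtain ⟨y, -, hy, hyS⟩ := exists_seq_tendsto_sInf (hne.image J) hbdd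
  choose w hwD hwy using hyS
  have hJ : Tendsto (fun n => J (w n)) atTop (𝓝 (sInf (J '' D))) := by simpa only [hwy] using hy
  obtain ⟨B, hB⟩ := hJ.bddAbove_range
  have hsum : ∀ n, G.energy p a (w n) + G.energy q b (w n) ≤ (B + K) / c := fun n => by
    have h2 : J (w n) ≤ B := hB ⟨n, rfl⟩
    rw [le_div_iff₀' hc0]
    linarith [hK _ (hwD n).1]
  have hwc : ∀ n, w n ∈ G.coneW p q a b := fun n => (H.mem_nehari_iff.1 (hwD n).1).1
  obtain ⟨u, θ, P, Q, hu, hθ, hP, hQ, hlP, hlQ, hlF, hlG⟩ := H.exists_subseq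
    (M := (B + K) / c) (M' := (B + K) / c) hwc (fun n => by linarith [hsum n, (hnn (w n)).2])
    (fun n => by linarith [hsum n, (hnn (w n)).1])
  have hlZ := hlG.const_mul lam
  have hXP : X ^ p ≤ P := ge_of_tendsto' hlP fun n =>
    ((H.lt_energy_iff hX0.le _).2 (H.bounds_of_mem_nehariMinus (hwD (θ n))).1).le
  have hZ : 0 < G.powInt g (α + 1) u := by
    have h1 : (p - 1 + γ) * P + (q - 1 + γ) * Q ≤ (α + γ) * (lam * G.powInt g (α + 1) u) := by
      refine le_of_tendsto_of_tendsto' ((hlP.const_mul _).add (hlQ.const_mul _))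
        (hlZ.const_mul _) fun n => ?_
      have := (hwD (θ n)).2
      rw [H.nehariSign_eq] at this
      linarith
    have h2 : 0 < (p - 1 + γ) * P :=
      mul_pos H.slope_pos ((Real.rpow_pos_of_pos hX0 p).trans_le hXP)
    have h3 : 0 ≤ (q - 1 + γ) * Q :=
      mul_nonneg (by linarith [H.one_lt_q, H.γ_pos]) ((hnn u).2.trans hQ)
    have hα : 0 < α + γ := by linarith [H.slope_pos, H.p_lt]
    exact pos_of_mul_pos_right (pos_of_mul_pos_right (lt_of_lt_of_le (by linarith) h1) hα.le)
      H.lam_pos.le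
  obtain ⟨t, ht, htD, htX⟩ := H.exists_smul_mem_nehariMinus hu hZ
  refine ⟨t • u, htD, fun w' hw' => le_trans ?_ (csInf_le hbdd ⟨w', hw', rfl⟩)⟩
  have hlt := tendsto_rayFn (p := p) (q := q) (γ := γ) (α := α) hlP hlQ hlF hlZ t
  have hmono : G.ray p q γ α lam a b f g u t ≤
      rayFn p q γ α P Q (G.powInt f (1 - γ) u) (lam * G.powInt g (α + 1) u) t := by
    have h1 := mul_le_mul_of_nonneg_left hP (by positivity : 0 ≤ t ^ p / p)
    have h2 := mul_le_mul_of_nonneg_left hQ (by positivity : 0 ≤ t ^ q / q)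
    rw [ray, rayFn, rayFn]
    linarith
  rw [ray_smul hu ht.le]
  refine hmono.trans (le_of_tendsto_of_tendsto hlt (hJ.comp hθ.tendsto_atTop) ?_)
  have hX₀ := H.X₀_pos
  have hA : (boundX₀ p γ α a₀ (G.normL (p / (p - 1 + γ)) f) / t) ^ p < P := by
    refine lt_of_lt_of_le ((H.lt_energy_iff (by positivity) u).2 ?_) hP
    rw [div_lt_iff₀' ht]
    exact H.X₀_lt_X.trans htX
  filter_upwards [hlP.eventually_const_lt hA] with n hn
  refine H.ray_le_of_mem_nehariMinus (hwD (θ n)) ?_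
  rw [H.lt_energy_iff (by positivity), div_lt_iff₀' ht] at hn
  exact hn.le

lemma tendsto_fib_line (H : Admissible G μ₀ a₀ b₀ p q γ α lam a b f g)
    (hv : v ∈ G.coneW p q a b) (hφ : φ ∈ G.coneW p q a b) (t : ℝ) :
    Tendsto (fun ε : ℝ => G.fib p q γ α lam a b f g (v + ε • φ) t) (𝓝[>] 0)
      (𝓝 (G.fib p q γ α lam a b f g v t)) := by
  have hε : Tendsto (fun ε : ℝ => ε) (𝓝[>] 0) (𝓝 0) :=
    tendsto_nhdsWithin_of_tendsto_nhds tendsto_id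
  have hε0 : ∀ᶠ ε : ℝ in 𝓝[>] 0, 0 ≤ ε := by
    filter_upwards [self_mem_nhdsWithin] with ε (h : 0 < ε) using h.le
  have hsum := H.add_mem_cone hv hφ
  have hR := H.le_of_energy_le hsum le_rfl
  have h0 : ∀ᶠ ε : ℝ in 𝓝[>] 0, ∀ x, 0 ≤ (v + ε • φ) x := by
    filter_upwards [hε0] with ε h x using add_nonneg (hv.2 x) (mul_nonneg h (hφ.2 x))
  have h1 : ∀ᶠ ε : ℝ in 𝓝[>] 0, ∀ x, (v + ε • φ) x ≤
      (G.energy p a (v + φ) / (μ₀ * a₀)) ^ (1 / p) := by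
    filter_upwards [hε.eventually_le_const one_pos] with ε h x
    refine le_trans (add_le_add_right ?_ _) (hR x)
    exact mul_le_of_le_one_left (hφ.2 x) h
  have hpt : ∀ x, Tendsto (fun ε : ℝ => (v + ε • φ) x) (𝓝[>] 0) (𝓝 (v x)) := fun x => by
    have := (hε.mul_const (φ x)).const_add (v x)
    simpa using this
  have hP := tendsto_energy_line H.one_lt_p H.a_nonneg hv.1.1 hφ.1.1 hε hε0
  have hQ := tendsto_energy_line H.one_lt_q H.b_nonneg hv.1.2 hφ.1.2 hε hε0
  have hF := tendsto_powInt (r := 1 - γ) (fun x => (H.f_pos x).le) H.f_int (by linarith [H.γ_lt])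
    h0 h1 hpt
  have hG := tendsto_powInt (r := α + 1) H.g_nonneg H.g_int (by linarith [H.one_lt_p, H.p_lt])
    h0 h1 hpt
  exact (((hP.const_mul _).add (hQ.const_mul _)).sub hF).sub ((hG.const_mul lam).const_mul _)

lemma firstOrderMin_of_nehariMinus (H : Admissible G μ₀ a₀ b₀ p q γ α lam a b f g)
    (hv : v ∈ G.nehariMinus p q γ α lam a b f g)
    (hmin : ∀ w ∈ G.nehariMinus p q γ α lam a b f g,
      G.ray p q γ α lam a b f g v 1 ≤ G.ray p q γ α lam a b f g w 1) :
    FirstOrderMin G p q γ α lam a b f g v := by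
  intro φ hφ
  have hp : 0 < p := by linarith [H.one_lt_p]
  obtain ⟨hc, h0⟩ := H.mem_nehari_iff.1 hv.1
  have hXA := (H.bounds_of_mem_nehariMinus hv).1
  set X := boundX p γ α μ₀ a₀ (supNorm g) lam with hX
  have hX0 : 0 < X := H.X₀_pos.trans H.X₀_lt_X
  have hA : 0 < G.normW p a v := hX0.trans hXA
  set ρ := 1 - X / G.normW p a v with hρ
  have hρ0 : 0 < ρ := sub_pos.2 ((div_lt_one hA).2 hXA)
  have hρ1 : ρ < 1 := sub_lt_self _ (by positivity)
  have hδ0 : ∀ n : ℕ, 0 < ρ / (n + 2) := fun n => by positivity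
  have hδρ : ∀ n : ℕ, ρ / (n + 2) < ρ := fun n =>
    div_lt_self hρ0 (by have := n.cast_nonneg (α := ℝ); linarith)
  have hδX : ∀ n : ℕ, X < (1 - ρ / (n + 2)) * G.normW p a v := fun n => by
    have : (1 - ρ) * G.normW p a v = X := by rw [hρ]; field_simp; ring
    nlinarith [hδρ n]
  have key : ∀ n : ℕ, ∃ ε t : ℝ, 0 < ε ∧ ε < 1 / ((n : ℝ) + 1) ∧ 1 - ρ / (n + 2) ≤ t ∧
      t ≤ 1 + ρ / (n + 2) ∧ t • (v + ε • φ) ∈ G.nehariMinus p q γ α lam a b f g := by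
    intro n
    have ht1 : 0 < 1 - ρ / (n + 2) := by linarith [hδρ n]
    have hp1 := H.fib_pos_of_lt_one hv ht1 (by linarith [hδ0 n]) (hδX n)
    have hn2 := H.fib_neg_of_one_lt hv (t := 1 + ρ / (n + 2)) (by linarith [hδ0 n])
    have hε : Tendsto (fun ε : ℝ => ε) (𝓝[>] 0) (𝓝 0) :=
      tendsto_nhdsWithin_of_tendsto_nhds tendsto_id
    have hE := tendsto_energy_line H.one_lt_p H.a_nonneg hc.1.1 hφ.1.1 hε
      (by filter_upwards [self_mem_nhdsWithin] with ε (h : 0 < ε) using h.le)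
    have hXE : (X / (1 - ρ / (n + 2))) ^ p < G.energy p a v := by
      rw [H.lt_energy_iff (by positivity), div_lt_iff₀' ht1]
      exact hδX n
    obtain ⟨ε, ⟨⟨⟨h1, h2⟩, h3⟩, h4⟩, h5⟩ := (((((H.tendsto_fib_line hc hφ _).eventually_const_lt
      hp1).and ((H.tendsto_fib_line hc hφ _).eventually_lt_const hn2)).and
      (hE.eventually_const_lt hXE)).and (hε.eventually_lt_const
      (by positivity : 0 < 1 / ((n : ℝ) + 1)))).and self_mem_nhdsWithin |>.exists
    replace h5 : 0 < ε := h5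
    have hcε := H.add_mem_cone hc (H.smul_mem_cone hφ h5.le)
    rw [H.lt_energy_iff (by positivity), div_lt_iff₀' ht1] at h3
    obtain ⟨t, ⟨ht, ht'⟩, h6⟩ := intermediate_value_Icc'
      (by linarith [hδ0 n] : 1 - ρ / (n + 2) ≤ 1 + ρ / (n + 2))
      (H.continuous_fib (v + ε • φ)).continuousOn ⟨h2.le, h1.le⟩
    exact ⟨ε, t, h5, h4, ht, ht', H.smul_mem_nehariMinus hcε (ht1.trans_le ht) h6
      (h3.trans_le (mul_le_mul_of_nonneg_right ht (normW_nonneg H.a_nonneg _)))⟩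
  choose ε t hε0 hε1 ht1 ht2 hD using key
  have ht0 : ∀ n, 0 < t n := fun n => lt_of_lt_of_le (by linarith [hδρ n]) (ht1 n)
  have hδl : Tendsto (fun n : ℕ => ρ / ((n : ℝ) + 2)) atTop (𝓝 0) :=
    tendsto_const_nhds.div_atTop (tendsto_atTop_add_const_right _ _ tendsto_natCast_atTop_atTop)
  refine ⟨t, ε, ht0, hε0, ?_, ?_, fun n => ?_⟩
  · refine tendsto_of_tendsto_of_tendsto_of_le_of_le ?_ ?_ ht1 ht2
    · simpa using hδl.const_sub 1
    · simpa using hδl.const_add 1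
  · exact squeeze_zero (fun n => (hε0 n).le) (fun n => (hε1 n).le)
      tendsto_one_div_add_atTop_nhds_zero_nat
  · rw [ray_smul hc (ht0 n).le]
    refine (H.ray_le_of_mem_nehariMinus hv ?_).trans (hmin _ (hD n))
    exact H.X₀_lt_X.le.trans ((hδX n).le.trans (mul_le_mul_of_nonneg_right (ht1 n) hA.le))

lemma exists_nehariMinus_solution (H : Admissible G μ₀ a₀ b₀ p q γ α lam a b f g) :
    ∃ v ∈ G.nehariMinus p q γ α lam a b f g, G.IsWeakSolution p q γ α lam a b f g v := by
  obtain ⟨v, hv, hmin⟩ := H.exists_isMinOn_nehariMinus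
  obtain ⟨hc, h0⟩ := H.mem_nehari_iff.1 hv.1
  exact ⟨v, hv, H.isWeakSolution hc (H.firstOrderMin_of_nehariMinus hv hmin) h0⟩

end Admissible

end WeightedGraph

section Blowup

open Filter Topology

/-- `X₀` tends to infinity as `p → α + 1`, if the norms of `f` stay away from zero. -/
lemma exists_lt_boundX₀ {γ q α a₀ y m : ℝ} (hγ0 : 0 < γ) (hγ1 : γ < 1) (hq : 1 < q)
    (ha : 0 < a₀) (hy : 0 < y) (hm : 0 < m) (M : ℝ) :
    ∃ δ : ℝ, 0 < δ ∧ ∀ p : ℝ, q ≤ p → p < α + 1 → α + 1 - δ < p → ∀ N : ℝ,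
      y * m ^ (1 / (p / (p - 1 + γ))) ≤ N → M < boundX₀ p γ α a₀ N := by
  rcases lt_or_ge (α + 1) q with hqα | hqα
  · exact ⟨1, one_pos, fun p h1 h2 => by linarith⟩
  have hα : 0 < α + γ := by linarith
  have hlim : Tendsto (fun p : ℝ => Real.log (α + γ) - Real.log (α + 1 - p)) (𝓝[<] (α + 1))
      atTop := by
    have h1 : Tendsto (fun p : ℝ => α + 1 - p) (𝓝[<] (α + 1)) (𝓝[>] 0) := by
      refine tendsto_nhdsWithin_iff.2 ⟨?_, ?_⟩
      · have : Tendsto (fun p : ℝ => α + 1 - p) (𝓝 (α + 1)) (𝓝 (α + 1 - (α + 1))) :=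
          tendsto_const_nhds.sub tendsto_id
        rw [sub_self] at this
        exact tendsto_nhdsWithin_of_tendsto_nhds this
      · filter_upwards [self_mem_nhdsWithin] with p (hp : p < α + 1)
        exact sub_pos.2 hp
    exact (tendsto_atTop_add_const_left _ (Real.log (α + γ)) (tendsto_neg_atBot_atTop.comp
      (Real.tendsto_log_nhdsGT_zero.comp h1))).congr fun p => (sub_eq_add_neg _ _).symm
  set B : ℝ := (α + γ) * |Real.log (|M| + 1)| + |Real.log a₀| + |Real.log y| + |Real.log m|
  obtain ⟨l, hl, hlB⟩ := (mem_nhdsLT_iff_exists_Ioo_subset).1 (hlim.eventually_gt_atTop B)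
  replace hl : l < α + 1 := hl
  refine ⟨α + 1 - l, by linarith, fun p hqp hpα hpl N hN => ?_⟩
  have hB : B < Real.log (α + γ) - Real.log (α + 1 - p) := hlB ⟨by linarith, hpα⟩
  have hp : 0 < p := by linarith
  have hk : 0 < p - 1 + γ := by linarith
  have hd : 0 < α + 1 - p := by linarith
  have hN0 : 0 < N := lt_of_lt_of_le (by positivity) hN
  have hM : 0 < |M| + 1 := by positivity
  have hM1 : M < |M| + 1 := by linarith [le_abs_self M]
  refine hM1.trans ((Real.log_lt_log_iff hM (boundX₀_pos hk hd ha hN0)).1 ?_)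
  have hlogN := Real.log_le_log (by positivity) hN
  rw [Real.log_mul hy.ne' (by positivity), Real.log_rpow hm, one_div_div] at hlogN
  rw [log_boundX₀ hk hd ha hN0]
  have e : 1 / (p - 1 + γ) * (Real.log (α + γ) - Real.log (α + 1 - p))
      + -((1 - γ) / (p * (p - 1 + γ))) * Real.log a₀ + 1 / (p - 1 + γ) * Real.log N =
      ((Real.log (α + γ) - Real.log (α + 1 - p)) - (1 - γ) / p * Real.log a₀ + Real.log N)
        / (p - 1 + γ) := by
    field_simp
    ring
  rw [e, lt_div_iff₀ hk]
  have hb : ∀ c x : ℝ, 0 ≤ c → c ≤ 1 → |c * x| ≤ |x| := fun c x h0 h1 => by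
    rw [abs_mul, abs_of_nonneg h0]
    exact mul_le_of_le_one_left (abs_nonneg x) h1
  have b1 := (abs_le.1 (hb ((1 - γ) / p) (Real.log a₀) (div_nonneg (by linarith) hp.le)
    (by rw [div_le_one hp]; linarith))).2
  have b2 := (abs_le.1 (hb ((p - 1 + γ) / p) (Real.log m) (by positivity)
    (by rw [div_le_one hp]; linarith))).1
  have b3 : Real.log (|M| + 1) * (p - 1 + γ) ≤ (α + γ) * |Real.log (|M| + 1)| := by
    have h1 := le_abs_self (Real.log (|M| + 1))
    have h2 := abs_nonneg (Real.log (|M| + 1))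
    nlinarith
  have b4 := neg_abs_le (Real.log y)
  linarith

end Blowup

namespace WeightedGraph

lemma mul_rpow_le_normL {V : Type*} (G : WeightedGraph V) {r : ℝ} {f : V → ℝ} (hr : 0 < r)
    (hf : G.MemL r f) (h0 : ∀ x, 0 ≤ f x) (x : V) :
    f x * G.meas x ^ (1 / r) ≤ G.normL r f := by
  have h := meas_mul_le_integral hf (fun y => Real.rpow_nonneg (abs_nonneg _) _) x
  have h1 := Real.rpow_le_rpow (mul_nonneg (G.meas_pos x).le (Real.rpow_nonneg (abs_nonneg _) _))
    h (by positivity : 0 ≤ 1 / r)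
  rw [Real.mul_rpow (G.meas_pos x).le (Real.rpow_nonneg (abs_nonneg _) _),
    ← Real.rpow_mul (abs_nonneg _), mul_one_div_cancel hr.ne', Real.rpow_one,
    abs_of_nonneg (h0 x), mul_comm] at h1
  exact h1

end WeightedGraph

theorem theorem1p1 {V : Type*} (G : WeightedGraph V) (hconn : G.graph.Connected)
    (μ₀ : ℝ) (hμ₀ : 0 < μ₀) (hμ : ∀ x, μ₀ ≤ G.meas x)
    (C : ℝ) (hC : ∀ x, G.weightSum x < C)
    (γ q α : ℝ) (hγ0 : 0 < γ) (hγ1 : γ < 1) (hq : 1 < q)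
    (a b f g : V → ℝ)
    (a₀ b₀ : ℝ) (ha₀ : 0 < a₀) (hb₀ : 0 < b₀) (ha : ∀ x, a₀ ≤ a x) (hb : ∀ x, b₀ ≤ b x)
    (hf : ∀ x, 0 < f x) (hf1 : G.MemL 1 f) (hfq : G.MemL (q / (q - 1 + γ)) f)
    (hg : ∀ x, 0 ≤ g x) (hg0 : ∃ x, g x ≠ 0) (hg1 : G.MemL 1 g) (hginf : MemLinfty g) :
    -- existence of two solutions, and the bounds that separate them
    (∀ p : ℝ, q ≤ p → p < α + 1 → G.MemL (p / (p - 1 + γ)) f →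
      ∀ lam : ℝ, 0 < lam →
        lam < lamStar p γ α μ₀ a₀ (G.normL (p / (p - 1 + γ)) f) (supNorm g) →
        ∃ u v : V → ℝ, u ≠ v ∧
          G.IsWeakSolution p q γ α lam a b f g u ∧
          G.IsWeakSolution p q γ α lam a b f g v ∧
          u ∈ G.nehariPlus p q γ α lam a b f g ∧
          v ∈ G.nehariMinus p q γ α lam a b f g ∧
          boundX p γ α μ₀ a₀ (supNorm g) lam < G.normW p a v ∧
          boundX₀ p γ α a₀ (G.normL (p / (p - 1 + γ)) f)
            < boundX p γ α μ₀ a₀ (supNorm g) lam ∧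
          G.normW p a u < boundX₀ p γ α a₀ (G.normL (p / (p - 1 + γ)) f) ∧
          boundS p γ α μ₀ a₀ (supNorm g) lam < G.normL (α + 1) v ∧
          boundS₀ p γ α μ₀ a₀ (G.normL (p / (p - 1 + γ)) f)
            < boundS p γ α μ₀ a₀ (supNorm g) lam ∧
          G.normL (α + 1) u < boundS₀ p γ α μ₀ a₀ (G.normL (p / (p - 1 + γ)) f) ∧
          G.normW p a v < G.normWW p q a b v) ∧
    -- blow-up as `p → α + 1`, uniformly in the admissible `lam`, of every element of `D⁻`
    -- (in particular of the solution `v` above)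
    (∀ M : ℝ, ∃ δ : ℝ, 0 < δ ∧
      ∀ p : ℝ, q ≤ p → p < α + 1 → α + 1 - δ < p → G.MemL (p / (p - 1 + γ)) f →
        ∀ lam : ℝ, 0 < lam →
          lam < lamStar p γ α μ₀ a₀ (G.normL (p / (p - 1 + γ)) f) (supNorm g) →
          M < boundX p γ α μ₀ a₀ (supNorm g) lam ∧
          ∀ v ∈ G.nehariMinus p q γ α lam a b f g,
            boundX p γ α μ₀ a₀ (supNorm g) lam < G.normW p a v ∧
            G.normW p a v < G.normWW p q a b v) := by
  have hq0 : 0 < q - 1 + γ := by linarith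
  have hf1' : G.Integrable f := by
    have : G.Integrable fun x => |f x| ^ (1 : ℝ) := hf1
    simpa only [Real.rpow_one, abs_of_pos (hf _)] using this
  have hg1' : G.Integrable g := by
    have : G.Integrable fun x => |g x| ^ (1 : ℝ) := hg1
    simpa only [Real.rpow_one, abs_of_nonneg (hg _)] using this
  have hadm : ∀ p : ℝ, q ≤ p → p < α + 1 → G.MemL (p / (p - 1 + γ)) f → ∀ lam : ℝ, 0 < lam →
      lam < lamStar p γ α μ₀ a₀ (G.normL (p / (p - 1 + γ)) f) (supNorm g) →
      G.Admissible μ₀ a₀ b₀ p q γ α lam a b f g := fun p hqp hpα hfp lam hl0 hl =>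
    ⟨hμ₀, hμ, hγ0, hγ1, hq, hqp, hpα, ha₀, ha, hb₀, hb, hf, hf1', hfp, hg, hg0, hg1', hginf,
      hl0, hl⟩
  refine ⟨fun p hqp hpα hfp lam hl0 hl => ?_, fun M => ?_⟩
  · have H := hadm p hqp hpα hfp lam hl0 hl
    obtain ⟨u, hne, huD, hu⟩ := H.exists_nehariPlus_solution
    obtain ⟨v, hvD, hv⟩ := H.exists_nehariMinus_solution
    have hbu := H.bounds_of_mem_nehariPlus hne huD
    have hbv := H.bounds_of_mem_nehariMinus hvD
    refine ⟨u, v, ?_, hu, hv, huD, hvD, hbv.1, H.X₀_lt_X, hbu.1, hbv.2.1, ?_, hbu.2, hbv.2.2⟩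
    · rintro rfl
      exact lt_asymm (hbu.1.trans H.X₀_lt_X) hbv.1
    · exact boundS₀_lt_boundS (by linarith) H.slope_pos H.gap_pos hμ₀ ha₀ H.normL_pos
        H.supNorm_pos hl0 hl
  · obtain ⟨x, -⟩ := hg0
    obtain ⟨δ, hδ, hδM⟩ := exists_lt_boundX₀ (α := α) hγ0 hγ1 hq ha₀ (hf x) (G.meas_pos x) M
    refine ⟨δ, hδ, fun p hqp hpα hpδ hfp lam hl0 hl => ?_⟩
    have H := hadm p hqp hpα hfp lam hl0 hl
    refine ⟨(hδM p hqp hpα hpδ _ ?_).trans H.X₀_lt_X, fun v hv => ?_⟩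
    · exact G.mul_rpow_le_normL (div_pos (by linarith) H.slope_pos) hfp (fun y => (hf y).le) x
    · have := H.bounds_of_mem_nehariMinus hv
      exact ⟨this.1, this.2.2⟩
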